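/- \textbf{Conventions.} Metrics are smooth, of signature $(+,+,+,-)$, on an open set $U\subset\mathbb R^4$. A vacuum (Ricci-flat) metric $g$ is \emph{algebraically special} with respect to a nowhere zero, affinely parametrized null vector field $k$ if $k$ is geodesic and shearfree and is a repeated principal null vector of the conformal tensor ($\Psi_0=\Psi_1=0$). For a null tetrad $(m,\bar m,l,k)$ with $ds^2=2(m\bar m-kl)$ the complex divergence of $k$ is $m^a\bar m^b k_{a;b}$; $k$ is \emph{diverging} if this never vanishes, and then real functions $r,\Sigma$ (the latter up to sign) are defined by $m^a\bar m^bk_{a;b}=1/(r+i\Sigma)$. The metric is \emph{stationary} if there is a Killing field $\xi$ of the type $V\partial_u$, normalized against $k$: $[\xi,k]=0$, $g(k,\xi)=-1$, $\nabla_\xi k\parallel k$. (The last condition says that $\xi$ annihilates the complex coordinate $\zeta$ for which $m^ak_{a;b}dx^b\propto d\bar\zeta$.) In expressions such as $k^2$, $k$ also denotes the 1-form $k_a dx^a$. \emph{Canonical form.} In coordinates $(\zeta,\bar\zeta,r,u)$, with real functions $P>0$, $\Sigma$, $H$ and complex functions $L$, $W$, $P$ and $L$ independent of $r$, $r^2+\Sigma^2\neq0$,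 $$ds^2=2(\omega^1\omega^2-\omega^3\omega^4),\quad \omega^1=\overline{\omega^2}=\frac{(r-i\Sigma)\,d\zeta}{P},\quad \omega^3=du+L\,d\zeta+\bar L\,d\bar\zeta,\quad \omega^4=dr+W\,d\zeta+\bar W\,d\bar\zeta+H\omega^3,$$ with $k=\partial_r$ (so that the 1-form $k$ is $\omega^3$ up to sign), and, with $m=\frac{P}{r-i\Sigma}(\partial_\zeta-W\partial_r-L\partial_u)$, $m^ak_{a;b}dx^b=d\bar\zeta/P$ (so that the complex divergence is $1/(r+i\Sigma)$). \emph{Quasi-stationary solutions.} Let $P>0$, $L$ (complex) and $A$ (real) be smooth functions of $(\zeta,\bar\zeta)$ alone, $c$ a real constant, $\nabla=P^2\partial_\zeta\partial_{\bar\zeta}$, $\Sigma=P^2\,\mathrm{Im}(L_{\bar\zeta})$, $r^2+\Sigma^2\ne0$, and suppose $$\nabla[\nabla(\ln P)]=c,\qquad M=2\Sigma\nabla(\ln P)+\nabla\Sigma,\qquad m=cu+A,\qquad cL=(A+iM)_\zeta .$$ The corresponding quasi-stationary metric is the one above with $W=i\Sigma_\zeta$ and $H=\nabla(\ln P)-\dfrac{mr+M\Sigma}{r^2+\Sigma^2}$.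 \textbf{Theorem.} (1) Let $ds_0^2$ be a stationary diverging algebraically special vacuum metric on an open set $U$, with $k,\xi,r,\Sigma$ as above. Then for every real constant $m_0$ the metric $$ds_0^2+\frac{2m_0r}{r^2+\Sigma^2}\,k^2$$ is again a stationary diverging algebraically special vacuum metric on $U$, with the same $k,\xi,r,\Sigma$. (2) Let $(P,L,A,c)$ be a solution of the quasi-stationary field equations and $ds_0^2$ its metric, on an open set $U$. Then $ds_0^2$ is a diverging algebraically special vacuum metric in canonical form with respect to $k=\partial_r$, the functions $r,\Sigma$ being those belonging to its complex divergence. For every real constant $m_0$, $(P,L,A+m_0,c)$ is again a solution of the quasi-stationary field equations, and its metric is $ds_0^2+\frac{2m_0r}{r^2+\Sigma^2}k^2$; in particular the latter is again a diverging algebraically special vacuum metric with the same $k,r,\Sigma$. (3) Conversely, let $ds_0^2$ be any diverging algebraically special vacuum metric in canonical form on a connected open set $U$ (with $P,L$ allowed to depend on $\zeta,\bar\zeta,u$). If for one constant $m_0\neq0$ the metric $ds_0^2+\frac{2m_0r}{r^2+\Sigma^2}k^2$ is also an algebraically special vacuum metric with respect to $k=\partial_r$, then $ds_0^2$ is quasi-stationary: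 there are a constant $c$ and a function $A$ such that $P,L,A$ depend on $(\zeta,\bar\zeta)$ alone, $(P,L,A,c)$ solves the quasi-stationary field equations on $U$, and $\Sigma,W,H$ are given by the formulas above. -/

import Mathlib

open scoped ContDiff

/-- Points of a coordinate patch. For the special coordinates used below, `x 0 + i x 1 = ζ`,
`x 2 = r` and `x 3 = u`. -/
abbrev Pt : Type := Fin 4 → ℝ

/-- Tensors with two lower indices, in coordinates. -/
abbrev Ten2 : Type := Matrix (Fin 4) (Fin 4) ℝ

noncomputable section

/-! ### Levi-Civita connection and curvature in coordinates -/

/-- Partial derivative along the `i`-th coordinate. -/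
def pd {F : Type} [NormedAddCommGroup F] [NormedSpace ℝ F] (i : Fin 4) (f : Pt → F) (x : Pt) : F :=
  fderiv ℝ f x (Pi.single i 1)

/-- Christoffel symbols `Γ^a_{bc}` of the metric `g`. -/
def christoffel (g : Pt → Ten2) (a b c : Fin 4) (x : Pt) : ℝ :=
  (1 / 2) * ∑ d, (g x)⁻¹ a d *
    (pd b (fun y => g y d c) x + pd c (fun y => g y d b) x - pd d (fun y => g y b c) x)

/-- Curvature tensor `R^a_{bcd}`. -/
def riemannUp (g : Pt → Ten2) (a b c d : Fin 4) (x : Pt) : ℝ :=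
  pd c (christoffel g a b d) x - pd d (christoffel g a b c) x
    + ∑ e, (christoffel g a c e x * christoffel g e b d x
      - christoffel g a d e x * christoffel g e b c x)

/-- Curvature tensor `R_{abcd}` with all indices lowered. -/
def riemann (g : Pt → Ten2) (a b c d : Fin 4) (x : Pt) : ℝ :=
  ∑ e, g x a e * riemannUp g e b c d x

/-- Ricci tensor `R_{bd} = R^a_{bad}`. -/
def ricci (g : Pt → Ten2) (b d : Fin 4) (x : Pt) : ℝ :=
  ∑ a, riemannUp g a b a d x

/-- Covariant derivative `k^a_{;b}` of a vector field. -/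
def covDeriv (g : Pt → Ten2) (k : Pt → Fin 4 → ℝ) (a b : Fin 4) (x : Pt) : ℝ :=
  pd b (fun y => k y a) x + ∑ c, christoffel g a b c x * k x c

/-- The tensor `k_{a;b}`. -/
def covDerivLow (g : Pt → Ten2) (k : Pt → Fin 4 → ℝ) (x : Pt) : Ten2 :=
  Matrix.of fun a b => ∑ c, g x a c * covDeriv g k c b x

/-- The covector `k_a`. -/
def lower (g : Pt → Ten2) (k : Pt → Fin 4 → ℝ) (x : Pt) (a : Fin 4) : ℝ :=
  ∑ c, g x a c * k x c

/-- Symmetric of signature `(+,+,+,-)`. -/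
def IsLorentzian (G : Ten2) : Prop :=
  ∃ S : Ten2, IsUnit S.det ∧ S.transpose * G * S = Matrix.diagonal ![1, 1, 1, -1]

/-! ### Complex null tetrads -/

/-- A real vector regarded as a complex one. -/
def cvec (v : Fin 4 → ℝ) : Fin 4 → ℂ := fun a => (v a : ℂ)

/-- Complex bilinear extension of a real tensor: `T_{ab} v^a w^b`. -/
def cform (T : Ten2) (v w : Fin 4 → ℂ) : ℂ :=
  ∑ a, ∑ b, (T a b : ℂ) * v a * w b

/-- The curvature component `R_{abcd} v^a w^b y^c z^d`. -/
def riemannForm (g : Pt → Ten2) (x : Pt) (v w y z : Fin 4 → ℂ) : ℂ :=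
  ∑ a, ∑ b, ∑ c, ∑ d, (riemann g a b c d x : ℂ) * v a * w b * y c * z d

/-- `(m, \bar m, l, k)` is a null tetrad for `G`, that is `ds² = 2 (m \bar m - k l)`. -/
structure IsNullTetrad (G : Ten2) (m : Fin 4 → ℂ) (l k : Fin 4 → ℝ) : Prop where
  m_m : cform G m m = 0
  m_conj : cform G m (star m) = 1
  m_l : cform G m (cvec l) = 0
  m_k : cform G m (cvec k) = 0
  l_l : cform G (cvec l) (cvec l) = 0
  k_k : cform G (cvec k) (cvec k) = 0
  k_l : cform G (cvec k) (cvec l) = -1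

/-! ### Diverging algebraically special vacuum metrics -/

/-- `g` is a smooth Lorentzian vacuum metric on `U`, algebraically special with respect to the
affinely parametrized null vector field `k`: `k` is geodesic and shearfree and it is a repeated
principal null vector of the conformal tensor (`Ψ₀ = Ψ₁ = 0`; in vacuum the conformal tensor is
the curvature tensor). -/
structure IsAlgSpecialVacuum (U : Set Pt) (g : Pt → Ten2) (k : Pt → Fin 4 → ℝ) : Prop where
  smooth_g : ∀ a b, ContDiffOn ℝ ∞ (fun x => g x a b) U
  lorentzian : ∀ x ∈ U, IsLorentzian (g x)
  vacuum : ∀ x ∈ U, ∀ a b, ricci g a b x = 0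
  smooth_k : ContDiffOn ℝ ∞ k U
  ne_zero : ∀ x ∈ U, k x ≠ 0
  null : ∀ x ∈ U, ∑ a, lower g k x a * k x a = 0
  geodesic : ∀ x ∈ U, ∀ a, ∑ b, covDeriv g k a b x * k x b = 0
  shearfree : ∀ x ∈ U, ∀ m l, IsNullTetrad (g x) m l (k x) → cform (covDerivLow g k x) m m = 0
  psi0 : ∀ x ∈ U, ∀ m l, IsNullTetrad (g x) m l (k x) →
    riemannForm g x (cvec (k x)) m (cvec (k x)) m = 0
  psi1 : ∀ x ∈ U, ∀ m l, IsNullTetrad (g x) m l (k x) →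
    riemannForm g x (cvec (k x)) (cvec l) (cvec (k x)) m = 0

/-- `k` is diverging on `U`, with `r` and `s` the functions (the second one written `Σ` in the
mathematics) for which `r + iΣ` is the reciprocal of the complex divergence
`m^a \bar m^b k_{a;b}` of `k`. These determine `r`, and `Σ` up to its sign (the orientation
of `m`, `\bar m`). -/
def IsDiverging (U : Set Pt) (g : Pt → Ten2) (k : Pt → Fin 4 → ℝ) (r s : Pt → ℝ) : Prop :=
  ∀ x ∈ U, ∃ m l, IsNullTetrad (g x) m l (k x) ∧
    ((r x : ℂ) + Complex.I * (s x : ℂ)) * cform (covDerivLow g k x) m (star m) = 1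

/-- `ξ` makes `(g, k)` stationary on `U`: it is a Killing field which preserves the congruence,
which is normalized against `k`, and which is of the type `V ∂_u`, i.e. it acts trivially on the
complex coordinate `ζ` defined by `Γ₄₁ = m^a k_{a;b} dx^b = d\bar ζ / P`: this says that
`m^a k_{a;b} ξ^b = 0`, or equivalently that `ξ^b k^a_{;b}` is a multiple of `k^a`. -/
structure IsStationaryFor (U : Set Pt) (g : Pt → Ten2) (k ξ : Pt → Fin 4 → ℝ) : Prop where
  smooth : ContDiffOn ℝ ∞ ξ U
  killing : ∀ x ∈ U, ∀ a b,
    ∑ c, (ξ x c * pd c (fun y => g y a b) x + g x c b * pd a (fun y => ξ y c) x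
      + g x a c * pd b (fun y => ξ y c) x) = 0
  commute : ∀ x ∈ U, ∀ a,
    ∑ c, (ξ x c * pd c (fun y => k y a) x - k x c * pd c (fun y => ξ y a) x) = 0
  normalized : ∀ x ∈ U, ∑ a, lower g k x a * ξ x a = -1
  type_one : ∀ x ∈ U, ∃ t : ℝ, ∀ a, ∑ b, covDeriv g k a b x * ξ x b = t * k x a

/-- The metric `ds₀² + 2 m₀ r / (r² + Σ²) k²`. -/
def splitMetric (g : Pt → Ten2) (k : Pt → Fin 4 → ℝ) (r s : Pt → ℝ) (m₀ : ℝ) (x : Pt) : Ten2 :=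
  Matrix.of fun a b =>
    g x a b + 2 * m₀ * r x / (r x ^ 2 + s x ^ 2) * (lower g k x a * lower g k x b)

/-! ### Canonical coordinates `(ζ, \bar ζ, r, u)` -/

/-- The coordinate function `r`. -/
def rCoord (x : Pt) : ℝ := x 2

/-- The vector field `∂_r`. -/
def kRay (_ : Pt) : Fin 4 → ℝ := Pi.single 2 1

/-- `∂/∂ζ` -/
def dz (f : Pt → ℂ) (x : Pt) : ℂ := (1 / 2) * (pd 0 f x - Complex.I * pd 1 f x)

/-- `∂/∂\bar ζ` -/
def dzbar (f : Pt → ℂ) (x : Pt) : ℂ := (1 / 2) * (pd 0 f x + Complex.I * pd 1 f x)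

/-- `∂ f = f_ζ - L f_u` -/
def dTwist (L f : Pt → ℂ) (x : Pt) : ℂ := dz f x - L x * pd 3 f x

/-- The components of the 1-form `dζ`. -/
def dzForm : Fin 4 → ℂ := ![1, Complex.I, 0, 0]

/-- `ω¹ = (r - iΣ) dζ / P`; `ω²` is its complex conjugate. -/
def omega1 (P s : Pt → ℝ) (x : Pt) (a : Fin 4) : ℂ :=
  ((rCoord x : ℂ) - Complex.I * (s x : ℂ)) / (P x : ℂ) * dzForm a

/-- `ω³ = du + L dζ + \bar L d\bar ζ`. -/
def omega3 (L : Pt → ℂ) (x : Pt) (a : Fin 4) : ℝ :=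
  (Pi.single 3 1 : Fin 4 → ℝ) a + 2 * (L x * dzForm a).re

/-- `ω⁴ = dr + W dζ + \bar W d\bar ζ + H ω³`. -/
def omega4 (L W : Pt → ℂ) (H : Pt → ℝ) (x : Pt) (a : Fin 4) : ℝ :=
  (Pi.single 2 1 : Fin 4 → ℝ) a + 2 * (W x * dzForm a).re + H x * omega3 L x a

/-- `ds² = 2 (ω¹ ω² - ω³ ω⁴)`. -/
def canonicalMetric (P s : Pt → ℝ) (L W : Pt → ℂ) (H : Pt → ℝ) (x : Pt) : Ten2 :=
  Matrix.of fun a b =>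
    2 * (omega1 P s x a * star (omega1 P s x b)).re
      - (omega3 L x a * omega4 L W H x b + omega4 L W H x a * omega3 L x b)

/-- The vector `m = P / (r - iΣ) (∂_ζ - W ∂_r - L ∂_u)` of the frame dual to
`(ω¹, ω², ω³, ω⁴)`. -/
def frameM (P s : Pt → ℝ) (L W : Pt → ℂ) (x : Pt) : Fin 4 → ℂ :=
  fun a => (P x : ℂ) / ((rCoord x : ℂ) - Complex.I * (s x : ℂ)) *
    (![1 / 2, -Complex.I / 2, -W x, -L x] : Fin 4 → ℂ) a

/-- `(ζ, r, u)` are canonical coordinates on `U` for the metric with these coefficients: `P` and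
`L` do not depend on `r`, and `Γ₄₁ = m^a k_{a;b} dx^b` equals `d\bar ζ / P`. (Thus
`Γ₄₁ = ω² / (r + iΣ)`: the complex divergence of `k = ∂_r` is `1 / (r + iΣ)`.) -/
structure IsCanonical (U : Set Pt) (P s : Pt → ℝ) (L W : Pt → ℂ) (H : Pt → ℝ) : Prop where
  smooth_P : ContDiffOn ℝ ∞ P U
  smooth_s : ContDiffOn ℝ ∞ s U
  smooth_L : ContDiffOn ℝ ∞ L U
  smooth_W : ContDiffOn ℝ ∞ W U
  smooth_H : ContDiffOn ℝ ∞ H U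
  P_pos : ∀ x ∈ U, 0 < P x
  regular : ∀ x ∈ U, rCoord x ^ 2 + s x ^ 2 ≠ 0
  P_r : ∀ x ∈ U, pd 2 P x = 0
  L_r : ∀ x ∈ U, pd 2 L x = 0
  gamma41 : ∀ x ∈ U, ∀ b,
    ∑ a, frameM P s L W x a * (covDerivLow (canonicalMetric P s L W H) kRay x a b : ℂ)
      = star (dzForm b) / (P x : ℂ)

/-! ### The quasi-stationary field equations -/

/-- `∇ f = P² ∂² f / ∂ζ ∂\bar ζ` -/
def nabla (P f : Pt → ℝ) (x : Pt) : ℝ :=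
  P x ^ 2 * ((1 / 4) * (pd 0 (pd 0 f) x + pd 1 (pd 1 f) x))

/-- `Σ`, defined by `2iΣ = P² (\bar ∂ L - ∂ \bar L)`; for `L` independent of `u` this is
`P² Im (L_{\bar ζ})`. -/
def sigmaOf (P : Pt → ℝ) (L : Pt → ℂ) (x : Pt) : ℝ :=
  P x ^ 2 * (star (dTwist L (fun y => star (L y)) x)).im

/-- `ln P` -/
def logP (P : Pt → ℝ) (x : Pt) : ℝ := Real.log (P x)

/-- `M = 2 Σ ∇(ln P) + ∇ Σ` -/
def MOf (P : Pt → ℝ) (L : Pt → ℂ) (x : Pt) : ℝ :=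
  2 * sigmaOf P L x * nabla P (logP P) x + nabla P (sigmaOf P L) x

/-- `m = c u + A` -/
def massOf (A : Pt → ℝ) (c : ℝ) (x : Pt) : ℝ := c * x 3 + A x

/-- `W = i Σ_ζ` -/
def WOf (P : Pt → ℝ) (L : Pt → ℂ) (x : Pt) : ℂ :=
  Complex.I * dz (fun y => (sigmaOf P L y : ℂ)) x

/-- `H = K / 2 - (m r + M Σ) / (r² + Σ²)` with `K = 2 ∇(ln P)`. -/
def HOf (P : Pt → ℝ) (L : Pt → ℂ) (A : Pt → ℝ) (c : ℝ) (x : Pt) : ℝ :=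
  nabla P (logP P) x
    - (massOf A c x * rCoord x + MOf P L x * sigmaOf P L x) / (rCoord x ^ 2 + sigmaOf P L x ^ 2)

/-- The metric determined by `P`, `L` and `m = c u + A`. -/
def quasiMetric (P : Pt → ℝ) (L : Pt → ℂ) (A : Pt → ℝ) (c : ℝ) : Pt → Ten2 :=
  canonicalMetric P (sigmaOf P L) L (WOf P L) (HOf P L A c)

/-- `P`, `L` and `A` are functions of `(ζ, \bar ζ)` alone and satisfy the quasi-stationary field
equations with the constant `c`:
`∇[∇(ln P)] = c`, `M = 2 Σ ∇(ln P) + ∇ Σ`, `m = c u + A`, `c L = (A + i M)_ζ`. -/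
structure IsQuasiStationary (U : Set Pt) (P : Pt → ℝ) (L : Pt → ℂ) (A : Pt → ℝ) (c : ℝ) :
    Prop where
  smooth_P : ContDiffOn ℝ ∞ P U
  smooth_L : ContDiffOn ℝ ∞ L U
  smooth_A : ContDiffOn ℝ ∞ A U
  P_pos : ∀ x ∈ U, 0 < P x
  regular : ∀ x ∈ U, rCoord x ^ 2 + sigmaOf P L x ^ 2 ≠ 0
  P_r : ∀ x ∈ U, pd 2 P x = 0
  P_u : ∀ x ∈ U, pd 3 P x = 0
  L_r : ∀ x ∈ U, pd 2 L x = 0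
  L_u : ∀ x ∈ U, pd 3 L x = 0
  A_r : ∀ x ∈ U, pd 2 A x = 0
  A_u : ∀ x ∈ U, pd 3 A x = 0
  eq_P : ∀ x ∈ U, nabla P (nabla P (logP P)) x = c
  eq_L : ∀ x ∈ U,
    (c : ℂ) * L x = dz (fun y => (A y : ℂ) + Complex.I * (MOf P L y : ℂ)) x

end

/-! Write ρ = 1/(r + iΣ) for the complex divergence. Then r/(r² + Σ²) = Re ρ, so adding the mass
term is the Kerr-Schild transformation g ↦ g + 2V k² with V = m₀ Re ρ = τ(ρ + ρ̄), τ = m₀/2. All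
computations take place in a null frame (m, m̄, l, k) adapted to k. There the transformation only
replaces l by l + Vk and changes the rotation coefficients by explicit terms
(`IsNullFrame.kerrSchild`). The rotation coefficients are determined by the commutators
(`IsFrame.nab_eq`), and the curvature follows from them algebraically and by differentiation along
the frame.

Let D, δ, Δ be the derivatives along k, m, l, and let T, μ be defined by ∇_m k = ρ̄ m - T k and ∇_m
l = μ m + T l. In vacuum the Sachs equation Dρ = -ρ² holds, and with it all Ricci components survive
the transformation except two (`ks_ricci_ml`, `ks_ricci_ll`): the ml component changes by -6τTρ²,
and, if T = 0, the ll component changes by -3τ[(ρ + ρ̄)(Δρ + Δρ̄) + (μ + μ̄)(ρ² + ρ̄²)]. Both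
changes vanish if T = 0 and some function h satisfies Δρ = hρ², Δρ̄ = hρ̄² and μ + μ̄ = -h(ρ + ρ̄),
so that ρ is constant along l + hk (`IsNullFrame.split_vacuum`).

In the stationary case ξ = l + hk for a suitable null frame. The Killing equation gives T = 0 and
the relation for μ, and the Bianchi identities then give ξρ = 0 (`IsNullFrame.l_ρ`).

In the quasi-stationary case ∂_u = l + Hk plays the role of ξ. It annihilates P, L, Σ and W, hence
ρ, and this suffices although H may depend on u, so that ∂_u need not be a Killing field. With H =
∇(ln P) - Re(ρ(m + iM)) the vacuum equations reduce to δ(m + iM) = 0 and m_u = ∇[∇(ln P)]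
(`ricci_ml_eq`, `ricci_ll_eq`), which are the quasi-stationary field equations.

Conversely, if a canonical vacuum metric splits for one m₀ ≠ 0, the ml defect forces L_u = 0. The ll
defect then collapses to a multiple of m₀ρρ̄P_u/P, so P_u = 0, and δρ = 0 gives W = iΣ_ζ. Two vacuum
equations determine the r-dependence of H and produce m; the other two, together with connectedness
of U, show that ∇[∇(ln P)] is a constant c and that m = cu + A. -/

noncomputable section

/-! ### Partial derivatives of smooth functions -/

section Calculus

variable {F : Type} [NormedAddCommGroup F] [NormedSpace ℝ F] {U : Set Pt} {x : Pt}

theorem differentiableAt_of_smooth {f : Pt → F} (hU : IsOpen U) (hf : ContDiffOn ℝ ∞ f U)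
    (hx : x ∈ U) : DifferentiableAt ℝ f x :=
  (hf.contDiffAt (hU.mem_nhds hx)).differentiableAt (by simp)

theorem smooth_pd {f : Pt → F} (hU : IsOpen U) (hf : ContDiffOn ℝ ∞ f U) (i : Fin 4) :
    ContDiffOn ℝ ∞ (pd i f) U :=
  (hf.fderiv_of_isOpen hU (m := ∞) (by simp)).clm_apply contDiffOn_const

theorem pd_congr {f g : Pt → F} (hU : IsOpen U) (h : ∀ y ∈ U, f y = g y) (hx : x ∈ U)
    (i : Fin 4) : pd i f x = pd i g x := by
  unfold pd
  rw [Filter.EventuallyEq.fderiv_eq (Filter.eventuallyEq_of_mem (hU.mem_nhds hx) h)]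

theorem pd_comm {f : Pt → F} (hU : IsOpen U) (hf : ContDiffOn ℝ ∞ f U) (hx : x ∈ U)
    (i j : Fin 4) : pd i (pd j f) x = pd j (pd i f) x := by
  have hfd : DifferentiableAt ℝ (fderiv ℝ f) x :=
    differentiableAt_of_smooth hU (hf.fderiv_of_isOpen hU (m := ∞) (by simp)) hx
  have key : ∀ v w : Pt, fderiv ℝ (fun y => fderiv ℝ f y v) x w = fderiv ℝ (fderiv ℝ f) x w v := by
    intro v w
    rw [fderiv_clm_apply hfd (differentiableAt_const v)]
    simp
  have hs : IsSymmSndFDerivAt ℝ f x :=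
    (hf.contDiffAt (hU.mem_nhds hx)).isSymmSndFDerivAt (by
      simp only [minSmoothness_of_isRCLikeNormedField]
      exact WithTop.coe_le_coe.2 (le_top : (2 : ℕ∞) ≤ ⊤))
  change fderiv ℝ (fun y => fderiv ℝ f y _) x _ = fderiv ℝ (fun y => fderiv ℝ f y _) x _
  rw [key, key]
  exact hs _ _

theorem pd_const (i : Fin 4) (c : F) : pd i (fun _ => c) x = 0 := by simp [pd]

theorem pd_add {f g : Pt → F} (i : Fin 4) (hf : DifferentiableAt ℝ f x)
    (hg : DifferentiableAt ℝ g x) : pd i (fun y => f y + g y) x = pd i f x + pd i g x := by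
  simp only [pd]
  rw [fderiv_fun_add hf hg]; rfl

theorem pd_sub {f g : Pt → F} (i : Fin 4) (hf : DifferentiableAt ℝ f x)
    (hg : DifferentiableAt ℝ g x) : pd i (fun y => f y - g y) x = pd i f x - pd i g x := by
  simp only [pd]
  rw [fderiv_fun_sub hf hg]; rfl

theorem pd_neg {f : Pt → F} (i : Fin 4) : pd i (fun y => -f y) x = -pd i f x := by
  simp only [pd]
  rw [fderiv_fun_neg]; rfl

theorem pd_sum {ι : Type} (s : Finset ι) {f : ι → Pt → F} (i : Fin 4)
    (hf : ∀ j ∈ s, DifferentiableAt ℝ (f j) x) :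
    pd i (fun y => ∑ j ∈ s, f j y) x = ∑ j ∈ s, pd i (f j) x := by
  simp only [pd]
  rw [fderiv_fun_sum hf]
  simp

theorem pd_mul {A : Type} [NormedCommRing A] [NormedAlgebra ℝ A] {f g : Pt → A} (i : Fin 4)
    (hf : DifferentiableAt ℝ f x) (hg : DifferentiableAt ℝ g x) :
    pd i (fun y => f y * g y) x = pd i f x * g x + f x * pd i g x := by
  simp only [pd]
  rw [fderiv_fun_mul hf hg]
  simp [mul_comm, add_comm]

theorem pd_clm {G : Type} [NormedAddCommGroup G] [NormedSpace ℝ G] (T : F →L[ℝ] G) {f : Pt → F}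
    (i : Fin 4) (hf : DifferentiableAt ℝ f x) : pd i (fun y => T (f y)) x = T (pd i f x) := by
  simp only [pd]
  have h : HasFDerivAt (fun y => T (f y)) (T.comp (fderiv ℝ f x)) x :=
    T.hasFDerivAt.comp x hf.hasFDerivAt
  rw [h.fderiv]; rfl

theorem pd_ofReal {f : Pt → ℝ} (i : Fin 4) (hf : DifferentiableAt ℝ f x) :
    pd i (fun y => (f y : ℂ)) x = ((pd i f x : ℝ) : ℂ) :=
  pd_clm Complex.ofRealCLM i hf

theorem pd_star {f : Pt → ℂ} (i : Fin 4) :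
    pd i (fun y => star (f y)) x = star (pd i f x) := by
  simp only [pd]
  change fderiv ℝ (fun y => Complex.conjCLE (f y)) x _ = _
  rw [show (fun y => Complex.conjCLE (f y)) = Complex.conjCLE ∘ f from rfl,
    ContinuousLinearEquiv.comp_fderiv]
  rfl

theorem pd_re {f : Pt → ℂ} (i : Fin 4) (hf : DifferentiableAt ℝ f x) :
    pd i (fun y => (f y).re) x = (pd i f x).re :=
  pd_clm Complex.reCLM i hf

theorem pd_im {f : Pt → ℂ} (i : Fin 4) (hf : DifferentiableAt ℝ f x) :
    pd i (fun y => (f y).im) x = (pd i f x).im :=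
  pd_clm Complex.imCLM i hf

theorem pd_inv {f : Pt → ℂ} (i : Fin 4) (hf : DifferentiableAt ℝ f x) (h0 : f x ≠ 0) :
    pd i (fun y => (f y)⁻¹) x = -(f x)⁻¹ ^ 2 * pd i f x := by
  have h1 : HasFDerivAt (fun y => (f y)⁻¹) (((-(f x ^ 2)⁻¹) : ℂ) • fderiv ℝ f x) x :=
    (hasDerivAt_inv h0).comp_hasFDerivAt_of_eq x hf.hasFDerivAt rfl
  simp only [pd]
  rw [h1.fderiv]
  simp

theorem smooth_ofReal {f : Pt → ℝ} (hf : ContDiffOn ℝ ∞ f U) :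
    ContDiffOn ℝ ∞ (fun y => (f y : ℂ)) U :=
  Complex.ofRealCLM.contDiff.comp_contDiffOn hf

theorem smooth_star {f : Pt → ℂ} (hf : ContDiffOn ℝ ∞ f U) :
    ContDiffOn ℝ ∞ (fun y => star (f y)) U :=
  Complex.conjCLE.contDiff.comp_contDiffOn hf

theorem smooth_re {f : Pt → ℂ} (hf : ContDiffOn ℝ ∞ f U) :
    ContDiffOn ℝ ∞ (fun y => (f y).re) U :=
  Complex.reCLM.contDiff.comp_contDiffOn hf

theorem smooth_im {f : Pt → ℂ} (hf : ContDiffOn ℝ ∞ f U) :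
    ContDiffOn ℝ ∞ (fun y => (f y).im) U :=
  Complex.imCLM.contDiff.comp_contDiffOn hf

/-! ### Complex vector fields -/

/-- The derivative of `f` along the complex vector field `X`. -/
def dd (X : Pt → Fin 4 → ℂ) (f : Pt → ℂ) (x : Pt) : ℂ := ∑ a, X x a * pd a f x

/-- The commutator of complex vector fields. -/
def br (X Y : Pt → Fin 4 → ℂ) (x : Pt) (a : Fin 4) : ℂ :=
  dd X (fun y => Y y a) x - dd Y (fun y => X y a) x

variable {X Y : Pt → Fin 4 → ℂ} {f g : Pt → ℂ}

theorem smooth_apply (hX : ContDiffOn ℝ ∞ X U) (a : Fin 4) :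
    ContDiffOn ℝ ∞ (fun y => X y a) U := contDiffOn_pi.1 hX a

theorem smooth_dd (hU : IsOpen U) (hX : ContDiffOn ℝ ∞ X U) (hf : ContDiffOn ℝ ∞ f U) :
    ContDiffOn ℝ ∞ (dd X f) U :=
  ContDiffOn.sum fun a _ => (smooth_apply hX a).mul (smooth_pd hU hf a)

theorem dd_congr (hU : IsOpen U) (h : ∀ y ∈ U, f y = g y) (hx : x ∈ U) :
    dd X f x = dd X g x := by
  simp only [dd, pd_congr hU h hx]

theorem dd_const (c : ℂ) : dd X (fun _ => c) x = 0 := by simp [dd, pd_const]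

theorem dd_neg : dd X (fun y => -f y) x = -dd X f x := by simp [dd, pd_neg]

theorem dd_add (hf : DifferentiableAt ℝ f x) (hg : DifferentiableAt ℝ g x) :
    dd X (fun y => f y + g y) x = dd X f x + dd X g x := by
  simp [dd, pd_add _ hf hg, mul_add, Finset.sum_add_distrib]

theorem dd_sub (hf : DifferentiableAt ℝ f x) (hg : DifferentiableAt ℝ g x) :
    dd X (fun y => f y - g y) x = dd X f x - dd X g x := by
  simp [dd, pd_sub _ hf hg, mul_sub, Finset.sum_sub_distrib]

theorem dd_mul (hf : DifferentiableAt ℝ f x) (hg : DifferentiableAt ℝ g x) :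
    dd X (fun y => f y * g y) x = dd X f x * g x + f x * dd X g x := by
  simp only [dd, pd_mul _ hf hg, Finset.sum_mul, Finset.mul_sum, ← Finset.sum_add_distrib]
  exact Finset.sum_congr rfl fun a _ => by ring

theorem dd_sum {ι : Type} (s : Finset ι) {f : ι → Pt → ℂ}
    (hf : ∀ j ∈ s, DifferentiableAt ℝ (f j) x) :
    dd X (fun y => ∑ j ∈ s, f j y) x = ∑ j ∈ s, dd X (f j) x := by
  simp only [dd, pd_sum s _ hf, Finset.mul_sum]
  exact Finset.sum_comm

theorem dd_star : dd (fun y => star (X y)) (fun y => star (f y)) x = star (dd X f x) := by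
  simp only [dd, pd_star, star_sum, star_mul']
  rfl

/-- Mixed partial derivatives commute, so the second-order terms of the two iterated derivatives
agree and only derivatives of the components survive; these form the bracket. -/
theorem dd_commutator (hU : IsOpen U) (hX : ContDiffOn ℝ ∞ X U) (hY : ContDiffOn ℝ ∞ Y U)
    (hf : ContDiffOn ℝ ∞ f U) (hx : x ∈ U) :
    dd X (dd Y f) x - dd Y (dd X f) x = ∑ a, br X Y x a * pd a f x := by
  have h1 : ∀ {X Y : Pt → Fin 4 → ℂ}, ContDiffOn ℝ ∞ X U → ContDiffOn ℝ ∞ Y U →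
      dd X (dd Y f) x = (∑ a, dd X (fun y => Y y a) x * pd a f x)
        + ∑ b, ∑ a, X x b * Y x a * pd b (pd a f) x := by
    intro X Y hX hY
    change dd X (fun y => ∑ a, Y y a * pd a f y) x = _
    rw [dd_sum]
    · rw [Finset.sum_comm, ← Finset.sum_add_distrib]
      refine Finset.sum_congr rfl fun a _ => ?_
      rw [dd_mul (differentiableAt_of_smooth hU (smooth_apply hY a) hx)
        (differentiableAt_of_smooth hU (smooth_pd hU hf a) hx)]
      congr 1
      simp only [dd, Finset.mul_sum]
      exact Finset.sum_congr rfl fun b _ => by ring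
    · intro a _
      exact differentiableAt_of_smooth hU ((smooth_apply hY a).mul (smooth_pd hU hf a)) hx
  rw [h1 hX hY, h1 hY hX]
  have h2 : ∑ b, ∑ a, X x b * Y x a * pd b (pd a f) x
      = ∑ b, ∑ a, Y x b * X x a * pd b (pd a f) x := by
    rw [Finset.sum_comm]
    refine Finset.sum_congr rfl fun a _ => Finset.sum_congr rfl fun b _ => ?_
    rw [pd_comm hU hf hx b a]; ring
  rw [h2]
  simp only [br, sub_mul, Finset.sum_sub_distrib]
  ring

end Calculus

/-! ### The Levi-Civita connection on complex vector fields -/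

/-- Smooth nondegenerate symmetric bilinear forms on an open set. -/
structure IsSmoothMetric (U : Set Pt) (g : Pt → Ten2) : Prop where
  isOpen : IsOpen U
  smooth : ∀ a b, ContDiffOn ℝ ∞ (fun x => g x a b) U
  symm : ∀ x ∈ U, ∀ a b, g x a b = g x b a
  det : ∀ x ∈ U, IsUnit (g x).det

/-- The covariant derivative `∇_c Y^a` of a complex vector field. -/
def cd (g : Pt → Ten2) (c : Fin 4) (Y : Pt → Fin 4 → ℂ) (x : Pt) (a : Fin 4) : ℂ :=
  pd c (fun y => Y y a) x + ∑ d, (christoffel g a c d x : ℂ) * Y x d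

/-- The covariant derivative `∇_X Y` of complex vector fields. -/
def nab (g : Pt → Ten2) (X Y : Pt → Fin 4 → ℂ) (x : Pt) (a : Fin 4) : ℂ :=
  ∑ c, X x c * cd g c Y x a

/-- The curvature operator `R(X, Y) Z`. -/
def curv (g : Pt → Ten2) (X Y Z : Pt → Fin 4 → ℂ) (x : Pt) (a : Fin 4) : ℂ :=
  ∑ c, ∑ d, X x c * Y x d * ∑ b, (riemannUp g a b c d x : ℂ) * Z x b

namespace IsSmoothMetric

variable {U : Set Pt} {g : Pt → Ten2} {x : Pt} (hg : IsSmoothMetric U g)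
include hg

theorem smooth_inv (a b : Fin 4) : ContDiffOn ℝ ∞ (fun x => (g x)⁻¹ a b) U := by
  have hdet : ∀ A : Pt → Ten2, (∀ a b, ContDiffOn ℝ ∞ (fun x => A x a b) U) →
      ContDiffOn ℝ ∞ (fun x => (A x).det) U := by
    intro A hA
    simp only [Matrix.det_apply']
    exact ContDiffOn.sum fun σ _ => contDiffOn_const.mul (contDiffOn_prod fun i _ => hA _ _)
  -- Cramer's rule makes the entries of the inverse smooth.
  have h1 : ContDiffOn ℝ ∞ (fun x => ((g x).det)⁻¹ * (g x).adjugate a b) U := by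
    refine ContDiffOn.mul ((hdet g hg.smooth).inv fun x hx => (hg.det x hx).ne_zero) ?_
    simp only [Matrix.adjugate_apply]
    refine hdet _ fun i j => ?_
    by_cases h : i = b
    · subst h; simpa using contDiffOn_const
    · simpa [Matrix.updateRow_ne h] using hg.smooth i j
  refine h1.congr fun x _ => ?_
  rw [Matrix.inv_def]
  simp

theorem smooth_christoffel (a b c : Fin 4) : ContDiffOn ℝ ∞ (christoffel g a b c) U := by
  have h : ∀ i a b, ContDiffOn ℝ ∞ (pd i (fun y => g y a b)) U :=
    fun i a b => smooth_pd hg.isOpen (hg.smooth a b) i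
  exact contDiffOn_const.mul (ContDiffOn.sum fun d _ => (hg.smooth_inv a d).mul
    (((h _ _ _).add (h _ _ _)).sub (h _ _ _)))

theorem pd_symm (hx : x ∈ U) (i a b : Fin 4) :
    pd i (fun y => g y a b) x = pd i (fun y => g y b a) x :=
  pd_congr hg.isOpen (fun y hy => hg.symm y hy a b) hx i

theorem christoffel_symm (hx : x ∈ U) (a b c : Fin 4) :
    christoffel g a b c x = christoffel g a c b x := by
  simp only [christoffel]
  congr 1
  refine Finset.sum_congr rfl fun d _ => ?_
  rw [hg.pd_symm hx d b c]; ring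

theorem lower_christoffel (hx : x ∈ U) (e b c : Fin 4) :
    ∑ a, g x e a * christoffel g a b c x = (1 / 2) * (pd b (fun y => g y e c) x
      + pd c (fun y => g y e b) x - pd e (fun y => g y b c) x) := by
  have h1 : ∀ e d, ∑ a, g x e a * (g x)⁻¹ a d = if e = d then 1 else 0 := by
    intro e d
    rw [← Matrix.mul_apply, Matrix.mul_nonsing_inv _ (hg.det x hx), Matrix.one_apply]
  simp only [christoffel, Finset.mul_sum]
  rw [Finset.sum_comm]
  have h2 : ∀ d, ∑ a, g x e a * ((1 / 2) * ((g x)⁻¹ a d * (pd b (fun y => g y d c) x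
      + pd c (fun y => g y d b) x - pd d (fun y => g y b c) x)))
      = (∑ a, g x e a * (g x)⁻¹ a d) * ((1 / 2) * (pd b (fun y => g y d c) x
      + pd c (fun y => g y d b) x - pd d (fun y => g y b c) x)) := by
    intro d
    rw [Finset.sum_mul]
    exact Finset.sum_congr rfl fun a _ => by ring
  simp only [h2, h1, ite_mul, one_mul, zero_mul, Finset.sum_ite_eq, Finset.mem_univ, if_true]

/-- Metric compatibility: in the sum of the two lowered Christoffel symbols every derivative of `g`
cancels except ∂_c g_ab, which occurs twice with factor 1/2. -/
theorem pd_metric (hx : x ∈ U) (c a b : Fin 4) :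
    pd c (fun y => g y a b) x = ∑ d, (g x d b * christoffel g d c a x
      + g x a d * christoffel g d c b x) := by
  rw [Finset.sum_add_distrib]
  simp only [hg.symm x hx _ b]
  rw [hg.lower_christoffel hx, hg.lower_christoffel hx, hg.pd_symm hx c b a, hg.pd_symm hx a b c,
    hg.pd_symm hx b c a]
  ring

end IsSmoothMetric

/-! ### Bilinear algebra of the complexified metric -/

section Forms

variable {U : Set Pt} {g : Pt → Ten2} {x : Pt}

theorem cform_add_left (T : Ten2) (v w z : Fin 4 → ℂ) :
    cform T (v + w) z = cform T v z + cform T w z := by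
  simp only [cform, Pi.add_apply, ← Finset.sum_add_distrib]
  exact Finset.sum_congr rfl fun a _ => Finset.sum_congr rfl fun b _ => by ring

theorem cform_add_right (T : Ten2) (v w z : Fin 4 → ℂ) :
    cform T v (w + z) = cform T v w + cform T v z := by
  simp only [cform, Pi.add_apply, ← Finset.sum_add_distrib]
  exact Finset.sum_congr rfl fun a _ => Finset.sum_congr rfl fun b _ => by ring

theorem cform_smul_left (T : Ten2) (c : ℂ) (v w : Fin 4 → ℂ) :
    cform T (c • v) w = c * cform T v w := by
  simp only [cform, Pi.smul_apply, smul_eq_mul, Finset.mul_sum]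
  exact Finset.sum_congr rfl fun a _ => Finset.sum_congr rfl fun b _ => by ring

theorem cform_smul_right (T : Ten2) (c : ℂ) (v w : Fin 4 → ℂ) :
    cform T v (c • w) = c * cform T v w := by
  simp only [cform, Pi.smul_apply, smul_eq_mul, Finset.mul_sum]
  exact Finset.sum_congr rfl fun a _ => Finset.sum_congr rfl fun b _ => by ring

theorem cform_sub_left (T : Ten2) (v w z : Fin 4 → ℂ) :
    cform T (v - w) z = cform T v z - cform T w z := by
  simp only [cform, Pi.sub_apply, ← Finset.sum_sub_distrib]
  exact Finset.sum_congr rfl fun a _ => Finset.sum_congr rfl fun b _ => by ring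

theorem cform_sub_right (T : Ten2) (v w z : Fin 4 → ℂ) :
    cform T v (w - z) = cform T v w - cform T v z := by
  simp only [cform, Pi.sub_apply, ← Finset.sum_sub_distrib]
  exact Finset.sum_congr rfl fun a _ => Finset.sum_congr rfl fun b _ => by ring

theorem cform_zero_left (T : Ten2) (v : Fin 4 → ℂ) : cform T 0 v = 0 := by simp [cform]

theorem cform_zero_right (T : Ten2) (v : Fin 4 → ℂ) : cform T v 0 = 0 := by simp [cform]

theorem cform_sum_left {ι : Type} (s : Finset ι) (T : Ten2) (v : ι → Fin 4 → ℂ) (w : Fin 4 → ℂ) :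
    cform T (∑ i ∈ s, v i) w = ∑ i ∈ s, cform T (v i) w := by
  classical
  induction s using Finset.induction_on with
  | empty => simp [cform_zero_left]
  | insert i s hi ih => rw [Finset.sum_insert hi, Finset.sum_insert hi, cform_add_left, ih]

theorem cform_sum_right {ι : Type} (s : Finset ι) (T : Ten2) (v : ι → Fin 4 → ℂ)
    (w : Fin 4 → ℂ) : cform T w (∑ i ∈ s, v i) = ∑ i ∈ s, cform T w (v i) := by
  classical
  induction s using Finset.induction_on with
  | empty => simp [cform_zero_right]
  | insert i s hi ih => rw [Finset.sum_insert hi, Finset.sum_insert hi, cform_add_right, ih]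

theorem cform_star (T : Ten2) (v w : Fin 4 → ℂ) :
    cform T (star v) (star w) = star (cform T v w) := by
  simp [cform, star_sum]

theorem IsSmoothMetric.cform_comm (hg : IsSmoothMetric U g) (hx : x ∈ U) (v w : Fin 4 → ℂ) :
    cform (g x) v w = cform (g x) w v := by
  simp only [cform]
  rw [Finset.sum_comm]
  refine Finset.sum_congr rfl fun a _ => Finset.sum_congr rfl fun b _ => ?_
  rw [hg.symm x hx]; ring

end Forms

namespace IsSmoothMetric

variable {U : Set Pt} {g : Pt → Ten2} {x : Pt} {X Y Z : Pt → Fin 4 → ℂ}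

theorem smooth_cform (hg : IsSmoothMetric U g) (hX : ContDiffOn ℝ ∞ X U)
    (hY : ContDiffOn ℝ ∞ Y U) : ContDiffOn ℝ ∞ (fun y => cform (g y) (X y) (Y y)) U :=
  ContDiffOn.sum fun a _ => ContDiffOn.sum fun b _ =>
    ((smooth_ofReal (hg.smooth a b)).mul (smooth_apply hX a)).mul (smooth_apply hY b)

theorem smooth_cd (hg : IsSmoothMetric U g) (hX : ContDiffOn ℝ ∞ X U) (c : Fin 4) :
    ContDiffOn ℝ ∞ (cd g c X) U :=
  contDiffOn_pi.2 fun a => (smooth_pd hg.isOpen (smooth_apply hX a) c).add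
    (ContDiffOn.sum fun d _ => (smooth_ofReal (hg.smooth_christoffel a c d)).mul
      (smooth_apply hX d))

theorem smooth_nab (hg : IsSmoothMetric U g) (hX : ContDiffOn ℝ ∞ X U)
    (hY : ContDiffOn ℝ ∞ Y U) : ContDiffOn ℝ ∞ (nab g X Y) U :=
  contDiffOn_pi.2 fun a => ContDiffOn.sum fun c _ =>
    (smooth_apply hX c).mul (smooth_apply (hg.smooth_cd hY c) a)

/-- Vanishing torsion: the Christoffel terms drop out by symmetry. -/
theorem nab_sub_nab (hg : IsSmoothMetric U g) (hx : x ∈ U) :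
    nab g X Y x - nab g Y X x = br X Y x := by
  funext a
  simp only [Pi.sub_apply, nab, cd, br, dd, mul_add, Finset.sum_add_distrib]
  have : ∑ c, X x c * ∑ d, (christoffel g a c d x : ℂ) * Y x d
      = ∑ c, Y x c * ∑ d, (christoffel g a c d x : ℂ) * X x d := by
    simp only [Finset.mul_sum]
    rw [Finset.sum_comm]
    refine Finset.sum_congr rfl fun d _ => Finset.sum_congr rfl fun c _ => ?_
    rw [hg.christoffel_symm hx]; ring
  rw [this]; ring

theorem pd_cform (hg : IsSmoothMetric U g) (hX : ContDiffOn ℝ ∞ X U) (hY : ContDiffOn ℝ ∞ Y U)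
    (hx : x ∈ U) (c : Fin 4) : pd c (fun y => cform (g y) (X y) (Y y)) x
      = cform (g x) (cd g c X x) (Y x) + cform (g x) (X x) (cd g c Y x) := by
  have hU := hg.isOpen
  have dX := fun a => differentiableAt_of_smooth hU (smooth_apply hX a) hx
  have dY := fun a => differentiableAt_of_smooth hU (smooth_apply hY a) hx
  have dg := fun a b => differentiableAt_of_smooth hU (smooth_ofReal (hg.smooth a b)) hx
  have h1 : pd c (fun y => cform (g y) (X y) (Y y)) x = ∑ a, ∑ b,
      (((pd c (fun y => g y a b) x : ℝ) : ℂ) * X x a * Y x b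
      + ((g x a b : ℂ) * pd c (fun y => X y a) x * Y x b
        + (g x a b : ℂ) * X x a * pd c (fun y => Y y b) x)) := by
    unfold cform
    rw [pd_sum _ _ fun a _ => DifferentiableAt.fun_sum fun b _ =>
      ((dg a b).fun_mul (dX a)).fun_mul (dY b)]
    refine Finset.sum_congr rfl fun a _ => ?_
    rw [pd_sum _ _ fun b _ => ((dg a b).fun_mul (dX a)).fun_mul (dY b)]
    refine Finset.sum_congr rfl fun b _ => ?_
    rw [pd_mul _ ((dg a b).fun_mul (dX a)) (dY b), pd_mul _ (dg a b) (dX a),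
      pd_ofReal _ (differentiableAt_of_smooth hU (hg.smooth a b) hx)]
    ring
  have h2 : ∑ a, ∑ b, ((pd c (fun y => g y a b) x : ℝ) : ℂ) * X x a * Y x b
      = ∑ a, ∑ b, ((g x a b : ℂ) * (∑ d, (christoffel g a c d x : ℂ) * X x d) * Y x b
        + (g x a b : ℂ) * X x a * ∑ d, (christoffel g b c d x : ℂ) * Y x d) := by
    simp only [Finset.sum_add_distrib]
    have e1 : ∑ a, ∑ b, (g x a b : ℂ) * (∑ d, (christoffel g a c d x : ℂ) * X x d) * Y x b
        = ∑ a, ∑ b, ∑ d, (g x d b : ℂ) * (christoffel g d c a x : ℂ) * X x a * Y x b := by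
      calc _ = ∑ a, ∑ b, ∑ d, (g x a b : ℂ) * (christoffel g a c d x : ℂ) * X x d * Y x b := by
            refine Finset.sum_congr rfl fun a _ => Finset.sum_congr rfl fun b _ => ?_
            rw [Finset.mul_sum, Finset.sum_mul]
            exact Finset.sum_congr rfl fun d _ => by ring
        _ = ∑ b, ∑ a, ∑ d, (g x a b : ℂ) * (christoffel g a c d x : ℂ) * X x d * Y x b :=
            Finset.sum_comm
        _ = ∑ b, ∑ d, ∑ a, (g x a b : ℂ) * (christoffel g a c d x : ℂ) * X x d * Y x b :=
            Finset.sum_congr rfl fun b _ => Finset.sum_comm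
        _ = _ := Finset.sum_comm
    have e2 : ∑ a, ∑ b, (g x a b : ℂ) * X x a * (∑ d, (christoffel g b c d x : ℂ) * Y x d)
        = ∑ a, ∑ b, ∑ d, (g x a d : ℂ) * (christoffel g d c b x : ℂ) * X x a * Y x b := by
      refine Finset.sum_congr rfl fun a _ => ?_
      rw [Finset.sum_comm' (t' := Finset.univ) (s' := fun _ => Finset.univ) (by simp)]
      refine Finset.sum_congr rfl fun b _ => ?_
      rw [Finset.mul_sum]
      exact Finset.sum_congr rfl fun d _ => by ring
    rw [e1, e2, ← Finset.sum_add_distrib]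
    refine Finset.sum_congr rfl fun a _ => ?_
    rw [← Finset.sum_add_distrib]
    refine Finset.sum_congr rfl fun b _ => ?_
    rw [← Finset.sum_add_distrib, hg.pd_metric hx]
    push_cast
    rw [Finset.sum_mul, Finset.sum_mul]
    exact Finset.sum_congr rfl fun d _ => by ring
  rw [h1]
  simp only [Finset.sum_add_distrib] at h2 ⊢
  rw [h2]
  simp only [cform, cd, mul_add, add_mul, Finset.sum_add_distrib]
  ring

/-- Metric compatibility for complex fields. Applied to the constant inner products of a frame it
yields the antisymmetry of the rotation coefficients. -/
theorem dd_cform (hg : IsSmoothMetric U g) (hY : ContDiffOn ℝ ∞ Y U) (hZ : ContDiffOn ℝ ∞ Z U)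
    (hx : x ∈ U) : dd X (fun y => cform (g y) (Y y) (Z y)) x
      = cform (g x) (nab g X Y x) (Z x) + cform (g x) (Y x) (nab g X Z x) := by
  have h : ∀ Y : Pt → Fin 4 → ℂ, nab g X Y x = ∑ c, X x c • cd g c Y x := by
    intro Y; funext a; simp [nab]
  simp only [h, cform_sum_left, cform_sum_right, cform_smul_left, cform_smul_right, dd,
    hg.pd_cform hY hZ hx, mul_add, Finset.sum_add_distrib]

/-- The Ricci identity: second derivatives of `Z` commute, terms with one derivative of `Z` are
symmetric in `c` and `d`, and what remains is the curvature. -/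
theorem cd_comm (hg : IsSmoothMetric U g) (hZ : ContDiffOn ℝ ∞ Z U) (hx : x ∈ U)
    (a c d : Fin 4) : cd g c (cd g d Z) x a - cd g d (cd g c Z) x a
      = ∑ b, (riemannUp g a b c d x : ℂ) * Z x b := by
  have hU := hg.isOpen
  have dG := fun a b c => differentiableAt_of_smooth hU (hg.smooth_christoffel a b c) hx
  have dGc := fun a b c =>
    differentiableAt_of_smooth hU (smooth_ofReal (hg.smooth_christoffel a b c)) hx
  have dZ := fun a => differentiableAt_of_smooth hU (smooth_apply hZ a) hx
  have dZ' := fun a c => differentiableAt_of_smooth hU (smooth_pd hU (smooth_apply hZ a) c) hx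
  have h1 : ∀ c d, cd g c (cd g d Z) x a = pd c (pd d (fun y => Z y a)) x
      + (∑ b, (christoffel g a d b x : ℂ) * pd c (fun y => Z y b) x
        + ∑ b, (christoffel g a c b x : ℂ) * pd d (fun y => Z y b) x)
      + (∑ b, ((pd c (christoffel g a d b) x : ℝ) : ℂ) * Z x b
        + ∑ b, ∑ e, (christoffel g a c e x : ℂ) * (christoffel g e d b x : ℂ) * Z x b) := by
    intro c d
    have e1 : pd c (fun y => cd g d Z y a) x = pd c (pd d (fun y => Z y a)) x
        + (∑ b, ((pd c (christoffel g a d b) x : ℝ) : ℂ) * Z x b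
        + ∑ b, (christoffel g a d b x : ℂ) * pd c (fun y => Z y b) x) := by
      unfold cd
      rw [pd_add _ (dZ' a d) (DifferentiableAt.fun_sum fun b _ => (dGc _ _ _).fun_mul (dZ b)),
        pd_sum _ _ fun b _ => (dGc _ _ _).fun_mul (dZ b), ← Finset.sum_add_distrib]
      congr 1
      refine Finset.sum_congr rfl fun b _ => ?_
      rw [pd_mul _ (dGc _ _ _) (dZ b), pd_ofReal _ (dG _ _ _)]
    have e2 : ∑ e, (christoffel g a c e x : ℂ) * cd g d Z x e
        = ∑ b, (christoffel g a c b x : ℂ) * pd d (fun y => Z y b) x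
        + ∑ b, ∑ e, (christoffel g a c e x : ℂ) * (christoffel g e d b x : ℂ) * Z x b := by
      rw [Finset.sum_comm, ← Finset.sum_add_distrib]
      refine Finset.sum_congr rfl fun e _ => ?_
      rw [cd, mul_add, Finset.mul_sum]
      congr 1
      exact Finset.sum_congr rfl fun b _ => by ring
    rw [cd, e1, e2]; ring
  rw [h1, h1, pd_comm hU (smooth_apply hZ a) hx c d]
  have h2 : ∑ b, (riemannUp g a b c d x : ℂ) * Z x b
      = (∑ b, ((pd c (christoffel g a d b) x : ℝ) : ℂ) * Z x b
        + ∑ b, ∑ e, (christoffel g a c e x : ℂ) * (christoffel g e d b x : ℂ) * Z x b)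
      - (∑ b, ((pd d (christoffel g a c b) x : ℝ) : ℂ) * Z x b
        + ∑ b, ∑ e, (christoffel g a d e x : ℂ) * (christoffel g e c b x : ℂ) * Z x b) := by
    simp only [← Finset.sum_add_distrib, ← Finset.sum_sub_distrib]
    refine Finset.sum_congr rfl fun b _ => ?_
    rw [riemannUp, pd_congr hU (fun y hy => hg.christoffel_symm hy a b d) hx,
      pd_congr hU (fun y hy => hg.christoffel_symm hy a b c) hx]
    push_cast
    rw [add_mul, Finset.sum_mul]
    simp only [sub_mul, Finset.sum_sub_distrib, hg.christoffel_symm hx _ b]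
    ring
  rw [h2]; ring

theorem nab_nab (hg : IsSmoothMetric U g) (hY : ContDiffOn ℝ ∞ Y U) (hZ : ContDiffOn ℝ ∞ Z U)
    (hx : x ∈ U) (a : Fin 4) : nab g X (nab g Y Z) x a
      = ∑ d, dd X (fun y => Y y d) x * cd g d Z x a
        + ∑ c, ∑ d, X x c * Y x d * cd g c (cd g d Z) x a := by
  have hU := hg.isOpen
  have dY := fun a => differentiableAt_of_smooth hU (smooth_apply hY a) hx
  have dC := fun c a => differentiableAt_of_smooth hU (smooth_apply (hg.smooth_cd hZ c) a) hx
  have h1 : ∀ c, cd g c (nab g Y Z) x a = ∑ d, (pd c (fun y => Y y d) x * cd g d Z x a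
      + Y x d * cd g c (cd g d Z) x a) := by
    intro c
    rw [cd]
    unfold nab
    rw [pd_sum _ _ fun d _ => (dY d).fun_mul (dC d a)]
    simp only [Finset.mul_sum]
    rw [Finset.sum_comm, ← Finset.sum_add_distrib]
    refine Finset.sum_congr rfl fun d _ => ?_
    rw [pd_mul _ (dY d) (dC d a)]
    rw [show cd g c (cd g d Z) x a = pd c (fun y => cd g d Z y a) x
      + ∑ e, (christoffel g a c e x : ℂ) * cd g d Z x e from rfl, mul_add, Finset.mul_sum,
        add_assoc]
    congr 2
    exact Finset.sum_congr rfl fun e _ => by ring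
  rw [nab]
  simp only [h1, Finset.mul_sum, mul_add, Finset.sum_add_distrib]
  congr 1
  · rw [Finset.sum_comm]
    refine Finset.sum_congr rfl fun d _ => ?_
    rw [dd, Finset.sum_mul]
    exact Finset.sum_congr rfl fun c _ => by ring
  · exact Finset.sum_congr rfl fun c _ => Finset.sum_congr rfl fun d _ => by ring

/-- The derivatives of `X` and `Y` split off by `nab_nab` make up the term with the bracket; the
rest is `cd_comm`. This identifies the coordinate curvature with an operator that can be computed in
any frame. -/
theorem curv_eq (hg : IsSmoothMetric U g) (hX : ContDiffOn ℝ ∞ X U) (hY : ContDiffOn ℝ ∞ Y U)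
    (hZ : ContDiffOn ℝ ∞ Z U) (hx : x ∈ U) :
    curv g X Y Z x = nab g X (nab g Y Z) x - nab g Y (nab g X Z) x - nab g (br X Y) Z x := by
  funext a
  simp only [Pi.sub_apply]
  rw [hg.nab_nab hY hZ hx, hg.nab_nab hX hZ hx]
  simp only [curv, ← hg.cd_comm hZ hx, mul_sub, Finset.sum_sub_distrib, nab, br, sub_mul]
  have : ∑ c, ∑ d, X x c * Y x d * cd g d (cd g c Z) x a
      = ∑ d, ∑ c, Y x d * X x c * cd g d (cd g c Z) x a := by
    rw [Finset.sum_comm]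
    exact Finset.sum_congr rfl fun c _ => Finset.sum_congr rfl fun d _ => by ring
  rw [this]; ring

end IsSmoothMetric

/-! ### Null frames -/

/-- The Gram matrix of a null frame `(m, \bar m, l, k)`. -/
def eta : Fin 4 → Fin 4 → ℂ :=
  ![![0, 1, 0, 0], ![1, 0, 0, 0], ![0, 0, 0, -1], ![0, 0, -1, 0]]

section Pointwise

variable {G : Ten2} {e : Fin 4 → Fin 4 → ℂ}

theorem gram_matrix (h : ∀ i j, cform G (e i) (e j) = eta i j) :
    Matrix.of e * (G.map Complex.ofReal * (Matrix.of e).transpose) = Matrix.of eta := by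
  ext i j
  rw [Matrix.of_apply, ← h i j]
  simp only [Matrix.mul_apply, cform, Matrix.map_apply, Matrix.transpose_apply, Matrix.of_apply,
    Finset.mul_sum]
  exact Finset.sum_congr rfl fun a _ => Finset.sum_congr rfl fun b _ => by ring

theorem det_eta : (Matrix.of eta).det = 1 := by
  simp [eta, Matrix.det_succ_row_zero, Fin.sum_univ_succ, Fin.succAbove]

theorem det_frame_ne_zero (h : ∀ i j, cform G (e i) (e j) = eta i j) :
    (Matrix.of e).det ≠ 0 := by
  have := congrArg Matrix.det (gram_matrix h)
  rw [Matrix.det_mul, det_eta] at this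
  exact left_ne_zero_of_mul_eq_one this

theorem det_ne_zero_of_gram (h : ∀ i j, cform G (e i) (e j) = eta i j) : IsUnit G.det := by
  have := congrArg Matrix.det (gram_matrix h)
  rw [Matrix.det_mul, Matrix.det_mul, det_eta] at this
  have h1 : (G.map Complex.ofReal).det ≠ 0 := by
    intro h0; rw [h0] at this; simp at this
  have h2 : (G.map Complex.ofReal).det = ((G.det : ℝ) : ℂ) :=
    (RingHom.map_det Complex.ofRealHom G).symm
  rw [h2] at h1
  exact isUnit_iff_ne_zero.2 (by exact_mod_cast h1)

theorem eq_zero_of_cform_frame (h : ∀ i j, cform G (e i) (e j) = eta i j) {w : Fin 4 → ℂ}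
    (hw : ∀ k, cform G w (e k) = 0) : w = 0 := by
  have h1 : (G.map Complex.ofReal * (Matrix.of e).transpose).det ≠ 0 := by
    have := congrArg Matrix.det (gram_matrix h)
    rw [Matrix.det_mul, det_eta] at this
    exact right_ne_zero_of_mul_eq_one this
  refine Matrix.eq_zero_of_vecMul_eq_zero h1 ?_
  ext k
  have := hw k
  simp only [cform] at this
  simp only [Matrix.vecMul, dotProduct, Matrix.mul_apply, Matrix.map_apply,
    Matrix.transpose_apply, Matrix.of_apply, Finset.mul_sum, Pi.zero_apply]
  rw [← this]
  exact Finset.sum_congr rfl fun a _ => Finset.sum_congr rfl fun b _ => by ring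

theorem eq_of_cform_frame (h : ∀ i j, cform G (e i) (e j) = eta i j) {v w : Fin 4 → ℂ}
    (hw : ∀ k, cform G v (e k) = cform G w (e k)) : v = w :=
  sub_eq_zero.1 (eq_zero_of_cform_frame h fun k => by rw [cform_sub_left, hw k, sub_self])

theorem cform_frame_sum (h : ∀ i j, cform G (e i) (e j) = eta i j) (c : Fin 4 → ℂ) (j : Fin 4) :
    cform G (∑ k, c k • e k) (e j) = ∑ k, c k * eta k j := by
  simp only [cform_sum_left, cform_smul_left, h]

/-- `eta` pairs m with m̄ and l with k, so each coefficient is an inner product with the partner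
vector, with a minus sign for l and k. -/
theorem frame_expansion (h : ∀ i j, cform G (e i) (e j) = eta i j) (v : Fin 4 → ℂ) :
    v = cform G v (e 1) • e 0 + cform G v (e 0) • e 1 - cform G v (e 3) • e 2
      - cform G v (e 2) • e 3 := by
  refine eq_of_cform_frame h fun k => ?_
  simp only [cform_sub_left, cform_add_left, cform_smul_left, h]
  fin_cases k <;> simp [eta]

theorem frame_coeff_unique (h : ∀ i j, cform G (e i) (e j) = eta i j) {c d : Fin 4 → ℂ}
    (hcd : ∑ k, c k • e k = ∑ k, d k • e k) : c = d := by
  have h1 : ∀ j, ∑ k, c k * eta k j = ∑ k, d k * eta k j := fun j => by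
    rw [← cform_frame_sum h, ← cform_frame_sum h, hcd]
  have h0 := h1 0; have h2 := h1 1; have h3 := h1 2; have h4 := h1 3
  simp [eta, Fin.sum_univ_four] at h0 h2 h3 h4
  funext k
  fin_cases k <;> simp_all

end Pointwise

/-- A frame `e` with the Gram matrix of a null tetrad, the commutators of which are
`[e i, e j] = ∑ k, (γ i j k - γ j i k) e k` for rotation coefficients `γ`. -/
structure IsFrame (U : Set Pt) (g : Pt → Ten2) (e : Fin 4 → Pt → Fin 4 → ℂ)
    (γ : Fin 4 → Fin 4 → Fin 4 → Pt → ℂ) : Prop where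
  metric : IsSmoothMetric U g
  smooth : ∀ i, ContDiffOn ℝ ∞ (e i) U
  smooth_coef : ∀ i j k, ContDiffOn ℝ ∞ (γ i j k) U
  gram : ∀ x ∈ U, ∀ i j, cform (g x) (e i x) (e j x) = eta i j
  bracket : ∀ x ∈ U, ∀ i j, br (e i) (e j) x = ∑ k, (γ i j k x - γ j i k x) • e k x
  antisymm : ∀ x ∈ U, ∀ i j k, ∑ n, γ i j n x * eta n k = -∑ n, γ i k n x * eta n j

/-- Components of the curvature operator in a frame. -/
def frameCurv (e : Fin 4 → Pt → Fin 4 → ℂ) (γ : Fin 4 → Fin 4 → Fin 4 → Pt → ℂ)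
    (i j l k : Fin 4) (x : Pt) : ℂ :=
  dd (e i) (γ j l k) x - dd (e j) (γ i l k) x
    + (∑ n, γ j l n x * γ i n k x - ∑ n, γ i l n x * γ j n k x)
    - ∑ n, (γ i j n x - γ j i n x) * γ n l k x

/-- Components of the Ricci tensor in a frame. -/
def frameRicci (e : Fin 4 → Pt → Fin 4 → ℂ) (γ : Fin 4 → Fin 4 → Fin 4 → Pt → ℂ)
    (l j : Fin 4) (x : Pt) : ℂ :=
  ∑ i, frameCurv e γ i j l i x

theorem nab_congr {U : Set Pt} {g : Pt → Ten2} {x : Pt} {X Y Z : Pt → Fin 4 → ℂ} (hU : IsOpen U)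
    (h : ∀ y ∈ U, Y y = Z y) (hx : x ∈ U) : nab g X Y x = nab g X Z x := by
  funext a
  simp only [nab, cd, pd_congr hU (fun y hy => congrFun (h y hy) a) hx, h x hx]

theorem nab_left (g : Pt → Ten2) (X : Pt → Fin 4 → ℂ) (Y : Pt → Fin 4 → ℂ) (x : Pt)
    (c : Fin 4 → ℂ) (e : Fin 4 → Pt → Fin 4 → ℂ) (h : X x = ∑ k, c k • e k x) :
    nab g X Y x = ∑ k, c k • nab g (e k) Y x := by
  funext a
  simp only [nab, h, Finset.sum_apply, Pi.smul_apply, smul_eq_mul, Finset.sum_mul,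
    Finset.mul_sum]
  rw [Finset.sum_comm]
  exact Finset.sum_congr rfl fun _ _ => Finset.sum_congr rfl fun _ _ => by ring

theorem nab_sum {U : Set Pt} {g : Pt → Ten2} {x : Pt} {X : Pt → Fin 4 → ℂ} (hU : IsOpen U)
    {c : Fin 4 → Pt → ℂ} {e : Fin 4 → Pt → Fin 4 → ℂ} (hc : ∀ k, ContDiffOn ℝ ∞ (c k) U)
    (he : ∀ k, ContDiffOn ℝ ∞ (e k) U) (hx : x ∈ U) :
    nab g X (fun y => ∑ k, c k y • e k y) x
      = ∑ k, (dd X (c k) x • e k x + c k x • nab g X (e k) x) := by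
  funext a
  have dc := fun k => differentiableAt_of_smooth hU (hc k) hx
  have de := fun k a => differentiableAt_of_smooth hU (smooth_apply (he k) a) hx
  have h1 : ∀ b, cd g b (fun y => ∑ k, c k y • e k y) x a
      = ∑ k, (pd b (c k) x * e k x a + c k x * cd g b (e k) x a) := by
    intro b
    simp only [cd, Finset.sum_apply, Pi.smul_apply, smul_eq_mul]
    rw [pd_sum _ _ fun k _ => (dc k).fun_mul (de k a)]
    simp only [Finset.mul_sum]
    rw [Finset.sum_comm, ← Finset.sum_add_distrib]
    refine Finset.sum_congr rfl fun k _ => ?_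
    rw [pd_mul _ (dc k) (de k a), mul_add, Finset.mul_sum, add_assoc]
    congr 2
    exact Finset.sum_congr rfl fun _ _ => by ring
  simp only [nab, h1, Finset.sum_apply, Pi.add_apply, Pi.smul_apply, smul_eq_mul, Finset.mul_sum,
    dd, Finset.sum_mul]
  rw [Finset.sum_comm]
  refine Finset.sum_congr rfl fun k _ => ?_
  rw [← Finset.sum_add_distrib]
  exact Finset.sum_congr rfl fun _ _ => by ring

/-- The first Bianchi identity. In coordinates it is a cancellation by symmetry of the Christoffel
symbols; read in a frame it becomes a set of differential relations between rotation coefficients,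
which are used below alongside the Ricci tensor. -/
theorem curv_bianchi {U : Set Pt} {g : Pt → Ten2} {x : Pt} (hg : IsSmoothMetric U g) (hx : x ∈ U)
    (X Y Z : Pt → Fin 4 → ℂ) : curv g X Y Z x + curv g Y Z X x + curv g Z X Y x = 0 := by
  have h0 : ∀ a b c d, riemannUp g a b c d x + riemannUp g a c d b x + riemannUp g a d b c x
      = 0 := by
    intro a b c d
    have hs := fun a b c => hg.christoffel_symm hx a b c
    have hp := fun i a b c =>
      pd_congr hg.isOpen (fun y hy => hg.christoffel_symm hy a b c) hx i
    simp only [riemannUp, Finset.sum_sub_distrib]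
    rw [hp c a b d, hp d a b c, hp b a c d]
    simp only [hs _ d b, hs _ c b, hs _ d c]
    ring
  funext a
  simp only [Pi.add_apply, Pi.zero_apply, curv, Finset.mul_sum]
  have e2 : ∑ c, ∑ d, ∑ b, Y x c * Z x d * ((riemannUp g a b c d x : ℂ) * X x b)
      = ∑ c, ∑ d, ∑ b, X x c * Y x d * ((riemannUp g a c d b x : ℂ) * Z x b) := by
    rw [Finset.sum_comm' (t' := Finset.univ) (s' := fun _ => Finset.univ) (by simp)]
    rw [Finset.sum_congr rfl fun d _ => Finset.sum_comm, Finset.sum_comm]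
    refine Finset.sum_congr rfl fun c _ => ?_
    rw [Finset.sum_comm]
    exact Finset.sum_congr rfl fun d _ => Finset.sum_congr rfl fun b _ => by ring
  have e3 : ∑ c, ∑ d, ∑ b, Z x c * X x d * ((riemannUp g a b c d x : ℂ) * Y x b)
      = ∑ c, ∑ d, ∑ b, X x c * Y x d * ((riemannUp g a d b c x : ℂ) * Z x b) := by
    rw [Finset.sum_comm]
    refine Finset.sum_congr rfl fun c _ => ?_
    rw [Finset.sum_comm]
    exact Finset.sum_congr rfl fun d _ => Finset.sum_congr rfl fun b _ => by ring
  rw [e2, e3]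
  simp only [← Finset.sum_add_distrib]
  refine Finset.sum_eq_zero fun c _ => Finset.sum_eq_zero fun d _ =>
    Finset.sum_eq_zero fun b _ => ?_
  have := congrArg (fun t : ℝ => (t : ℂ)) (h0 a b c d)
  push_cast at this
  linear_combination X x c * Y x d * Z x b * this

theorem riemannForm_eq (g : Pt → Ten2) (x : Pt) (v w y z : Fin 4 → ℂ) :
    riemannForm g x v w y z
      = cform (g x) v (curv g (fun _ => y) (fun _ => z) (fun _ => w) x) := by
  simp only [riemannForm, cform, curv, riemann, Complex.ofReal_sum, Complex.ofReal_mul,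
    Finset.mul_sum, Finset.sum_mul]
  refine Finset.sum_congr rfl fun a _ => ?_
  rw [Finset.sum_congr rfl fun b _ => Finset.sum_congr rfl fun c _ => Finset.sum_comm,
    Finset.sum_congr rfl fun b _ => Finset.sum_comm, Finset.sum_comm]
  refine Finset.sum_congr rfl fun n _ => ?_
  rw [Finset.sum_comm]
  refine Finset.sum_congr rfl fun c _ => ?_
  rw [Finset.sum_comm]
  refine Finset.sum_congr rfl fun d _ => Finset.sum_congr rfl fun b _ => ?_
  ring

/-! ### Connection, curvature and Ricci tensor in a frame -/

namespace IsFrame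

variable {U : Set Pt} {g : Pt → Ten2} {e : Fin 4 → Pt → Fin 4 → ℂ}
  {γ : Fin 4 → Fin 4 → Fin 4 → Pt → ℂ} {x : Pt} (H : IsFrame U g e γ)
include H

theorem cform_bracket (hx : x ∈ U) (i j k : Fin 4) :
    cform (g x) (br (e i) (e j) x) (e k x)
      = ∑ n, γ i j n x * eta n k - ∑ n, γ j i n x * eta n k := by
  rw [H.bracket x hx, cform_frame_sum (H.gram x hx)]
  simp only [sub_mul, Finset.sum_sub_distrib]

/-- Uniqueness of the Levi-Civita connection: the `γ` are antisymmetric (compatibility) and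
reproduce the commutators (torsion zero), so they must be its coefficients. Hence only commutators
ever have to be computed. -/
theorem nab_eq (hx : x ∈ U) (i j : Fin 4) :
    nab g (e i) (e j) x = ∑ k, γ i j k x • e k x := by
  have hg := H.metric
  have compat : ∀ i j k, cform (g x) (nab g (e i) (e j) x) (e k x)
      = -cform (g x) (nab g (e i) (e k) x) (e j x) := by
    intro i j k
    have h1 := hg.dd_cform (X := e i) (H.smooth j) (H.smooth k) hx
    rw [dd_congr hg.isOpen (fun y hy => H.gram y hy j k) hx, dd_const,
      hg.cform_comm hx (e j x)] at h1
    linear_combination -h1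
  have torsion : ∀ i j k, cform (g x) (nab g (e i) (e j) x) (e k x)
      = cform (g x) (nab g (e j) (e i) x) (e k x)
        + (∑ n, γ i j n x * eta n k - ∑ n, γ j i n x * eta n k) := by
    intro i j k
    rw [← H.cform_bracket hx, ← hg.nab_sub_nab hx, cform_sub_left]
    ring
  refine eq_of_cform_frame (H.gram x hx) fun k => ?_
  rw [cform_frame_sum (H.gram x hx)]
  have a1 := compat i j k
  have a2 := compat j i k
  have a3 := compat k i j
  have t1 := torsion i j k
  have t2 := torsion i k j
  have t3 := torsion j k i
  have b1 := H.antisymm x hx i j k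
  have b2 := H.antisymm x hx j i k
  have b3 := H.antisymm x hx k i j
  -- The Koszul combination: the alternating sum over the three index pairs isolates a single inner
  -- product.
  linear_combination (1 / 2) * (t1 + a2 - t3 - a3 - t2 + a1 - b1 - b2 + b3)

theorem curv_eq (hx : x ∈ U) (i j l : Fin 4) :
    curv g (e i) (e j) (e l) x = ∑ k, frameCurv e γ i j l k x • e k x := by
  have hg := H.metric
  have h1 : ∀ i j, nab g (e i) (nab g (e j) (e l)) x
      = ∑ k, (dd (e i) (γ j l k) x + ∑ n, γ j l n x * γ i n k x) • e k x := by
    intro i j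
    rw [nab_congr hg.isOpen (fun y hy => H.nab_eq hy j l) hx,
      nab_sum hg.isOpen (fun k => H.smooth_coef j l k) H.smooth hx, Finset.sum_add_distrib]
    simp only [add_smul, Finset.sum_add_distrib, H.nab_eq hx, Finset.smul_sum, Finset.sum_smul,
      smul_smul]
    rw [Finset.sum_comm (f := fun a b => (γ j l a x * γ i a b x) • e b x)]
  have h2 : nab g (br (e i) (e j)) (e l) x
      = ∑ k, (∑ n, (γ i j n x - γ j i n x) * γ n l k x) • e k x := by
    rw [nab_left g _ _ x _ e (H.bracket x hx i j)]
    simp only [H.nab_eq hx, Finset.smul_sum, Finset.sum_smul, smul_smul]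
    rw [Finset.sum_comm]
  rw [hg.curv_eq (H.smooth i) (H.smooth j) (H.smooth l) hx, h1, h1, h2,
    ← Finset.sum_sub_distrib, ← Finset.sum_sub_distrib]
  refine Finset.sum_congr rfl fun k _ => ?_
  rw [← sub_smul, ← sub_smul, frameCurv]
  congr 1
  ring

theorem trace_eq (hx : x ∈ U) (A : Matrix (Fin 4) (Fin 4) ℂ) (M : Fin 4 → Fin 4 → ℂ)
    (h : ∀ i, A.mulVec (e i x) = ∑ k, M i k • e k x) : A.trace = ∑ i, M i i := by
  set E : Matrix (Fin 4) (Fin 4) ℂ := (Matrix.of fun i => e i x).transpose with hE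
  have hdet : IsUnit E.det := by
    rw [hE, Matrix.det_transpose]
    exact isUnit_iff_ne_zero.2 (det_frame_ne_zero (H.gram x hx))
  have h1 : A * E = E * (Matrix.of M).transpose := by
    ext a i
    have := congrFun (h i) a
    simp only [Matrix.mulVec, dotProduct, Finset.sum_apply, Pi.smul_apply, smul_eq_mul] at this
    simp only [Matrix.mul_apply, hE, Matrix.transpose_apply, Matrix.of_apply, this]
    exact Finset.sum_congr rfl fun k _ => mul_comm _ _
  have h2 : A = E * (Matrix.of M).transpose * E⁻¹ := by
    rw [← h1, Matrix.mul_nonsing_inv_cancel_right _ _ hdet]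
  rw [h2, Matrix.trace_mul_comm, Matrix.nonsing_inv_mul_cancel_left _ _ hdet,
    Matrix.trace_transpose]
  rfl

/-- The Ricci tensor is the trace of X ↦ R(X, e_j) e_l, taken once in coordinates and once in the
frame; by `trace_eq` the trace does not depend on the basis. -/
theorem ricci_eq (hx : x ∈ U) (l j : Fin 4) :
    ∑ a, ∑ b, (ricci g a b x : ℂ) * e l x a * e j x b = frameRicci e γ l j x := by
  rw [frameRicci, ← H.trace_eq hx
    (Matrix.of fun a c => ∑ d, e j x d * ∑ b, (riemannUp g a b c d x : ℂ) * e l x b)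
    (fun i k => frameCurv e γ i j l k x)]
  · simp only [Matrix.trace, Matrix.diag_apply, Matrix.of_apply, ricci, Complex.ofReal_sum,
      Finset.sum_mul, Finset.mul_sum]
    rw [Finset.sum_congr rfl fun a _ => Finset.sum_comm, Finset.sum_comm]
    refine Finset.sum_congr rfl fun a _ => ?_
    rw [Finset.sum_comm]
    exact Finset.sum_congr rfl fun d _ => Finset.sum_congr rfl fun b _ => by ring
  · intro i
    rw [← H.curv_eq hx]
    funext a
    simp only [Matrix.mulVec, dotProduct, Matrix.of_apply, curv, Finset.sum_mul]
    exact Finset.sum_congr rfl fun c _ => Finset.sum_congr rfl fun d _ => by ring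

theorem frameCurv_bianchi (hx : x ∈ U) (i j l k : Fin 4) :
    frameCurv e γ i j l k x + frameCurv e γ j l i k x + frameCurv e γ l i j k x = 0 := by
  have h1 := curv_bianchi H.metric hx (e i) (e j) (e l)
  rw [H.curv_eq hx, H.curv_eq hx, H.curv_eq hx, ← Finset.sum_add_distrib,
    ← Finset.sum_add_distrib] at h1
  simp only [← add_smul] at h1
  have h2 := frame_coeff_unique (H.gram x hx) (d := 0) (h1.trans (by simp))
  exact congrFun h2 k

end IsFrame

/-- The rotation coefficients of a null frame `(m, \bar m, l, k)` for which `k` is geodesic and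
shearfree, affinely parametrized, and `m` is chosen so that `∇_l k` is a multiple of `k`. -/
structure Coefs where
  (ρ ρb F T Tb μ μb ν j jb a ab q : Pt → ℂ)

/-- The table of the rotation coefficients: `∇_{e i} e_j = ∑ k, γ i j k e k`. -/
def Coefs.γ (c : Coefs) : Fin 4 → Fin 4 → Fin 4 → Pt → ℂ :=
  ![![![-c.a, 0, 0, 0], ![0, c.a, c.ρb, c.μ], ![c.μ, 0, c.T, 0], ![c.ρb, 0, 0, -c.T]],
    ![![c.ab, 0, c.ρ, c.μb], ![0, -c.ab, 0, 0], ![0, c.μb, c.Tb, 0], ![0, c.ρ, 0, -c.Tb]],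
    ![![c.ν, 0, 0, c.j], ![0, -c.ν, 0, c.jb], ![c.jb, c.j, -c.q, 0], ![0, 0, 0, c.q]],
    ![![-c.F, 0, 0, 0], ![0, c.F, 0, 0], ![0, 0, 0, 0], ![0, 0, 0, 0]]]

theorem dd_neg' (X : Pt → Fin 4 → ℂ) (f : Pt → ℂ) (x : Pt) : dd X (-f) x = -dd X f x := dd_neg

theorem dd_zero (X : Pt → Fin 4 → ℂ) (x : Pt) : dd X 0 x = 0 := dd_const 0

theorem Coefs.antisymm (c : Coefs) (i j k : Fin 4) (x : Pt) :
    ∑ n, c.γ i j n x * eta n k = -∑ n, c.γ i k n x * eta n j := by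
  fin_cases i <;> fin_cases j <;> fin_cases k <;>
    simp [Coefs.γ, eta, Fin.sum_univ_four]

/-- A null frame `(m, \bar m, l, k)` with real `l` and `k` and with the rotation coefficients
given by the table of `c`. -/
structure IsNullFrame (U : Set Pt) (g : Pt → Ten2) (e : Fin 4 → Pt → Fin 4 → ℂ) (c : Coefs) :
    Prop extends IsFrame U g e c.γ where
  conj_m : ∀ x ∈ U, e 1 x = star (e 0 x)
  real_l : ∀ x ∈ U, star (e 2 x) = e 2 x
  real_k : ∀ x ∈ U, star (e 3 x) = e 3 x
  conj_ρ : ∀ x ∈ U, c.ρb x = star (c.ρ x)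
  conj_T : ∀ x ∈ U, c.Tb x = star (c.T x)
  conj_μ : ∀ x ∈ U, c.μb x = star (c.μ x)
  conj_j : ∀ x ∈ U, c.jb x = star (c.j x)
  conj_a : ∀ x ∈ U, c.ab x = star (c.a x)
  imag_F : ∀ x ∈ U, star (c.F x) = -c.F x
  imag_ν : ∀ x ∈ U, star (c.ν x) = -c.ν x
  real_q : ∀ x ∈ U, star (c.q x) = c.q x

/-! ### Ricci components of an adapted null frame -/

section Tables

variable (e : Fin 4 → Pt → Fin 4 → ℂ) (c : Coefs) (x : Pt)

theorem ricci_kk : frameRicci e c.γ 3 3 x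
    = -(dd (e 3) c.ρ x + c.ρ x ^ 2) - (dd (e 3) c.ρb x + c.ρb x ^ 2) := by
  simp [frameRicci, frameCurv, Coefs.γ, Fin.sum_univ_four, dd_zero]
  ring

theorem ricci_km : frameRicci e c.γ 3 0 x
    = -(dd (e 0) c.ρ x + c.T x * c.ρ x) - (dd (e 3) c.T x + (c.ρb x + c.F x) * c.T x) := by
  simp [frameRicci, frameCurv, Coefs.γ, Fin.sum_univ_four, dd_neg', dd_zero]
  ring

/-- Although the Ricci tensor is symmetric, this component is written with other coefficients than
`ricci_km`: it supplies D a, which is needed in the transformed ml component. -/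
theorem ricci_mk : frameRicci e c.γ 0 3 x
    = dd (e 3) c.a x - dd (e 0) c.F x + (c.ρb x + c.F x) * c.a x - c.F x * c.T x := by
  simp [frameRicci, frameCurv, Coefs.γ, Fin.sum_univ_four, dd_neg', dd_zero]
  ring

theorem ricci_kl : frameRicci e c.γ 3 2 x
    = -(dd (e 2) c.ρ x + c.ρ x * (c.μb x - c.q x))
      - (dd (e 2) c.ρb x + c.ρb x * (c.μ x - c.q x)) + dd (e 3) c.q x := by
  simp [frameRicci, frameCurv, Coefs.γ, Fin.sum_univ_four, dd_zero]
  ring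

/-- Built into the table: neither ∇_m k nor ∇_m l has an m̄-component, that is, both k and l are
shearfree. -/
theorem ricci_mm : frameRicci e c.γ 0 0 x = 0 := by
  simp [frameRicci, frameCurv, Coefs.γ, Fin.sum_univ_four, dd_neg', dd_zero]

theorem ricci_mmb : frameRicci e c.γ 0 1 x
    = dd (e 0) c.ab x + dd (e 1) c.a x - 2 * c.a x * c.ab x + c.ρ x * c.μ x + c.ρb x * c.μb x
      - (c.ρb x - c.ρ x) * c.ν x + c.F x * (c.μ x - c.μb x) + dd (e 3) c.μb x
      + c.ρ x * c.μb x + dd (e 2) c.ρ x - c.ρ x * c.q x + c.ρ x * c.μb x := by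
  simp [frameRicci, frameCurv, Coefs.γ, Fin.sum_univ_four, dd_neg', dd_zero]
  ring

theorem ricci_ml : frameRicci e c.γ 0 2 x
    = dd (e 2) c.a x + dd (e 0) c.ν x + c.ρb x * c.j x - (c.ν x - c.μ x) * c.a x
      - c.T x * c.ν x + dd (e 3) c.j x := by
  simp [frameRicci, frameCurv, Coefs.γ, Fin.sum_univ_four, dd_neg', dd_zero]
  ring

theorem ricci_ll : frameRicci e c.γ 2 2 x
    = -(dd (e 2) c.μ x + c.μ x * (c.μ x + c.q x) - dd (e 0) c.jb x + c.a x * c.jb x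
        + 2 * c.T x * c.jb x)
      - (dd (e 2) c.μb x + c.μb x * (c.μb x + c.q x) - dd (e 1) c.j x + c.ab x * c.j x
        + 2 * c.Tb x * c.j x) := by
  simp [frameRicci, frameCurv, Coefs.γ, Fin.sum_univ_four, dd_neg', dd_zero]
  ring

/-- The curvature operator is skew with respect to the metric, hence traceless. -/
theorem frameCurv_trace (i j : Fin 4) : ∑ k, frameCurv e c.γ i j k k x = 0 := by
  fin_cases i <;> fin_cases j <;>
    simp [frameCurv, Coefs.γ, Fin.sum_univ_four, dd_neg', dd_zero] <;> ring

end Tables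

namespace IsNullFrame

variable {U : Set Pt} {g : Pt → Ten2} {e : Fin 4 → Pt → Fin 4 → ℂ} {c : Coefs} {x : Pt}
  (H : IsNullFrame U g e c)
include H

/-- Trace of the Bianchi identity: two of its terms are the Ricci components to be compared, and the
third is the trace of a curvature operator, zero by `frameCurv_trace`. -/
theorem ricci_comm (hx : x ∈ U) (l j : Fin 4) :
    frameRicci e c.γ l j x = frameRicci e c.γ j l x := by
  have h1 : ∀ i, frameCurv e c.γ i j l i x + frameCurv e c.γ j l i i x
      - frameCurv e c.γ i l j i x = 0 := by
    intro i
    have := H.toIsFrame.frameCurv_bianchi hx i j l i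
    have h2 : frameCurv e c.γ l i j i x = -frameCurv e c.γ i l j i x := by
      simp only [frameCurv, sub_mul, Finset.sum_sub_distrib]; ring
    rw [h2] at this
    linear_combination this
  have h3 := Finset.sum_eq_zero fun i (_ : i ∈ Finset.univ) => h1 i
  rw [Finset.sum_sub_distrib, Finset.sum_add_distrib, frameCurv_trace] at h3
  rw [frameRicci, frameRicci]
  linear_combination h3

theorem ricci_conj (hx : x ∈ U) (σ : Fin 4 → Fin 4) (hσ : ∀ i, e (σ i) x = star (e i x))
    (l j : Fin 4) : frameRicci e c.γ (σ l) (σ j) x = star (frameRicci e c.γ l j x) := by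
  rw [← H.toIsFrame.ricci_eq hx, ← H.toIsFrame.ricci_eq hx, hσ, hσ]
  simp [star_sum]

/-- A metric with a null frame is Ricci-flat if the independent components vanish. -/
theorem vacuum (hx : x ∈ U) (kk : frameRicci e c.γ 3 3 x = 0) (km : frameRicci e c.γ 3 0 x = 0)
    (kl : frameRicci e c.γ 3 2 x = 0) (mmb : frameRicci e c.γ 0 1 x = 0)
    (ml : frameRicci e c.γ 0 2 x = 0) (ll : frameRicci e c.γ 2 2 x = 0) (a b : Fin 4) :
    ricci g a b x = 0 := by
  -- Complex conjugation exchanges m and m̄ and fixes l and k; it supplies the components with m̄.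
  set σ : Fin 4 → Fin 4 := ![1, 0, 2, 3] with hσ
  have hs : ∀ i, e (σ i) x = star (e i x) := by
    intro i
    fin_cases i
    · exact H.conj_m x hx
    · change e 0 x = star (e 1 x)
      rw [H.conj_m x hx, star_star]
    · exact (H.real_l x hx).symm
    · exact (H.real_k x hx).symm
  have hc := H.ricci_conj hx σ hs
  have mm := ricci_mm e c x
  have bb : frameRicci e c.γ 1 1 x = 0 := (hc 0 0).trans (by rw [mm, star_zero])
  have kb : frameRicci e c.γ 3 1 x = 0 := (hc 3 0).trans (by rw [km, star_zero])
  have bl : frameRicci e c.γ 1 2 x = 0 := (hc 0 2).trans (by rw [ml, star_zero])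
  have all : ∀ l j, frameRicci e c.γ l j x = 0 := by
    have comm := fun l j => H.ricci_comm hx l j
    have lk := (comm 2 3).trans kl
    have mk := (comm 0 3).trans km
    have bk := (comm 1 3).trans kb
    have lm := (comm 2 0).trans ml
    have lb := (comm 2 1).trans bl
    have bm := (comm 1 0).trans mmb
    intro l j
    match l, j with
    | 0, 0 => exact mm
    | 0, 1 => exact mmb
    | 0, 2 => exact ml
    | 0, 3 => exact mk
    | 1, 0 => exact bm
    | 1, 1 => exact bb
    | 1, 2 => exact bl
    | 1, 3 => exact bk
    | 2, 0 => exact lm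
    | 2, 1 => exact lb
    | 2, 2 => exact ll
    | 2, 3 => exact lk
    | 3, 0 => exact km
    | 3, 1 => exact kb
    | 3, 2 => exact kl
    | 3, 3 => exact kk
  set E := Matrix.of fun i => e i x with hE
  have hdet : IsUnit E.det := isUnit_iff_ne_zero.2 (det_frame_ne_zero (H.gram x hx))
  -- Back to coordinates: the matrix of frame vectors is invertible.
  have h1 : E * (Matrix.of fun a b => (ricci g a b x : ℂ)) * E.transpose = 0 := by
    ext l j
    have := all l j
    rw [← H.toIsFrame.ricci_eq hx, Finset.sum_comm] at this
    rw [Matrix.zero_apply, ← this]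
    simp only [Matrix.mul_apply, hE, Matrix.transpose_apply, Matrix.of_apply, Finset.sum_mul]
    exact Finset.sum_congr rfl fun _ _ => Finset.sum_congr rfl fun _ _ => by ring
  have h2 : (Matrix.of fun a b => (ricci g a b x : ℂ)) = 0 := by
    have hdet' : IsUnit E.transpose.det := by rwa [Matrix.det_transpose]
    have h3 : E * (Matrix.of fun a b => (ricci g a b x : ℂ)) = 0 := by
      rw [← Matrix.mul_nonsing_inv_cancel_right _ (E * _) hdet', h1, Matrix.zero_mul]
    rw [← Matrix.nonsing_inv_mul_cancel_left E (Matrix.of _) hdet, h3, Matrix.mul_zero]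
  have := congrFun (congrFun h2 a) b
  simpa using this

/-- The components of the Ricci tensor of a Ricci-flat metric vanish. -/
theorem ricci_zero (hx : x ∈ U) (hv : ∀ a b, ricci g a b x = 0) (l j : Fin 4) :
    frameRicci e c.γ l j x = 0 := by
  rw [← H.toIsFrame.ricci_eq hx]
  simp [hv]

theorem dd_conj_k {f fb : Pt → ℂ} (hx : x ∈ U) (hf : ∀ y ∈ U, fb y = star (f y)) :
    dd (e 3) fb x = star (dd (e 3) f x) := by
  rw [dd_congr H.metric.isOpen hf hx, ← dd_star]
  simp only [dd]
  refine Finset.sum_congr rfl fun a _ => ?_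
  rw [← congrFun (H.real_k x hx) a]

theorem dd_conj_l {f fb : Pt → ℂ} (hx : x ∈ U) (hf : ∀ y ∈ U, fb y = star (f y)) :
    dd (e 2) fb x = star (dd (e 2) f x) := by
  rw [dd_congr H.metric.isOpen hf hx, ← dd_star]
  simp only [dd]
  refine Finset.sum_congr rfl fun a _ => ?_
  rw [← congrFun (H.real_l x hx) a]

theorem dd_conj_m {f fb : Pt → ℂ} (hx : x ∈ U) (hf : ∀ y ∈ U, fb y = star (f y)) :
    dd (e 1) fb x = star (dd (e 0) f x) := by
  rw [dd_congr H.metric.isOpen hf hx, ← dd_star]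
  simp only [dd]
  refine Finset.sum_congr rfl fun a _ => ?_
  rw [congrFun (H.conj_m x hx) a]

/-- The Sachs equation. -/
theorem sachs (hx : x ∈ U) (kk : frameRicci e c.γ 3 3 x = 0) :
    dd (e 3) c.ρ x = -c.ρ x ^ 2 ∧ dd (e 3) c.ρb x = -c.ρb x ^ 2 := by
  -- The l-component of the Bianchi identity for k, m, m̄ says that Dρ + ρ² and Dρ̄ + ρ̄² are equal;
  -- the kk component of the Ricci tensor says that their sum vanishes.
  have h1 := H.toIsFrame.frameCurv_bianchi hx 3 0 1 2
  simp [frameCurv, Coefs.γ, Fin.sum_univ_four, dd_zero] at h1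
  rw [ricci_kk] at kk
  constructor
  · linear_combination (-1 / 2) * h1 - (1 / 2) * kk
  · linear_combination (1 / 2) * h1 - (1 / 2) * kk

/-- The l-component of the Bianchi identity for l, m, m̄; it controls the imaginary part of Δρ. -/
theorem dd_l_twist (hx : x ∈ U) (hT : ∀ y ∈ U, c.T y = 0) : dd (e 2) c.ρb x - dd (e 2) c.ρ x
    = -(c.ρb x - c.ρ x) * (c.μ x + c.μb x) := by
  have h1 := H.toIsFrame.frameCurv_bianchi hx 2 0 1 2
  simp [frameCurv, Coefs.γ, Fin.sum_univ_four, dd_zero] at h1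
  have hTb : ∀ y ∈ U, c.Tb y = 0 := fun y hy => by rw [H.conj_T y hy, hT y hy, star_zero]
  rw [dd_congr H.metric.isOpen hT hx, dd_congr H.metric.isOpen hTb hx, dd_const, dd_const,
    hT x hx, hTb x hx] at h1
  linear_combination h1

/-- Sum of the Bianchi identities for l, m, k and for l, m̄, k; the terms with F and ν enter with
opposite signs and cancel. It controls the real part of Δρ. -/
theorem dd_l_expansion (hx : x ∈ U) : dd (e 2) c.ρ x + dd (e 2) c.ρb x
    = (c.ρ x + c.ρb x) * c.q x + dd (e 3) c.μ x + dd (e 3) c.μb x := by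
  have h1 := H.toIsFrame.frameCurv_bianchi hx 2 0 3 0
  have h2 := H.toIsFrame.frameCurv_bianchi hx 2 1 3 1
  simp [frameCurv, Coefs.γ, Fin.sum_univ_four, dd_neg', dd_zero] at h1 h2
  linear_combination h1 + h2

end IsNullFrame

/-! ### Construction of null frames and the Kerr-Schild transformation -/

theorem br_swap (X Y : Pt → Fin 4 → ℂ) (x : Pt) : br X Y x = -br Y X x := by
  funext a; simp [br]

theorem br_self (X : Pt → Fin 4 → ℂ) (x : Pt) : br X X x = 0 := by
  funext a; simp [br]

theorem br_star (X Y : Pt → Fin 4 → ℂ) (x : Pt) :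
    br (fun y => star (X y)) (fun y => star (Y y)) x = star (br X Y x) := by
  funext a
  have := fun X Y : Pt → Fin 4 → ℂ => dd_star (X := X) (f := fun y => Y y a) (x := x)
  simp only [br, Pi.star_apply, star_sub, ← this]

theorem br_congr {U : Set Pt} (hU : IsOpen U) {X X' Y Y' : Pt → Fin 4 → ℂ} {x : Pt} (hx : x ∈ U)
    (hX : ∀ y ∈ U, X y = X' y) (hY : ∀ y ∈ U, Y y = Y' y) : br X Y x = br X' Y' x := by
  funext a
  simp only [br, dd, hX x hx, hY x hx, pd_congr hU (fun y hy => congrFun (hX y hy) a) hx,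
    pd_congr hU (fun y hy => congrFun (hY y hy) a) hx]

theorem br_add_smul {X X' Y : Pt → Fin 4 → ℂ} {V : Pt → ℂ} {x : Pt}
    (hX : ∀ a, DifferentiableAt ℝ (fun y => X y a) x)
    (hX' : ∀ a, DifferentiableAt ℝ (fun y => X' y a) x) (hV : DifferentiableAt ℝ V x) :
    br (fun y => X y + V y • X' y) Y x = br X Y x + V x • br X' Y x - dd Y V x • X' x := by
  funext a
  have h1 : dd Y (fun y => X y a + V y * X' y a) x
      = dd Y (fun y => X y a) x + (dd Y V x * X' x a + V x * dd Y (fun y => X' y a) x) := by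
    rw [dd_add (hX a) (hV.fun_mul (hX' a)), dd_mul hV (hX' a)]
  simp only [br, Pi.add_apply, Pi.sub_apply, Pi.smul_apply, smul_eq_mul, h1]
  simp only [dd, Pi.add_apply, Pi.smul_apply, smul_eq_mul, add_mul, Finset.sum_add_distrib,
    mul_sub, Finset.mul_sum, mul_assoc]
  ring

theorem Coefs.smooth_γ {U : Set Pt} {c : Coefs} (hρ : ContDiffOn ℝ ∞ c.ρ U)
    (hρb : ContDiffOn ℝ ∞ c.ρb U) (hF : ContDiffOn ℝ ∞ c.F U) (hT : ContDiffOn ℝ ∞ c.T U)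
    (hTb : ContDiffOn ℝ ∞ c.Tb U) (hμ : ContDiffOn ℝ ∞ c.μ U) (hμb : ContDiffOn ℝ ∞ c.μb U)
    (hν : ContDiffOn ℝ ∞ c.ν U) (hj : ContDiffOn ℝ ∞ c.j U) (hjb : ContDiffOn ℝ ∞ c.jb U)
    (ha : ContDiffOn ℝ ∞ c.a U) (hab : ContDiffOn ℝ ∞ c.ab U) (hq : ContDiffOn ℝ ∞ c.q U)
    (i j k : Fin 4) : ContDiffOn ℝ ∞ (c.γ i j k) U := by
  have h0 : ContDiffOn ℝ ∞ (0 : Pt → ℂ) U := contDiffOn_const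
  have hν' := hν.neg
  have ha' := ha.neg
  have hab' := hab.neg
  have hT' := hT.neg
  have hTb' := hTb.neg
  have hq' := hq.neg
  have hF' := hF.neg
  fin_cases i <;> fin_cases j <;> fin_cases k <;>
    simp only [Coefs.γ, Fin.zero_eta, Fin.mk_one, Fin.reduceFinMk, Matrix.cons_val] <;>
    assumption

/-- A null frame is determined by the independent inner products and commutators. -/
theorem IsNullFrame.of_brackets {U : Set Pt} {g : Pt → Ten2} {e : Fin 4 → Pt → Fin 4 → ℂ}
    {c : Coefs} (hU : IsOpen U) (smooth_g : ∀ a b, ContDiffOn ℝ ∞ (fun x => g x a b) U)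
    (symm : ∀ x ∈ U, ∀ a b, g x a b = g x b a)
    (smooth_m : ContDiffOn ℝ ∞ (e 0) U) (smooth_l : ContDiffOn ℝ ∞ (e 2) U)
    (smooth_k : ContDiffOn ℝ ∞ (e 3) U)
    (conj_m : ∀ x ∈ U, e 1 x = star (e 0 x)) (real_l : ∀ x ∈ U, star (e 2 x) = e 2 x)
    (real_k : ∀ x ∈ U, star (e 3 x) = e 3 x)
    (mm : ∀ x ∈ U, cform (g x) (e 0 x) (e 0 x) = 0)
    (mb : ∀ x ∈ U, cform (g x) (e 0 x) (e 1 x) = 1)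
    (ml : ∀ x ∈ U, cform (g x) (e 0 x) (e 2 x) = 0)
    (mk : ∀ x ∈ U, cform (g x) (e 0 x) (e 3 x) = 0)
    (ll : ∀ x ∈ U, cform (g x) (e 2 x) (e 2 x) = 0)
    (lk : ∀ x ∈ U, cform (g x) (e 2 x) (e 3 x) = -1)
    (kk : ∀ x ∈ U, cform (g x) (e 3 x) (e 3 x) = 0)
    (bmb : ∀ x ∈ U, br (e 0) (e 1) x = -c.ab x • e 0 x + c.a x • e 1 x
      + (c.ρb x - c.ρ x) • e 2 x + (c.μ x - c.μb x) • e 3 x)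
    (blm : ∀ x ∈ U, br (e 2) (e 0) x = (c.ν x - c.μ x) • e 0 x - c.T x • e 2 x + c.j x • e 3 x)
    (bkm : ∀ x ∈ U, br (e 3) (e 0) x = -(c.ρb x + c.F x) • e 0 x + c.T x • e 3 x)
    (bkl : ∀ x ∈ U, br (e 3) (e 2) x = -c.q x • e 3 x)
    (conj_ρ : ∀ x ∈ U, c.ρb x = star (c.ρ x)) (conj_T : ∀ x ∈ U, c.Tb x = star (c.T x))
    (conj_μ : ∀ x ∈ U, c.μb x = star (c.μ x)) (conj_j : ∀ x ∈ U, c.jb x = star (c.j x))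
    (conj_a : ∀ x ∈ U, c.ab x = star (c.a x)) (imag_F : ∀ x ∈ U, star (c.F x) = -c.F x)
    (imag_ν : ∀ x ∈ U, star (c.ν x) = -c.ν x) (real_q : ∀ x ∈ U, star (c.q x) = c.q x)
    (hρ : ContDiffOn ℝ ∞ c.ρ U) (hF : ContDiffOn ℝ ∞ c.F U) (hT : ContDiffOn ℝ ∞ c.T U)
    (hμ : ContDiffOn ℝ ∞ c.μ U) (hν : ContDiffOn ℝ ∞ c.ν U) (hj : ContDiffOn ℝ ∞ c.j U)
    (ha : ContDiffOn ℝ ∞ c.a U) (hq : ContDiffOn ℝ ∞ c.q U) : IsNullFrame U g e c := by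
  have comm : ∀ x ∈ U, ∀ v w, cform (g x) v w = cform (g x) w v := by
    intro x hx v w
    simp only [cform]
    rw [Finset.sum_comm]
    refine Finset.sum_congr rfl fun a _ => Finset.sum_congr rfl fun b _ => ?_
    rw [symm x hx]; ring
  have gram : ∀ x ∈ U, ∀ i j, cform (g x) (e i x) (e j x) = eta i j := by
    intro x hx
    have conj : ∀ i, cform (g x) (e i x) (e 1 x) = star (cform (g x) (star (e i x)) (e 0 x)) := by
      intro i
      rw [← cform_star, star_star, conj_m x hx]
    have bb : cform (g x) (e 1 x) (e 1 x) = 0 := by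
      rw [conj, conj_m x hx, star_star, mm x hx, star_zero]
    have lb : cform (g x) (e 2 x) (e 1 x) = 0 := by
      rw [conj, real_l x hx, comm x hx, ml x hx, star_zero]
    have kb : cform (g x) (e 3 x) (e 1 x) = 0 := by
      rw [conj, real_k x hx, comm x hx, mk x hx, star_zero]
    intro i j
    match i, j with
    | 0, 0 => exact mm x hx
    | 0, 1 => exact mb x hx
    | 0, 2 => exact ml x hx
    | 0, 3 => exact mk x hx
    | 1, 0 => exact (comm x hx _ _).trans (mb x hx)
    | 1, 1 => exact bb
    | 1, 2 => exact (comm x hx _ _).trans lb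
    | 1, 3 => exact (comm x hx _ _).trans kb
    | 2, 0 => exact (comm x hx _ _).trans (ml x hx)
    | 2, 1 => exact lb
    | 2, 2 => exact ll x hx
    | 2, 3 => exact lk x hx
    | 3, 0 => exact (comm x hx _ _).trans (mk x hx)
    | 3, 1 => exact kb
    | 3, 2 => exact (comm x hx _ _).trans (lk x hx)
    | 3, 3 => exact kk x hx
  have bracket : ∀ x ∈ U, ∀ i j, br (e i) (e j) x
      = ∑ k, (c.γ i j k x - c.γ j i k x) • e k x := by
    intro x hx
    -- The brackets with m̄ are the conjugates of those with m.
    have blb : br (e 2) (e 1) x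
        = (-c.ν x - c.μb x) • e 1 x - c.Tb x • e 2 x + c.jb x • e 3 x := by
      rw [br_congr hU hx (fun y hy => (real_l y hy).symm) conj_m, br_star, blm x hx,
        conj_m x hx, conj_T x hx, conj_μ x hx, conj_j x hx]
      simp only [star_add, star_sub, star_smul, real_l x hx, real_k x hx, imag_ν x hx]
    have bkb : br (e 3) (e 1) x = -(c.ρ x - c.F x) • e 1 x + c.Tb x • e 3 x := by
      rw [br_congr hU hx (fun y hy => (real_k y hy).symm) conj_m, br_star, bkm x hx,
        conj_m x hx, conj_T x hx, conj_ρ x hx]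
      simp only [star_add, star_neg, star_smul, real_k x hx, imag_F x hx, star_star]
      rw [← sub_eq_add_neg]
    have sw : ∀ i j, br (e i) (e j) x = ∑ k, (c.γ i j k x - c.γ j i k x) • e k x →
        br (e j) (e i) x = ∑ k, (c.γ j i k x - c.γ i j k x) • e k x := by
      intro i j h
      rw [br_swap, h, ← Finset.sum_neg_distrib]
      exact Finset.sum_congr rfl fun k _ => by rw [← neg_smul, neg_sub]
    have b01 : br (e 0) (e 1) x = ∑ k, (c.γ 0 1 k x - c.γ 1 0 k x) • e k x := by
      rw [bmb x hx]; simp [Coefs.γ, Fin.sum_univ_four]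
    have b20 : br (e 2) (e 0) x = ∑ k, (c.γ 2 0 k x - c.γ 0 2 k x) • e k x := by
      rw [blm x hx]; simp [Coefs.γ, Fin.sum_univ_four, sub_eq_add_neg]
    have b21 : br (e 2) (e 1) x = ∑ k, (c.γ 2 1 k x - c.γ 1 2 k x) • e k x := by
      rw [blb]; simp [Coefs.γ, Fin.sum_univ_four, sub_eq_add_neg]
    have b30 : br (e 3) (e 0) x = ∑ k, (c.γ 3 0 k x - c.γ 0 3 k x) • e k x := by
      rw [bkm x hx]
      simp only [Coefs.γ, Fin.sum_univ_four, Matrix.cons_val, Pi.neg_apply, Pi.zero_apply]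
      module
    have b31 : br (e 3) (e 1) x = ∑ k, (c.γ 3 1 k x - c.γ 1 3 k x) • e k x := by
      rw [bkb]; simp [Coefs.γ, Fin.sum_univ_four]
    have b32 : br (e 3) (e 2) x = ∑ k, (c.γ 3 2 k x - c.γ 2 3 k x) • e k x := by
      rw [bkl x hx]; simp [Coefs.γ, Fin.sum_univ_four]
    intro i j
    match i, j with
    | 0, 0 => simp [br_self]
    | 0, 1 => exact b01
    | 0, 2 => exact sw _ _ b20
    | 0, 3 => exact sw _ _ b30
    | 1, 0 => exact sw _ _ b01
    | 1, 1 => simp [br_self]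
    | 1, 2 => exact sw _ _ b21
    | 1, 3 => exact sw _ _ b31
    | 2, 0 => exact b20
    | 2, 1 => exact b21
    | 2, 2 => simp [br_self]
    | 2, 3 => exact sw _ _ b32
    | 3, 0 => exact b30
    | 3, 1 => exact b31
    | 3, 2 => exact b32
    | 3, 3 => simp [br_self]
  refine
    { metric := ⟨hU, smooth_g, symm, fun x hx => det_ne_zero_of_gram (gram x hx)⟩
      smooth := fun i => ?_
      smooth_coef := Coefs.smooth_γ hρ ((smooth_star hρ).congr conj_ρ) hF hT
        ((smooth_star hT).congr conj_T) hμ ((smooth_star hμ).congr conj_μ) hν hj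
        ((smooth_star hj).congr conj_j) ha ((smooth_star ha).congr conj_a) hq
      gram := gram
      bracket := bracket
      antisymm := fun x _ i j k => c.antisymm i j k x
      conj_m, real_l, real_k, conj_ρ, conj_T, conj_μ, conj_j, conj_a, imag_F, imag_ν, real_q }
  match i with
  | 0 => exact smooth_m
  | 1 =>
    refine contDiffOn_pi.2 fun a => ?_
    exact (smooth_star (smooth_apply smooth_m a)).congr fun x hx => congrFun (conj_m x hx) a
  | 2 => exact smooth_l
  | 3 => exact smooth_k

namespace IsNullFrame

variable {U : Set Pt} {g : Pt → Ten2} {e : Fin 4 → Pt → Fin 4 → ℂ} {c : Coefs}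
  (H : IsNullFrame U g e c)
include H

theorem smooth_ρ : ContDiffOn ℝ ∞ c.ρ U := H.smooth_coef 1 0 2
theorem smooth_ρb : ContDiffOn ℝ ∞ c.ρb U := H.smooth_coef 0 1 2
theorem smooth_F : ContDiffOn ℝ ∞ c.F U := H.smooth_coef 3 1 1
theorem smooth_T : ContDiffOn ℝ ∞ c.T U := H.smooth_coef 0 2 2
theorem smooth_μ : ContDiffOn ℝ ∞ c.μ U := H.smooth_coef 0 1 3
theorem smooth_μb : ContDiffOn ℝ ∞ c.μb U := H.smooth_coef 1 0 3
theorem smooth_ν : ContDiffOn ℝ ∞ c.ν U := H.smooth_coef 2 0 0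
theorem smooth_j : ContDiffOn ℝ ∞ c.j U := H.smooth_coef 2 0 3
theorem smooth_jb : ContDiffOn ℝ ∞ c.jb U := H.smooth_coef 2 1 3
theorem smooth_a : ContDiffOn ℝ ∞ c.a U := H.smooth_coef 0 1 1
theorem smooth_q : ContDiffOn ℝ ∞ c.q U := H.smooth_coef 2 3 3

variable {x : Pt}

theorem dd_comm {f : Pt → ℂ} (hx : x ∈ U) (hf : ContDiffOn ℝ ∞ f U) (i j : Fin 4) :
    dd (e i) (dd (e j) f) x
      = dd (e j) (dd (e i) f) x + ∑ k, (c.γ i j k x - c.γ j i k x) * dd (e k) f x := by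
  have h := dd_commutator H.metric.isOpen (H.smooth i) (H.smooth j) hf hx
  rw [H.bracket x hx] at h
  rw [← sub_eq_iff_eq_add', h]
  simp only [dd, Finset.sum_apply, Pi.smul_apply, smul_eq_mul, Finset.sum_mul, Finset.mul_sum]
  rw [Finset.sum_comm]
  exact Finset.sum_congr rfl fun _ _ => Finset.sum_congr rfl fun _ _ => by ring

end IsNullFrame

/-- The frame `(m, \bar m, l + V k, k)`. -/
def ksFrame (e : Fin 4 → Pt → Fin 4 → ℂ) (V : Pt → ℂ) : Fin 4 → Pt → Fin 4 → ℂ :=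
  ![e 0, e 1, fun x => e 2 x + V x • e 3 x, e 3]

/-- The rotation coefficients of `ksFrame` with respect to `g + 2 V k²`. -/
def Coefs.ks (c : Coefs) (e : Fin 4 → Pt → Fin 4 → ℂ) (V : Pt → ℂ) : Coefs :=
  { c with
    j := fun x => c.j x + 2 * V x * c.T x - dd (e 0) V x
    jb := fun x => c.jb x + 2 * V x * c.Tb x - dd (e 1) V x
    μ := fun x => c.μ x + V x * c.ρ x
    μb := fun x => c.μb x + V x * c.ρb x
    ν := fun x => c.ν x - V x * (c.ρb x - c.ρ x) - V x * c.F x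
    q := fun x => c.q x - dd (e 3) V x }

theorem dd_ksFrame (e : Fin 4 → Pt → Fin 4 → ℂ) (V f : Pt → ℂ) (x : Pt) :
    dd (fun y => e 2 y + V y • e 3 y) f x = dd (e 2) f x + V x * dd (e 3) f x := by
  simp [dd, add_mul, Finset.sum_add_distrib, Finset.mul_sum, mul_assoc]

/-- The added term sees a vector only through its inner product with k. So m, m̄ and k keep their
inner products, and l + Vk is null again: the shift contributes -2V, the new metric +2V. -/
theorem cform_ks {G G' : Ten2} {k : Fin 4 → ℝ} {t : ℝ}
    (h : ∀ a b, G' a b = G a b + 2 * t * ((∑ c, G a c * k c) * ∑ c, G b c * k c))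
    (v w : Fin 4 → ℂ) : cform G' v w
      = cform G v w + 2 * t * (cform G v (cvec k) * cform G w (cvec k)) := by
  obtain ⟨K, hK⟩ : ∃ K : Fin 4 → ℝ, ∀ a, ∑ c, G a c * k c = K a := ⟨_, fun _ => rfl⟩
  simp only [hK] at h
  have h1 : ∀ v, cform G v (cvec k) = ∑ a, v a * (K a : ℂ) := by
    intro v
    simp only [cform, cvec, ← hK, Complex.ofReal_sum, Complex.ofReal_mul, Finset.mul_sum]
    exact Finset.sum_congr rfl fun _ _ => Finset.sum_congr rfl fun _ _ => by ring
  rw [h1, h1, Finset.sum_mul_sum, Finset.mul_sum]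
  simp only [cform, h, Finset.mul_sum, ← Finset.sum_add_distrib]
  refine Finset.sum_congr rfl fun _ _ => Finset.sum_congr rfl fun _ _ => ?_
  push_cast
  ring

/-- The Kerr-Schild transformation `g ↦ g + 2 V k²` of a metric with a null frame. -/
theorem IsNullFrame.kerrSchild {U : Set Pt} {g g' : Pt → Ten2} {e : Fin 4 → Pt → Fin 4 → ℂ}
    {c : Coefs} (H : IsNullFrame U g e c) {k : Pt → Fin 4 → ℝ} (hk : ∀ x ∈ U, e 3 x = cvec (k x))
    {t : Pt → ℝ} (ht : ContDiffOn ℝ ∞ t U)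
    (h : ∀ x ∈ U, ∀ a b, g' x a b = g x a b + 2 * t x * (lower g k x a * lower g k x b)) :
    IsNullFrame U g' (ksFrame e fun x => (t x : ℂ)) (c.ks e fun x => (t x : ℂ)) := by
  have hU := H.metric.isOpen
  have hV := smooth_ofReal ht
  have key : ∀ x ∈ U, ∀ v w, cform (g' x) v w
      = cform (g x) v w + 2 * t x * (cform (g x) v (e 3 x) * cform (g x) w (e 3 x)) := by
    intro x hx v w
    rw [hk x hx]
    exact cform_ks (h x hx) v w
  have hlow : ∀ a, ContDiffOn ℝ ∞ (fun x => lower g k x a) U := by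
    intro a
    refine ContDiffOn.sum fun b _ => (H.metric.smooth a b).mul ?_
    refine (smooth_re (smooth_apply (H.smooth 3) b)).congr fun x hx => ?_
    rw [hk x hx]; simp [cvec]
  have dV := fun x (hx : x ∈ U) => differentiableAt_of_smooth hU hV hx
  have de := fun i x (hx : x ∈ U) a =>
    differentiableAt_of_smooth hU (smooth_apply (H.smooth i) a) hx
  have sdd := fun i => smooth_dd hU (H.smooth i) hV
  have hT := H.smooth_T
  refine IsNullFrame.of_brackets hU ?_ ?_ (H.smooth 0) ?_ (H.smooth 3) H.conj_m ?_ H.real_k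
    ?_ ?_ ?_ ?_ ?_ ?_ ?_ ?_ ?_ ?_ ?_ H.conj_ρ H.conj_T ?_ ?_ H.conj_a H.imag_F ?_ ?_ H.smooth_ρ
    H.smooth_F hT ?_ ?_ ?_ H.smooth_a ?_
  · intro a b
    exact ((H.metric.smooth a b).add ((contDiffOn_const.mul ht).mul ((hlow a).mul
      (hlow b)))).congr fun x hx => h x hx a b
  · intro x hx a b
    rw [h x hx, h x hx, H.metric.symm x hx]; ring
  · exact (H.smooth 2).add (hV.smul (H.smooth 3))
  · intro x hx
    change star (e 2 x + (t x : ℂ) • e 3 x) = e 2 x + (t x : ℂ) • e 3 x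
    rw [star_add, star_smul, H.real_l x hx, H.real_k x hx]
    simp
  · intro x hx
    change cform (g' x) (e 0 x) (e 0 x) = 0
    simp [key x hx, H.gram x hx, eta]
  · intro x hx
    change cform (g' x) (e 0 x) (e 1 x) = 1
    simp [key x hx, H.gram x hx, eta]
  · intro x hx
    change cform (g' x) (e 0 x) (e 2 x + (t x : ℂ) • e 3 x) = 0
    simp only [key x hx, H.gram x hx, cform_add_right, cform_smul_right]
    simp [eta]
  · intro x hx
    change cform (g' x) (e 0 x) (e 3 x) = 0
    simp [key x hx, H.gram x hx, eta]
  · intro x hx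
    change cform (g' x) (e 2 x + (t x : ℂ) • e 3 x) (e 2 x + (t x : ℂ) • e 3 x) = 0
    simp only [key x hx, H.gram x hx, cform_add_right, cform_smul_right, cform_add_left,
      cform_smul_left]
    simp [eta]
    ring
  · intro x hx
    change cform (g' x) (e 2 x + (t x : ℂ) • e 3 x) (e 3 x) = -1
    simp only [key x hx, H.gram x hx, cform_add_left, cform_smul_left]
    simp [eta]
  · intro x hx
    change cform (g' x) (e 3 x) (e 3 x) = 0
    simp [key x hx, H.gram x hx, eta]
  · intro x hx
    change br (e 0) (e 1) x = -c.ab x • e 0 x + c.a x • e 1 x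
      + (c.ρb x - c.ρ x) • (e 2 x + (t x : ℂ) • e 3 x)
      + (c.μ x + t x * c.ρ x - (c.μb x + t x * c.ρb x)) • e 3 x
    rw [H.bracket x hx]
    simp only [Coefs.γ, Fin.sum_univ_four, Matrix.cons_val, Pi.zero_apply]
    module
  · intro x hx
    change br (fun y => e 2 y + (t y : ℂ) • e 3 y) (e 0) x
      = (c.ν x - t x * (c.ρb x - c.ρ x) - t x * c.F x - (c.μ x + t x * c.ρ x)) • e 0 x
      - c.T x • (e 2 x + (t x : ℂ) • e 3 x)
      + (c.j x + 2 * t x * c.T x - dd (e 0) (fun x => (t x : ℂ)) x) • e 3 x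
    rw [br_add_smul (de 2 x hx) (de 3 x hx) (dV x hx), H.bracket x hx, H.bracket x hx]
    simp only [Coefs.γ, Fin.sum_univ_four, Matrix.cons_val, Pi.neg_apply, Pi.zero_apply]
    module
  · intro x hx
    change br (e 3) (e 0) x = -(c.ρb x + c.F x) • e 0 x + c.T x • e 3 x
    rw [H.bracket x hx]
    simp only [Coefs.γ, Fin.sum_univ_four, Matrix.cons_val, Pi.neg_apply, Pi.zero_apply]
    module
  · intro x hx
    change br (e 3) (fun y => e 2 y + (t y : ℂ) • e 3 y) x
      = -(c.q x - dd (e 3) (fun x => (t x : ℂ)) x) • e 3 x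
    rw [br_swap, br_add_smul (de 2 x hx) (de 3 x hx) (dV x hx), br_self, H.bracket x hx]
    simp only [Coefs.γ, Fin.sum_univ_four, Matrix.cons_val, Pi.zero_apply]
    module
  · intro x hx
    change c.μb x + t x * c.ρb x = star (c.μ x + t x * c.ρ x)
    rw [H.conj_μ x hx, H.conj_ρ x hx]
    simp
  · intro x hx
    change c.jb x + 2 * t x * c.Tb x - dd (e 1) (fun x => (t x : ℂ)) x
      = star (c.j x + 2 * t x * c.T x - dd (e 0) (fun x => (t x : ℂ)) x)
    rw [H.conj_j x hx, H.conj_T x hx, H.dd_conj_m hx (f := fun x => (t x : ℂ))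
      (fb := fun x => (t x : ℂ)) (by simp)]
    simp
  · intro x hx
    change star (c.ν x - t x * (c.ρb x - c.ρ x) - t x * c.F x)
      = -(c.ν x - t x * (c.ρb x - c.ρ x) - t x * c.F x)
    have h1 := H.imag_ν x hx
    have h2 := H.imag_F x hx
    rw [H.conj_ρ x hx]
    simp only [star_sub, star_mul', star_star, h1, h2]
    simp
    ring
  · intro x hx
    change star (c.q x - dd (e 3) (fun x => (t x : ℂ)) x)
      = c.q x - dd (e 3) (fun x => (t x : ℂ)) x
    rw [star_sub, H.real_q x hx, ← H.dd_conj_k hx (f := fun x => (t x : ℂ))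
      (fb := fun x => (t x : ℂ)) (by simp)]
  · exact H.smooth_μ.add (hV.mul H.smooth_ρ)
  · exact (H.smooth_ν.sub (hV.mul (H.smooth_ρb.sub H.smooth_ρ))).sub (hV.mul H.smooth_F)
  · exact (H.smooth_j.add ((contDiffOn_const.mul hV).mul hT)).sub (sdd 0)
  · exact H.smooth_q.sub (sdd 3)

/-! ### The Ricci tensor after a Kerr-Schild transformation -/

namespace IsNullFrame

variable {U : Set Pt} {g : Pt → Ten2} {e : Fin 4 → Pt → Fin 4 → ℂ} {c : Coefs}
  (H : IsNullFrame U g e c) {x : Pt}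
include H

theorem dd_comm_m_mb {f : Pt → ℂ} (hx : x ∈ U) (hf : ContDiffOn ℝ ∞ f U) :
    dd (e 0) (dd (e 1) f) x = dd (e 1) (dd (e 0) f) x - c.ab x * dd (e 0) f x
      + c.a x * dd (e 1) f x + (c.ρb x - c.ρ x) * dd (e 2) f x
      + (c.μ x - c.μb x) * dd (e 3) f x := by
  rw [H.dd_comm hx hf]
  simp [Coefs.γ, Fin.sum_univ_four]
  ring

theorem dd_comm_k_m {f : Pt → ℂ} (hx : x ∈ U) (hf : ContDiffOn ℝ ∞ f U) :
    dd (e 3) (dd (e 0) f) x = dd (e 0) (dd (e 3) f) x - (c.ρb x + c.F x) * dd (e 0) f x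
      + c.T x * dd (e 3) f x := by
  rw [H.dd_comm hx hf]
  simp [Coefs.γ, Fin.sum_univ_four]
  ring

variable {V : Pt → ℂ} {τ : ℂ} (hV : ∀ y ∈ U, V y = τ * (c.ρ y + c.ρb y))
  (sachs : ∀ y ∈ U, dd (e 3) c.ρ y = -c.ρ y ^ 2 ∧ dd (e 3) c.ρb y = -c.ρb y ^ 2)
include hV

theorem smooth_V : ContDiffOn ℝ ∞ V U :=
  (contDiffOn_const.mul (H.smooth_ρ.add H.smooth_ρb)).congr hV

theorem dd_V (hx : x ∈ U) (i : Fin 4) :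
    dd (e i) V x = τ * (dd (e i) c.ρ x + dd (e i) c.ρb x) := by
  have hU := H.metric.isOpen
  have d1 := differentiableAt_of_smooth hU H.smooth_ρ hx
  have d2 := differentiableAt_of_smooth hU H.smooth_ρb hx
  rw [dd_congr hU hV hx, dd_mul (differentiableAt_const τ) (d1.fun_add d2), dd_const,
    dd_add d1 d2]
  ring

include sachs

theorem dd_k_V (hx : x ∈ U) : dd (e 3) V x = -τ * (c.ρ x ^ 2 + c.ρb x ^ 2) := by
  rw [H.dd_V hV hx, (sachs x hx).1, (sachs x hx).2]; ring

theorem dd_dd_k_V (hx : x ∈ U) (i : Fin 4) : dd (e i) (dd (e 3) V) x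
    = -2 * τ * (c.ρ x * dd (e i) c.ρ x + c.ρb x * dd (e i) c.ρb x) := by
  have hU := H.metric.isOpen
  have d1 := differentiableAt_of_smooth hU H.smooth_ρ hx
  have d2 := differentiableAt_of_smooth hU H.smooth_ρb hx
  have h1 : ∀ y ∈ U, dd (e 3) V y = -τ * (c.ρ y * c.ρ y + c.ρb y * c.ρb y) := by
    intro y hy
    rw [H.dd_k_V hV sachs hy]; ring
  rw [dd_congr hU h1 hx, dd_mul (differentiableAt_const _)
    ((d1.fun_mul d1).fun_add (d2.fun_mul d2)), dd_const, dd_add (d1.fun_mul d1) (d2.fun_mul d2),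
    dd_mul d1 d1, dd_mul d2 d2]
  ring

/-- The change involves V, DV and D²V. For V proportional to ρ + ρ̄ the Sachs equations turn these
into polynomials in ρ and ρ̄, which cancel identically; the mm̄ component behaves in the same way.
-/
theorem ks_ricci_kl (hx : x ∈ U) : frameRicci (ksFrame e V) (c.ks e V).γ 3 2 x
    = frameRicci e c.γ 3 2 x := by
  have hU := H.metric.isOpen
  have sV := H.smooth_V hV
  rw [ricci_kl, ricci_kl]
  change -(dd (fun y => e 2 y + V y • e 3 y) c.ρ x
      + c.ρ x * (c.μb x + V x * c.ρb x - (c.q x - dd (e 3) V x)))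
      - (dd (fun y => e 2 y + V y • e 3 y) c.ρb x
      + c.ρb x * (c.μ x + V x * c.ρ x - (c.q x - dd (e 3) V x)))
      + dd (e 3) (fun y => c.q y - dd (e 3) V y) x = _
  rw [dd_ksFrame, dd_ksFrame, dd_sub (differentiableAt_of_smooth hU H.smooth_q hx)
    (differentiableAt_of_smooth hU (smooth_dd hU (H.smooth 3) sV) hx),
    H.dd_dd_k_V hV sachs hx, H.dd_k_V hV sachs hx, (sachs x hx).1, (sachs x hx).2, hV x hx]
  ring

theorem ks_ricci_mmb (hx : x ∈ U) : frameRicci (ksFrame e V) (c.ks e V).γ 0 1 x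
    = frameRicci e c.γ 0 1 x := by
  have hU := H.metric.isOpen
  have sV := H.smooth_V hV
  have dV := differentiableAt_of_smooth hU sV hx
  have d2 := differentiableAt_of_smooth hU H.smooth_ρb hx
  rw [ricci_mmb, ricci_mmb]
  change dd (e 0) c.ab x + dd (e 1) c.a x - 2 * c.a x * c.ab x + c.ρ x * (c.μ x + V x * c.ρ x)
      + c.ρb x * (c.μb x + V x * c.ρb x)
      - (c.ρb x - c.ρ x) * (c.ν x - V x * (c.ρb x - c.ρ x) - V x * c.F x)
      + c.F x * (c.μ x + V x * c.ρ x - (c.μb x + V x * c.ρb x))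
      + dd (e 3) (fun y => c.μb y + V y * c.ρb y) x
      + c.ρ x * (c.μb x + V x * c.ρb x) + dd (fun y => e 2 y + V y • e 3 y) c.ρ x
      - c.ρ x * (c.q x - dd (e 3) V x) + c.ρ x * (c.μb x + V x * c.ρb x) = _
  rw [dd_ksFrame, dd_add (differentiableAt_of_smooth hU H.smooth_μb hx) (dV.fun_mul d2),
    dd_mul dV d2, H.dd_k_V hV sachs hx, (sachs x hx).1, (sachs x hx).2, hV x hx]
  ring

/-- After D and δ are commuted on V, the derivatives of ρ̄ cancel and a single defect remains. It
vanishes if T = 0, and conversely its vanishing for τ ≠ 0 is what forces L_u = 0 in a canonical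
metric. -/
theorem ks_ricci_ml (hx : x ∈ U) (hTk : dd (e 3) c.T x = -(c.ρb x + c.F x) * c.T x)
    (hm : dd (e 0) c.ρ x = -c.T x * c.ρ x) (ha : dd (e 3) c.a x
      = dd (e 0) c.F x - (c.ρb x + c.F x) * c.a x + c.F x * c.T x) :
    frameRicci (ksFrame e V) (c.ks e V).γ 0 2 x
      = frameRicci e c.γ 0 2 x - 6 * τ * c.T x * c.ρ x ^ 2 := by
  have hU := H.metric.isOpen
  have sV := H.smooth_V hV
  have dV := differentiableAt_of_smooth hU sV hx
  have dT := differentiableAt_of_smooth hU H.smooth_T hx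
  have dF := differentiableAt_of_smooth hU H.smooth_F hx
  have d1 := differentiableAt_of_smooth hU H.smooth_ρ hx
  have d2 := differentiableAt_of_smooth hU H.smooth_ρb hx
  have dν := differentiableAt_of_smooth hU H.smooth_ν hx
  have dj := differentiableAt_of_smooth hU H.smooth_j hx
  have dVm := differentiableAt_of_smooth hU (smooth_dd hU (H.smooth 0) sV) hx
  have dc := differentiableAt_const (𝕜 := ℝ) (x := x) (2 : ℂ)
  rw [ricci_ml, ricci_ml]
  change dd (fun y => e 2 y + V y • e 3 y) c.a x
      + dd (e 0) (fun y => c.ν y - V y * (c.ρb y - c.ρ y) - V y * c.F y) x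
      + c.ρb x * (c.j x + 2 * V x * c.T x - dd (e 0) V x)
      - (c.ν x - V x * (c.ρb x - c.ρ x) - V x * c.F x - (c.μ x + V x * c.ρ x)) * c.a x
      - c.T x * (c.ν x - V x * (c.ρb x - c.ρ x) - V x * c.F x)
      + dd (e 3) (fun y => c.j y + 2 * V y * c.T y - dd (e 0) V y) x = _
  rw [dd_ksFrame, dd_sub (dν.fun_sub (dV.fun_mul (d2.fun_sub d1))) (dV.fun_mul dF),
    dd_sub dν (dV.fun_mul (d2.fun_sub d1)), dd_mul dV (d2.fun_sub d1), dd_mul dV dF,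
    dd_sub d2 d1, dd_sub (dj.fun_add ((dc.fun_mul dV).fun_mul dT)) dVm,
    dd_add dj ((dc.fun_mul dV).fun_mul dT), dd_mul (dc.fun_mul dV) dT, dd_mul dc dV, dd_const,
    H.dd_comm_k_m hx sV, H.dd_dd_k_V hV sachs hx, H.dd_k_V hV sachs hx, H.dd_V hV hx 0,
    hm, ha, hTk, hV x hx]
  ring

/-- Since δρ = 0, the commutator of δ and δ̄ reduces the second derivatives of V to first
derivatives of ρ and ρ̄. The part quadratic in τ cancels by the Sachs equations, and the linear part
is simplified with `dd_l_twist` and `dd_l_expansion`. Once T = 0, this defect is the only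
obstruction to splitting. -/
theorem ks_ricci_ll (hx : x ∈ U) (hT : ∀ y ∈ U, c.T y = 0)
    (hm : ∀ y ∈ U, dd (e 0) c.ρ y = 0) :
    frameRicci (ksFrame e V) (c.ks e V).γ 2 2 x = frameRicci e c.γ 2 2 x
      - 3 * τ * ((c.ρ x + c.ρb x) * (dd (e 2) c.ρ x + dd (e 2) c.ρb x)
        + (c.μ x + c.μb x) * (c.ρ x ^ 2 + c.ρb x ^ 2)) := by
  have hU := H.metric.isOpen
  have sV := H.smooth_V hV
  have dV := differentiableAt_of_smooth hU sV hx
  have d1 := differentiableAt_of_smooth hU H.smooth_ρ hx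
  have d2 := differentiableAt_of_smooth hU H.smooth_ρb hx
  have dμ := differentiableAt_of_smooth hU H.smooth_μ hx
  have dμb := differentiableAt_of_smooth hU H.smooth_μb hx
  have dj := differentiableAt_of_smooth hU H.smooth_j hx
  have djb := differentiableAt_of_smooth hU H.smooth_jb hx
  have dV0 := differentiableAt_of_smooth hU (smooth_dd hU (H.smooth 0) sV) hx
  have dV1 := differentiableAt_of_smooth hU (smooth_dd hU (H.smooth 1) sV) hx
  have hTb : ∀ y ∈ U, c.Tb y = 0 := fun y hy => by rw [H.conj_T y hy, hT y hy, star_zero]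
  have hmb : ∀ y ∈ U, dd (e 1) c.ρb y = 0 := fun y hy => by
    rw [H.dd_conj_m hy H.conj_ρ, hm y hy, star_zero]
  have e1 : ∀ y ∈ U, dd (e 1) V y = τ * dd (e 1) c.ρ y := fun y hy => by
    rw [H.dd_V hV hy, hmb y hy, add_zero]
  have e0 : ∀ y ∈ U, dd (e 0) V y = τ * dd (e 0) c.ρb y := fun y hy => by
    rw [H.dd_V hV hy, hm y hy, zero_add]
  have s1 := differentiableAt_of_smooth hU (smooth_dd hU (H.smooth 1) H.smooth_ρ) hx
  have s0 := differentiableAt_of_smooth hU (smooth_dd hU (H.smooth 0) H.smooth_ρb) hx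
  have f1 : dd (e 0) (dd (e 1) V) x = τ * (c.a x * dd (e 1) c.ρ x
      + (c.ρb x - c.ρ x) * dd (e 2) c.ρ x - (c.μ x - c.μb x) * c.ρ x ^ 2) := by
    rw [dd_congr hU e1 hx, dd_mul (differentiableAt_const τ) s1, dd_const,
      H.dd_comm_m_mb hx H.smooth_ρ, dd_congr hU hm hx, dd_const, hm x hx, (sachs x hx).1]
    ring
  have f0 : dd (e 1) (dd (e 0) V) x = τ * (c.ab x * dd (e 0) c.ρb x
      - (c.ρb x - c.ρ x) * dd (e 2) c.ρb x + (c.μ x - c.μb x) * c.ρb x ^ 2) := by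
    have h1 := H.dd_comm_m_mb hx H.smooth_ρb
    rw [dd_congr hU hmb hx, dd_const, hmb x hx, (sachs x hx).2] at h1
    rw [dd_congr hU e0 hx, dd_mul (differentiableAt_const τ) s0, dd_const]
    linear_combination -τ * h1
  have g1 : dd (e 0) (fun y => c.jb y + 2 * V y * c.Tb y - dd (e 1) V y) x
      = dd (e 0) c.jb x - dd (e 0) (dd (e 1) V) x := by
    rw [dd_congr (g := fun y => c.jb y - dd (e 1) V y) hU
      (fun y hy => by rw [hTb y hy]; ring) hx, dd_sub djb dV1]
  have g0 : dd (e 1) (fun y => c.j y + 2 * V y * c.T y - dd (e 0) V y) x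
      = dd (e 1) c.j x - dd (e 1) (dd (e 0) V) x := by
    rw [dd_congr (g := fun y => c.j y - dd (e 0) V y) hU
      (fun y hy => by rw [hT y hy]; ring) hx, dd_sub dj dV0]
  have t1 := H.dd_l_twist hx hT
  have t2 := H.dd_l_expansion hx
  rw [ricci_ll, ricci_ll]
  change -(dd (fun y => e 2 y + V y • e 3 y) (fun y => c.μ y + V y * c.ρ y) x
      + (c.μ x + V x * c.ρ x) * (c.μ x + V x * c.ρ x + (c.q x - dd (e 3) V x))
      - dd (e 0) (fun y => c.jb y + 2 * V y * c.Tb y - dd (e 1) V y) x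
      + c.a x * (c.jb x + 2 * V x * c.Tb x - dd (e 1) V x)
      + 2 * c.T x * (c.jb x + 2 * V x * c.Tb x - dd (e 1) V x))
    - (dd (fun y => e 2 y + V y • e 3 y) (fun y => c.μb y + V y * c.ρb y) x
      + (c.μb x + V x * c.ρb x) * (c.μb x + V x * c.ρb x + (c.q x - dd (e 3) V x))
      - dd (e 1) (fun y => c.j y + 2 * V y * c.T y - dd (e 0) V y) x
      + c.ab x * (c.j x + 2 * V x * c.T x - dd (e 0) V x)
      + 2 * c.Tb x * (c.j x + 2 * V x * c.T x - dd (e 0) V x)) = _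
  rw [dd_ksFrame, dd_ksFrame, g1, g0, f1, f0, e1 x hx, e0 x hx, hT x hx, hTb x hx]
  simp only [dd_add dμ (dV.fun_mul d1), dd_add dμb (dV.fun_mul d2), dd_mul dV d1, dd_mul dV d2,
    H.dd_k_V hV sachs hx, (sachs x hx).1, (sachs x hx).2, H.dd_V hV hx, hV x hx]
  linear_combination τ * (c.ρ x + c.ρb x) * t2 + τ * (c.ρb x - c.ρ x) * t1

end IsNullFrame

/-! ### Algebraically special vacuum metrics in terms of null frames -/

theorem cform_cvec (G : Ten2) (v w : Fin 4 → ℝ) :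
    cform G (cvec v) (cvec w) = ((∑ a, ∑ b, G a b * v a * w b : ℝ) : ℂ) := by
  simp [cform, cvec]

/-- A real orthonormal basis is √2 Re m, √2 Im m, (l - k)/√2, (l + k)/√2; the last vector is
timelike because l · k = -1. -/
theorem isLorentzian_of_gram {G : Ten2} {e : Fin 4 → Fin 4 → ℂ} {l k : Fin 4 → ℝ}
    (h : ∀ i j, cform G (e i) (e j) = eta i j) (hm : e 1 = star (e 0)) (hl : e 2 = cvec l)
    (hk : e 3 = cvec k) : IsLorentzian G := by
  obtain ⟨s, hs⟩ : ∃ s : ℝ, s * s = 1 / 2 :=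
    ⟨Real.sqrt (1 / 2), Real.mul_self_sqrt (by norm_num)⟩
  have hs' : (s : ℂ) * s = 1 / 2 := by
    rw [← Complex.ofReal_mul, hs]; norm_num
  set S : Fin 4 → Fin 4 → ℝ := ![fun a => 2 * s * (e 0 a).re, fun a => 2 * s * (e 0 a).im,
    fun a => s * (l a - k a), fun a => s * (l a + k a)] with hS
  have c0 : cvec (S 0) = (s : ℂ) • (e 0 + e 1) := by
    funext a
    simp only [hm, cvec, hS, Matrix.cons_val, Pi.smul_apply, Pi.add_apply, smul_eq_mul,
      Pi.star_apply]
    apply Complex.ext <;> simp <;> ring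
  have c1 : cvec (S 1) = (-Complex.I * s : ℂ) • (e 0 - e 1) := by
    funext a
    simp only [hm, cvec, hS, Matrix.cons_val, Pi.smul_apply, Pi.sub_apply, smul_eq_mul,
      Pi.star_apply]
    apply Complex.ext <;> simp <;> ring
  have c2 : cvec (S 2) = (s : ℂ) • (e 2 - e 3) := by
    funext a; simp [hl, hk, cvec, hS]
  have c3 : cvec (S 3) = (s : ℂ) • (e 2 + e 3) := by
    funext a; simp [hl, hk, cvec, hS]
  have key : ∀ i j, cform G (cvec (S i)) (cvec (S j))
      = ((Matrix.diagonal ![1, 1, 1, -1] : Ten2) i j : ℂ) := by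
    intro i j
    fin_cases i <;> fin_cases j <;>
      simp only [Fin.zero_eta, Fin.mk_one, Fin.reduceFinMk, c0, c1, c2, c3, cform_smul_left,
        cform_smul_right, cform_add_left, cform_add_right, cform_sub_left, cform_sub_right, h] <;>
      simp [eta] <;> first | linear_combination 2 * hs' | linear_combination -2 * hs' | skip
    all_goals ring_nf
    simp only [Complex.I_sq]
    linear_combination 2 * hs'
  have h2 : (Matrix.of S) * G * (Matrix.of S).transpose = Matrix.diagonal ![1, 1, 1, -1] := by
    ext i j
    have := key i j
    rw [cform_cvec] at this
    rw [← Complex.ofReal_inj.1 this, Finset.sum_comm]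
    simp only [Matrix.mul_apply, Matrix.transpose_apply, Matrix.of_apply, Finset.sum_mul]
    exact Finset.sum_congr rfl fun _ _ => Finset.sum_congr rfl fun _ _ => by ring
  refine ⟨(Matrix.of S).transpose, ?_, by rwa [Matrix.transpose_transpose]⟩
  have h3 := congrArg Matrix.det h2
  rw [Matrix.det_mul, Matrix.det_diagonal] at h3
  simp [Fin.prod_univ_four] at h3
  rw [Matrix.det_transpose]
  refine isUnit_iff_ne_zero.2 fun h0 => ?_
  rw [h0] at h3; simp at h3

theorem cd_cvec {g : Pt → Ten2} {k : Pt → Fin 4 → ℝ} {x : Pt}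
    (hk : ∀ a, DifferentiableAt ℝ (fun y => k y a) x) (a b : Fin 4) :
    cd g b (fun y => cvec (k y)) x a = (covDeriv g k a b x : ℂ) := by
  simp only [cd, covDeriv, cvec, pd_ofReal b (hk a)]
  push_cast
  rfl

theorem nab_cvec {g : Pt → Ten2} {k : Pt → Fin 4 → ℝ} {x : Pt}
    (hk : ∀ a, DifferentiableAt ℝ (fun y => k y a) x) (X : Pt → Fin 4 → ℂ) (a : Fin 4) :
    nab g X (fun y => cvec (k y)) x a = ∑ b, X x b * (covDeriv g k a b x : ℂ) := by
  simp only [nab, cd_cvec hk]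

/-- Translates the tensor k_{a;b}, in which shear and divergence are defined, into covariant
derivatives along frame vectors. -/
theorem cform_covDerivLow {g : Pt → Ten2} {k : Pt → Fin 4 → ℝ} {x : Pt}
    (hk : ∀ a, DifferentiableAt ℝ (fun y => k y a) x) (v : Fin 4 → ℂ) (X : Pt → Fin 4 → ℂ) :
    cform (covDerivLow g k x) v (X x)
      = cform (g x) v (nab g X (fun y => cvec (k y)) x) := by
  simp only [cform, nab_cvec hk, covDerivLow, Matrix.of_apply, Complex.ofReal_sum,
    Complex.ofReal_mul, Finset.mul_sum, Finset.sum_mul]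
  refine Finset.sum_congr rfl fun a _ => ?_
  rw [Finset.sum_comm]
  exact Finset.sum_congr rfl fun _ _ => Finset.sum_congr rfl fun _ _ => by ring

theorem sum_covDeriv {g : Pt → Ten2} {k ξ : Pt → Fin 4 → ℝ} {x : Pt}
    (hk : ∀ a, DifferentiableAt ℝ (fun y => k y a) x) (a : Fin 4) :
    nab g (fun y => cvec (ξ y)) (fun y => cvec (k y)) x a
      = ((∑ b, covDeriv g k a b x * ξ x b : ℝ) : ℂ) := by
  rw [nab_cvec hk]
  push_cast
  exact Finset.sum_congr rfl fun b _ => by rw [mul_comm]; rfl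

theorem sum_lower (g : Pt → Ten2) (k ξ : Pt → Fin 4 → ℝ) (x : Pt)
    (hs : ∀ a b, g x a b = g x b a) :
    ((∑ a, lower g k x a * ξ x a : ℝ) : ℂ) = cform (g x) (cvec (k x)) (cvec (ξ x)) := by
  rw [cform_cvec, Finset.sum_comm]
  congr 1
  refine Finset.sum_congr rfl fun a _ => ?_
  rw [lower, Finset.sum_mul]
  exact Finset.sum_congr rfl fun b _ => by rw [hs a b]; try ring

theorem curv_tensorial {g : Pt → Ten2} {x : Pt} {X X' Y Y' Z Z' : Pt → Fin 4 → ℂ}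
    (hX : X x = X' x) (hY : Y x = Y' x) (hZ : Z x = Z' x) :
    curv g X Y Z x = curv g X' Y' Z' x := by
  funext a; simp only [curv, hX, hY, hZ]

theorem curv_sum_mid {g : Pt → Ten2} {x : Pt} {X Y Z : Pt → Fin 4 → ℂ}
    {e : Fin 4 → Pt → Fin 4 → ℂ} {v : Fin 4 → ℂ} (hY : Y x = ∑ i, v i • e i x) :
    curv g X Y Z x = ∑ i, v i • curv g X (e i) Z x := by
  have h : ∀ (A : Fin 4 → ℂ) (E K : Fin 4 → Fin 4 → ℂ),
      ∑ c, ∑ d, A c * (∑ i, v i * E i d) * K c d = ∑ i, v i * ∑ c, ∑ d, A c * E i d * K c d := by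
    intro A E K
    simp only [Finset.mul_sum, Finset.sum_mul]
    rw [Finset.sum_congr rfl fun c _ => Finset.sum_comm, Finset.sum_comm]
    exact Finset.sum_congr rfl fun _ _ => Finset.sum_congr rfl fun _ _ =>
      Finset.sum_congr rfl fun _ _ => by ring
  funext a
  simp only [curv, hY, Finset.sum_apply, Pi.smul_apply, smul_eq_mul]
  exact h _ _ _

theorem curv_sum_right {g : Pt → Ten2} {x : Pt} {X Y Z : Pt → Fin 4 → ℂ}
    {e : Fin 4 → Pt → Fin 4 → ℂ} {v : Fin 4 → ℂ} (hZ : Z x = ∑ i, v i • e i x) :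
    curv g X Y Z x = ∑ i, v i • curv g X Y (e i) x := by
  have h : ∀ (A : Fin 4 → Fin 4 → ℂ) (E : Fin 4 → Fin 4 → ℂ) (K : Fin 4 → Fin 4 → Fin 4 → ℂ),
      ∑ c, ∑ d, A c d * ∑ b, K c d b * (∑ i, v i * E i b)
        = ∑ i, v i * ∑ c, ∑ d, A c d * ∑ b, K c d b * E i b := by
    intro A E K
    simp only [Finset.mul_sum]
    rw [Finset.sum_congr rfl fun c _ => Finset.sum_congr rfl fun d _ => Finset.sum_comm,
      Finset.sum_congr rfl fun c _ => Finset.sum_comm, Finset.sum_comm]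
    exact Finset.sum_congr rfl fun _ _ => Finset.sum_congr rfl fun _ _ =>
      Finset.sum_congr rfl fun _ _ => Finset.sum_congr rfl fun _ _ => by ring
  funext a
  simp only [curv, hZ, Finset.sum_apply, Pi.smul_apply, smul_eq_mul]
  exact h (fun c d => X x c * Y x d) _ _

namespace IsNullFrame

variable {U : Set Pt} {g : Pt → Ten2} {e : Fin 4 → Pt → Fin 4 → ℂ} {c : Coefs}
  (H : IsNullFrame U g e c) {k : Pt → Fin 4 → ℝ} {x : Pt}
include H

theorem exists_real_l (x : Pt) (hx : x ∈ U) : ∃ l : Fin 4 → ℝ, e 2 x = cvec l := by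
  refine ⟨fun a => (e 2 x a).re, funext fun a => ?_⟩
  exact (Complex.conj_eq_iff_re.1 (congrFun (H.real_l x hx) a)).symm

theorem isLorentzian (hx : x ∈ U) (hk : e 3 x = cvec (k x)) : IsLorentzian (g x) := by
  obtain ⟨l, hl⟩ := H.exists_real_l x hx
  exact isLorentzian_of_gram (H.gram x hx) (H.conj_m x hx) hl hk

theorem isNullTetrad (hx : x ∈ U) (hk : e 3 x = cvec (k x)) {l : Fin 4 → ℝ}
    (hl : e 2 x = cvec l) : IsNullTetrad (g x) (e 0 x) l (k x) where
  m_m := H.gram x hx 0 0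
  m_conj := by rw [← H.conj_m x hx]; exact H.gram x hx 0 1
  m_l := by rw [← hl]; exact H.gram x hx 0 2
  m_k := by rw [← hk]; exact H.gram x hx 0 3
  l_l := by rw [← hl]; exact H.gram x hx 2 2
  k_k := by rw [← hk]; exact H.gram x hx 3 3
  k_l := by rw [← hl, ← hk]; exact H.gram x hx 3 2

theorem nab_k_k (hx : x ∈ U) : nab g (e 3) (e 3) x = 0 := by
  rw [H.nab_eq hx]; simp [Coefs.γ, Fin.sum_univ_four]

theorem nab_m_k (hx : x ∈ U) : nab g (e 0) (e 3) x = c.ρb x • e 0 x - c.T x • e 3 x := by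
  rw [H.nab_eq hx]; simp [Coefs.γ, Fin.sum_univ_four, sub_eq_add_neg]

theorem nab_mb_k (hx : x ∈ U) : nab g (e 1) (e 3) x = c.ρ x • e 1 x - c.Tb x • e 3 x := by
  rw [H.nab_eq hx]; simp [Coefs.γ, Fin.sum_univ_four, sub_eq_add_neg]

theorem nab_l_k (hx : x ∈ U) : nab g (e 2) (e 3) x = c.q x • e 3 x := by
  rw [H.nab_eq hx]; simp [Coefs.γ, Fin.sum_univ_four]

theorem divergence (hk : ∀ y ∈ U, e 3 y = cvec (k y))
    (sk : ∀ a, DifferentiableAt ℝ (fun y => k y a) x) (hx : x ∈ U) :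
    cform (covDerivLow g k x) (e 0 x) (star (e 0 x)) = c.ρ x := by
  rw [← H.conj_m x hx, cform_covDerivLow sk, ← nab_congr H.metric.isOpen hk hx, H.nab_mb_k hx]
  simp only [cform_sub_right, cform_smul_right, H.gram x hx]
  simp [eta]

/-- The condition concerns every tetrad, the table only one. Any other tetrad vector is orthogonal
to k, hence equal to αm + βm̄ - δk; its shear is αβ(ρ + ρ̄), and αβ = 0 because it is null. -/
theorem shearfree (hk : ∀ y ∈ U, e 3 y = cvec (k y))
    (sk : ∀ a, DifferentiableAt ℝ (fun y => k y a) x) (hx : x ∈ U) {m : Fin 4 → ℂ}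
    {l : Fin 4 → ℝ} (h : IsNullTetrad (g x) m l (k x)) :
    cform (covDerivLow g k x) m m = 0 := by
  have ex := frame_expansion (H.gram x hx) m
  rw [hk x hx, h.m_k] at ex
  have h2 := h.m_m
  set α := cform (g x) m (e 1 x)
  set β := cform (g x) m (e 0 x)
  set δ := cform (g x) m (e 2 x)
  have ex' : m = ∑ i, ![α, β, 0, -δ] i • e i x := by
    rw [Fin.sum_univ_four]
    conv_lhs => rw [ex]
    simp [hk x hx, sub_eq_add_neg]
  have key := cform_covDerivLow (g := g) sk m (fun _ => m)
  rw [key, ← nab_congr H.metric.isOpen hk hx, nab_left g (fun _ => m) (e 3) x _ e ex',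
    Fin.sum_univ_four, H.nab_m_k hx, H.nab_mb_k hx, H.nab_k_k hx]
  rw [ex', Fin.sum_univ_four] at h2 ⊢
  simp only [cform_add_left, cform_add_right, cform_sub_right, cform_smul_left, cform_smul_right,
    cform_zero_right, H.gram x hx] at h2 ⊢
  simp [eta] at h2 ⊢
  linear_combination (1 / 2) * (c.ρ x + c.ρb x) * h2

/-- Handles Ψ₀ and Ψ₁ at once: when T = 0, the Sachs equations give ⟨k, R(k, X) Y⟩ = 0 for all X
orthogonal to k and all Y, and no more is needed for either component. -/
theorem psi_zero (hk : e 3 x = cvec (k x)) (hx : x ∈ U) (hT : ∀ y ∈ U, c.T y = 0)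
    (sachs : dd (e 3) c.ρ x = -c.ρ x ^ 2 ∧ dd (e 3) c.ρb x = -c.ρb x ^ 2)
    {m w : Fin 4 → ℂ} (hm : cform (g x) m (cvec (k x)) = 0) :
    riemannForm g x (cvec (k x)) w (cvec (k x)) m = 0 := by
  have hTb : ∀ y ∈ U, c.Tb y = 0 := fun y hy => by rw [H.conj_T y hy, hT y hy, star_zero]
  have expand : ∀ m, ∃ v : Fin 4 → ℂ, m = ∑ i, v i • e i x
      ∧ v 2 = -cform (g x) m (e 3 x) := by
    intro m
    refine ⟨![cform (g x) m (e 1 x), cform (g x) m (e 0 x), -cform (g x) m (e 3 x),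
      -cform (g x) m (e 2 x)], ?_, by simp⟩
    conv_lhs => rw [frame_expansion (H.gram x hx) m]
    rw [Fin.sum_univ_four]
    simp [sub_eq_add_neg]
  obtain ⟨v, hv, hv2⟩ := expand m
  obtain ⟨u, hu, -⟩ := expand w
  rw [hk, hm, neg_zero] at hv2
  -- Inner products with k pick out the l-component; `i = 2` is excluded because a vector orthogonal
  -- to k has no l-part.
  have h2 : ∀ i, i ≠ 2 → ∀ j, frameCurv e c.γ 3 i j 2 x = 0 := by
    intro i hi j
    have t1 : dd (e 3) c.T x = 0 := by rw [dd_congr H.metric.isOpen hT hx, dd_const]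
    have t2 : dd (e 3) c.Tb x = 0 := by rw [dd_congr H.metric.isOpen hTb hx, dd_const]
    have t3 := hT x hx
    have t4 := hTb x hx
    fin_cases i <;> fin_cases j <;>
      first
      | exact absurd rfl hi
      | (simp [frameCurv, Coefs.γ, Fin.sum_univ_four, dd_neg', dd_zero, t1, t2, t3, t4, sachs.1,
          sachs.2]; done)
      | (simp [frameCurv, Coefs.γ, Fin.sum_univ_four, dd_neg', dd_zero, t1, t2, t3, t4, sachs.1,
          sachs.2]; ring)
  have h3 : curv g (fun _ => cvec (k x)) (fun _ => m) (fun _ => w) x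
      = ∑ i, ∑ j, (v i * u j) • curv g (e 3) (e i) (e j) x := by
    rw [curv_tensorial (X' := e 3) hk.symm rfl rfl, curv_sum_mid hv]
    refine Finset.sum_congr rfl fun i _ => ?_
    rw [curv_sum_right hu, Finset.smul_sum]
    exact Finset.sum_congr rfl fun j _ => by rw [smul_smul]
  rw [riemannForm_eq, h3, cform_sum_right]
  refine Finset.sum_eq_zero fun i _ => ?_
  rw [cform_sum_right]
  refine Finset.sum_eq_zero fun j _ => ?_
  by_cases hi : i = 2
  · rw [hi, hv2, zero_mul, zero_smul, cform_zero_right]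
  · rw [cform_smul_right, H.curv_eq hx, ← hk, cform_sum_right]
    simp only [cform_smul_right, H.gram x hx, Fin.sum_univ_four]
    simp [eta, h2 i hi j]

end IsNullFrame

/-- Vacuum metrics with local null frames are algebraically special. -/
theorem IsAlgSpecialVacuum.of_frames {U : Set Pt} {g : Pt → Ten2} {k : Pt → Fin 4 → ℝ}
    (hk : ContDiffOn ℝ ∞ k U)
    (h : ∀ x ∈ U, ∃ N e c, x ∈ N ∧ IsNullFrame N g e c ∧ (∀ y ∈ N, e 3 y = cvec (k y)) ∧
      (∀ y ∈ N, c.T y = 0) ∧ ∀ y ∈ N, ∀ a b, ricci g a b y = 0) :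
    IsAlgSpecialVacuum U g k := by
  have sk : ∀ {N e c}, IsNullFrame N g e c → (∀ y ∈ N, e 3 y = cvec (k y)) → ∀ x ∈ N, ∀ a,
      DifferentiableAt ℝ (fun y => k y a) x := by
    intro N e c H hk x hx a
    refine differentiableAt_of_smooth H.metric.isOpen
      ((smooth_re (smooth_apply (H.smooth 3) a)).congr fun y hy => ?_) hx
    rw [hk y hy]; simp [cvec]
  refine ⟨fun a b x hx => ?_, fun x hx => ?_, fun x hx => ?_, hk, fun x hx => ?_, fun x hx => ?_,
    fun x hx a => ?_, fun x hx m l hm => ?_, fun x hx m l hm => ?_, fun x hx m l hm => ?_⟩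
  -- Every condition is local, so a frame near each point suffices; a global m is not required.
  all_goals obtain ⟨N, e, c, hxN, H, hkN, hT, hv⟩ := h x hx
  · exact ((H.metric.smooth a b).contDiffAt (H.metric.isOpen.mem_nhds hxN)).contDiffWithinAt
  · exact H.isLorentzian hxN (hkN x hxN)
  · exact hv x hxN
  · intro h0
    have := H.gram x hxN 2 3
    rw [hkN x hxN, h0, show cvec 0 = 0 by funext a; simp [cvec], cform_zero_right] at this
    simp [eta] at this
  · have := sum_lower g k k x (H.metric.symm x hxN)
    rw [← hkN x hxN, H.gram x hxN] at this
    exact_mod_cast this.trans (show eta 3 3 = ((0 : ℝ) : ℂ) by simp [eta])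
  · have := sum_covDeriv (g := g) (ξ := k) (sk H hkN x hxN) a
    rw [← nab_congr H.metric.isOpen hkN hxN] at this
    have h1 := congrFun (H.nab_k_k hxN) a
    have h2 : nab g (e 3) (e 3) x = nab g (fun y => cvec (k y)) (e 3) x := by
      funext a; simp [nab, hkN x hxN]
    rw [h2, this] at h1
    exact Complex.ofReal_eq_zero.1 h1
  · exact H.shearfree hkN (sk H hkN x hxN) hxN hm
  · exact H.psi_zero (hkN x hxN) hxN hT
      (H.sachs hxN (H.ricci_zero hxN (hv x hxN) 3 3)) hm.m_k
  · exact H.psi_zero (hkN x hxN) hxN hT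
      (H.sachs hxN (H.ricci_zero hxN (hv x hxN) 3 3)) hm.m_k

/-- The complex divergence in terms of a null frame. -/
theorem IsNullFrame.divergence_eq {N : Set Pt} {g : Pt → Ten2} {e : Fin 4 → Pt → Fin 4 → ℂ}
    {c : Coefs} {k : Pt → Fin 4 → ℝ} {x : Pt} (H : IsNullFrame N g e c) (hx : x ∈ N)
    (hk : ∀ y ∈ N, e 3 y = cvec (k y)) {r s : ℝ} (h : ((r : ℂ) + Complex.I * s) * c.ρ x = 1) :
    ∃ m l, IsNullTetrad (g x) m l (k x) ∧
      ((r : ℂ) + Complex.I * s) * cform (covDerivLow g k x) m (star m) = 1 := by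
  obtain ⟨l, hl⟩ := H.exists_real_l x hx
  have sk : ∀ a, DifferentiableAt ℝ (fun y => k y a) x := by
    intro a
    refine differentiableAt_of_smooth H.metric.isOpen
      ((smooth_re (smooth_apply (H.smooth 3) a)).congr fun y hy => ?_) hx
    rw [hk y hy]; simp [cvec]
  exact ⟨e 0 x, l, H.isNullTetrad hx (hk x hx) hl, by rw [H.divergence hk sk hx, h]⟩

/-! ### Local null frames of stationary metrics -/

theorem IsLorentzian.symm {G : Ten2} (h : IsLorentzian G) (a b : Fin 4) : G a b = G b a := by
  obtain ⟨S, hS, h⟩ := h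
  have hS' : IsUnit S.transpose.det := by rwa [Matrix.det_transpose]
  have h1 : G.transpose = G := by
    have h2 : S.transpose * G.transpose * S = S.transpose * G * S := by
      rw [h]
      have := congrArg Matrix.transpose h
      rwa [Matrix.transpose_mul, Matrix.transpose_mul, Matrix.transpose_transpose,
        Matrix.diagonal_transpose, ← Matrix.mul_assoc] at this
    have h3 : S.transpose * G.transpose = S.transpose * G := by
      rw [← Matrix.mul_nonsing_inv_cancel_right S (S.transpose * G.transpose) hS, h2,
        Matrix.mul_nonsing_inv_cancel_right S _ hS]
    rw [← Matrix.nonsing_inv_mul_cancel_left S.transpose G.transpose hS', h3,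
      Matrix.nonsing_inv_mul_cancel_left S.transpose _ hS']
  exact congrFun (congrFun h1 b) a

theorem IsLorentzian.det {G : Ten2} (h : IsLorentzian G) : IsUnit G.det := by
  obtain ⟨S, hS, h⟩ := h
  have h3 := congrArg Matrix.det h
  rw [Matrix.det_mul, Matrix.det_mul, Matrix.det_diagonal] at h3
  simp [Fin.prod_univ_four] at h3
  refine isUnit_iff_ne_zero.2 fun h0 => ?_
  rw [h0] at h3; simp at h3

theorem IsAlgSpecialVacuum.metric {U : Set Pt} {g : Pt → Ten2} {k : Pt → Fin 4 → ℝ}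
    (hU : IsOpen U) (h : IsAlgSpecialVacuum U g k) : IsSmoothMetric U g :=
  ⟨hU, h.smooth_g, fun x hx => (h.lorentzian x hx).symm, fun x hx => (h.lorentzian x hx).det⟩

theorem IsSmoothMetric.mono {U N : Set Pt} {g : Pt → Ten2} (h : IsSmoothMetric U g)
    (hN : IsOpen N) (hNU : N ⊆ U) : IsSmoothMetric N g :=
  ⟨hN, fun a b => (h.smooth a b).mono hNU, fun x hx => h.symm x (hNU hx),
    fun x hx => h.det x (hNU hx)⟩

/-- The real inner product. -/
def rform (G : Ten2) (v w : Fin 4 → ℝ) : ℝ := ∑ a, ∑ b, G a b * v a * w b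

theorem cform_rform (G : Ten2) (v w : Fin 4 → ℝ) :
    cform G (cvec v) (cvec w) = (rform G v w : ℂ) := cform_cvec G v w

theorem cvec_add (v w : Fin 4 → ℝ) : cvec (v + w) = cvec v + cvec w := by
  funext a; simp [cvec]

theorem cvec_smul (t : ℝ) (v : Fin 4 → ℝ) : cvec (t • v) = (t : ℂ) • cvec v := by
  funext a; simp [cvec]

theorem star_cvec (v : Fin 4 → ℝ) : star (cvec v) = cvec v := by
  funext a; simp [cvec]

theorem rform_add_left (G : Ten2) (u v w : Fin 4 → ℝ) :
    rform G (u + v) w = rform G u w + rform G v w := by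
  have := cform_add_left G (cvec u) (cvec v) (cvec w)
  rw [← cvec_add] at this
  simp only [cform_rform] at this
  exact_mod_cast this

theorem rform_smul_left (G : Ten2) (t : ℝ) (v w : Fin 4 → ℝ) :
    rform G (t • v) w = t * rform G v w := by
  have := cform_smul_left G t (cvec v) (cvec w)
  rw [← cvec_smul] at this
  simp only [cform_rform] at this
  exact_mod_cast this

theorem rform_add_right (G : Ten2) (u v w : Fin 4 → ℝ) :
    rform G w (u + v) = rform G w u + rform G w v := by
  have := cform_add_right G (cvec w) (cvec u) (cvec v)
  rw [← cvec_add] at this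
  simp only [cform_rform] at this
  exact_mod_cast this

theorem rform_smul_right (G : Ten2) (t : ℝ) (v w : Fin 4 → ℝ) :
    rform G v (t • w) = t * rform G v w := by
  have := cform_smul_right G t (cvec v) (cvec w)
  rw [← cvec_smul] at this
  simp only [cform_rform] at this
  exact_mod_cast this

theorem IsSmoothMetric.rform_comm {U : Set Pt} {g : Pt → Ten2} {x : Pt}
    (hg : IsSmoothMetric U g) (hx : x ∈ U) (v w : Fin 4 → ℝ) :
    rform (g x) v w = rform (g x) w v := by
  have := hg.cform_comm hx (cvec v) (cvec w)
  simp only [cform_rform] at this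
  exact_mod_cast this

theorem IsSmoothMetric.smooth_rform {U : Set Pt} {g : Pt → Ten2} {v w : Pt → Fin 4 → ℝ}
    (hg : IsSmoothMetric U g) (hv : ContDiffOn ℝ ∞ v U) (hw : ContDiffOn ℝ ∞ w U) :
    ContDiffOn ℝ ∞ (fun y => rform (g y) (v y) (w y)) U :=
  ContDiffOn.sum fun a _ => ContDiffOn.sum fun b _ =>
    ((hg.smooth a b).mul (contDiffOn_pi.1 hv a)).mul (contDiffOn_pi.1 hw b)

theorem smooth_cvec {U : Set Pt} {v : Pt → Fin 4 → ℝ} (hv : ContDiffOn ℝ ∞ v U) :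
    ContDiffOn ℝ ∞ (fun y => cvec (v y)) U :=
  contDiffOn_pi.2 fun a => smooth_ofReal (contDiffOn_pi.1 hv a)

/-- A null tetrad at a point extends to a smooth null frame with prescribed real null vectors. -/
theorem exists_local_tetrad {U : Set Pt} {g : Pt → Ten2} {k l : Pt → Fin 4 → ℝ}
    (hg : IsSmoothMetric U g) (sk : ContDiffOn ℝ ∞ k U) (sl : ContDiffOn ℝ ∞ l U)
    (kk : ∀ x ∈ U, rform (g x) (k x) (k x) = 0) (ll : ∀ x ∈ U, rform (g x) (l x) (l x) = 0)
    (kl : ∀ x ∈ U, rform (g x) (k x) (l x) = -1) {x₀ : Pt} (hx₀ : x₀ ∈ U) {m₀ : Fin 4 → ℂ}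
    {l₀ : Fin 4 → ℝ} (h₀ : IsNullTetrad (g x₀) m₀ l₀ (k x₀)) :
    ∃ N, IsOpen N ∧ x₀ ∈ N ∧ N ⊆ U ∧ ∃ m : Pt → Fin 4 → ℂ, ContDiffOn ℝ ∞ m N ∧
      ∀ x ∈ N, cform (g x) (m x) (m x) = 0 ∧ cform (g x) (m x) (star (m x)) = 1 ∧
        cform (g x) (m x) (cvec (l x)) = 0 ∧ cform (g x) (m x) (cvec (k x)) = 0 := by
  have comm := fun x (hx : x ∈ U) => hg.rform_comm hx
  -- the projection of a constant vector to the orthogonal complement of `k` and `l`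
  let π : (Fin 4 → ℝ) → Pt → Fin 4 → ℝ := fun v y =>
    v + rform (g y) v (k y) • l y + rform (g y) v (l y) • k y
  have sπ : ∀ v, ContDiffOn ℝ ∞ (π v) U := fun v =>
    (contDiffOn_const.add ((hg.smooth_rform contDiffOn_const sk).smul sl)).add
      ((hg.smooth_rform contDiffOn_const sl).smul sk)
  have πk : ∀ v, ∀ y ∈ U, rform (g y) (π v y) (k y) = 0 := by
    intro v y hy
    simp only [π, rform_add_left, rform_smul_left, kk y hy, comm y hy (l y), kl y hy]
    ring
  have πl : ∀ v, ∀ y ∈ U, rform (g y) (π v y) (l y) = 0 := by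
    intro v y hy
    simp only [π, rform_add_left, rform_smul_left, ll y hy, kl y hy]
    ring
  obtain ⟨v, w, hvw⟩ : ∃ v w : Fin 4 → ℝ, m₀ = cvec v + Complex.I • cvec w := by
    refine ⟨fun a => (m₀ a).re, fun a => (m₀ a).im, funext fun a => ?_⟩
    simp [cvec, mul_comm Complex.I]
  have hstar : star m₀ = cvec v - Complex.I • cvec w := by
    rw [hvw, star_add, star_smul, star_cvec, star_cvec]
    simp [sub_eq_add_neg]
  have e1 := h₀.m_m
  have e2 := h₀.m_conj
  have e3 := h₀.m_k
  rw [hstar] at e2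
  rw [hvw] at e1 e2 e3
  simp only [cform_add_left, cform_add_right, cform_sub_right, cform_smul_left,
    cform_smul_right, cform_rform] at e1 e2 e3
  rw [comm x₀ hx₀ w v] at e1 e2
  have r1 := congrArg Complex.re e1
  have i1 := congrArg Complex.im e1
  have r2 := congrArg Complex.re e2
  have r3 := congrArg Complex.re e3
  have i3 := congrArg Complex.im e3
  simp at r1 i1 r2 r3 i3
  have hvv : rform (g x₀) v v = 1 / 2 := by linarith
  have hww : rform (g x₀) w w = 1 / 2 := by linarith
  have hvw0 : rform (g x₀) v w = 0 := by linarith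
  -- On vectors orthogonal to k the projection only adds multiples of k, so it preserves their inner
  -- products, even if the prescribed `l` differs from `l₀` at `x₀`.
  have ππ : ∀ v w, rform (g x₀) v (k x₀) = 0 → rform (g x₀) w (k x₀) = 0 →
      rform (g x₀) (π v x₀) (π w x₀) = rform (g x₀) v w := by
    intro v w hv hw
    have hk := comm x₀ hx₀
    simp only [π, rform_add_left, rform_smul_left, rform_add_right, rform_smul_right, hv, hw,
      kk x₀ hx₀, hk (k x₀) w]
    ring
  let p := π v
  let A : Pt → ℝ := fun y => rform (g y) (p y) (p y)
  -- Gram-Schmidt without division: q is orthogonal to p. The real and imaginary parts of `m₀` have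
  -- square norm 1/2, whence A = 1/2 and B = 1/8 at `x₀`; both remain positive nearby, where p and q
  -- can be normalized.
  let q : Pt → Fin 4 → ℝ := fun y => A y • π w y + (-rform (g y) (p y) (π w y)) • p y
  let B : Pt → ℝ := fun y => rform (g y) (q y) (q y)
  have sA : ContDiffOn ℝ ∞ A U := hg.smooth_rform (sπ v) (sπ v)
  have sq : ContDiffOn ℝ ∞ q U :=
    (sA.smul (sπ w)).add ((hg.smooth_rform (sπ v) (sπ w)).neg.smul (sπ v))
  have sB : ContDiffOn ℝ ∞ B U := hg.smooth_rform sq sq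
  have A0 : A x₀ = 1 / 2 := (ππ v v r3 r3).trans hvv
  have q0 : q x₀ = (1 / 2 : ℝ) • π w x₀ := by
    simp only [q, p, A0, ππ v w r3 i3, hvw0]; simp
  have B0 : B x₀ = 1 / 8 := by
    simp only [B, q0, rform_smul_left, rform_smul_right, ππ w w i3 i3, hww]; norm_num
  have hpq : ∀ y ∈ U, rform (g y) (p y) (q y) = 0 := by
    intro y _
    simp only [q, A, rform_add_right, rform_smul_right]; ring
  have hpk := πk v
  have hpl := πl v
  have hqk : ∀ y ∈ U, rform (g y) (q y) (k y) = 0 := by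
    intro y hy
    simp only [q, p, rform_add_left, rform_smul_left, πk _ y hy]; ring
  have hql : ∀ y ∈ U, rform (g y) (q y) (l y) = 0 := by
    intro y hy
    simp only [q, p, rform_add_left, rform_smul_left, πl _ y hy]; ring
  refine ⟨(U ∩ A ⁻¹' Set.Ioi 0) ∩ (U ∩ B ⁻¹' Set.Ioi 0),
    (sA.continuousOn.isOpen_inter_preimage hg.isOpen isOpen_Ioi).inter
      (sB.continuousOn.isOpen_inter_preimage hg.isOpen isOpen_Ioi),
    ⟨⟨hx₀, by simp [A0]⟩, hx₀, by simp [B0]⟩, fun y hy => hy.1.1,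
    fun y => cvec ((Real.sqrt (2 * A y))⁻¹ • p y)
      + Complex.I • cvec ((Real.sqrt (2 * B y))⁻¹ • q y), ?_, ?_⟩
  · have inv : ∀ {C : Pt → ℝ} {N : Set Pt}, ContDiffOn ℝ ∞ C N → (∀ y ∈ N, 0 < C y) →
        ContDiffOn ℝ ∞ (fun y => (Real.sqrt (2 * C y))⁻¹) N := by
      intro C N hC hpos
      refine ContDiffOn.inv (ContDiffOn.sqrt (contDiffOn_const.mul hC) fun y hy => ?_)
        fun y hy => ?_
      · have := hpos y hy; positivity
      · have := hpos y hy; positivity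
    have sub : ((U ∩ A ⁻¹' Set.Ioi 0) ∩ (U ∩ B ⁻¹' Set.Ioi 0)) ⊆ U := fun y hy => hy.1.1
    refine (smooth_cvec ((inv (sA.mono sub) fun y hy => hy.1.2).smul ((sπ v).mono sub))).add ?_
    exact (smooth_cvec ((inv (sB.mono sub) fun y hy => hy.2.2).smul
      (sq.mono sub))).const_smul Complex.I
  · rintro y ⟨⟨hy, hA⟩, -, hB⟩
    have hA : 0 < A y := hA
    have hB : 0 < B y := hB
    have nA : (Real.sqrt (2 * A y))⁻¹ * ((Real.sqrt (2 * A y))⁻¹ * A y) = 1 / 2 := by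
      rw [← mul_assoc, ← mul_inv, Real.mul_self_sqrt (by positivity)]; field_simp
    have nB : (Real.sqrt (2 * B y))⁻¹ * ((Real.sqrt (2 * B y))⁻¹ * B y) = 1 / 2 := by
      rw [← mul_assoc, ← mul_inv, Real.mul_self_sqrt (by positivity)]; field_simp
    beta_reduce
    generalize (Real.sqrt (2 * A y))⁻¹ = α at nA ⊢
    generalize (Real.sqrt (2 * B y))⁻¹ = β at nB ⊢
    have nA' : (α : ℂ) * (α * A y) = 1 / 2 := by
      rw [← Complex.ofReal_mul, ← Complex.ofReal_mul, nA]; norm_num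
    have nB' : (β : ℂ) * (β * B y) = 1 / 2 := by
      rw [← Complex.ofReal_mul, ← Complex.ofReal_mul, nB]; norm_num
    have fA : rform (g y) (p y) (p y) = A y := rfl
    have fB : rform (g y) (q y) (q y) = B y := rfl
    have hst : star (cvec (α • p y) + Complex.I • cvec (β • q y))
        = cvec (α • p y) - Complex.I • cvec (β • q y) := by
      rw [star_add, star_smul, star_cvec, star_cvec]
      simp [sub_eq_add_neg]
    rw [hst]
    simp only [cform_add_left, cform_add_right, cform_sub_right, cform_smul_left,
      cform_smul_right, cform_rform, rform_smul_left, rform_smul_right, comm y hy (q y) (p y),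
      hpq y hy, fA, fB, hqk y hy, hql y hy]
    rw [show rform (g y) (p y) (k y) = 0 from hpk y hy,
      show rform (g y) (p y) (l y) = 0 from hpl y hy]
    refine ⟨?_, ?_, by simp, by simp⟩
    · push_cast
      linear_combination nA' + Complex.I ^ 2 * nB' + (1 / 2) * Complex.I_sq
    · push_cast
      linear_combination nA' - Complex.I ^ 2 * nB' - (1 / 2) * Complex.I_sq

theorem nab_star (g : Pt → Ten2) (X Y : Pt → Fin 4 → ℂ) (x : Pt) :
    nab g (fun y => star (X y)) (fun y => star (Y y)) x = star (nab g X Y x) := by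
  funext a
  have h := fun c b => pd_star (x := x) (f := fun y => Y y b) c
  simp only [nab, cd, Pi.star_apply, star_sum, star_mul', star_add, h]
  simp

theorem nab_add_smul_right {U : Set Pt} (g : Pt → Ten2) {X Y Z : Pt → Fin 4 → ℂ} {f : Pt → ℂ}
    {x : Pt} (hU : IsOpen U) (hY : ContDiffOn ℝ ∞ Y U) (hZ : ContDiffOn ℝ ∞ Z U)
    (hf : ContDiffOn ℝ ∞ f U) (hx : x ∈ U) : nab g X (fun y => Y y + f y • Z y) x
      = nab g X Y x + (dd X f x • Z x + f x • nab g X Z x) := by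
  have := nab_sum (g := g) (X := X) (x := x) hU (c := ![1, f, 0, 0]) (e := ![Y, Z, Y, Y])
    (fun k => by fin_cases k <;> first | exact contDiffOn_const | exact hf)
    (fun k => by fin_cases k <;> first | exact hY | exact hZ) hx
  simpa [Fin.sum_univ_four, dd_zero, show dd X 1 x = 0 from dd_const 1] using this

theorem nab_add_smul_left (g : Pt → Ten2) (X Y Z : Pt → Fin 4 → ℂ) (f : Pt → ℂ) (x : Pt) :
    nab g (fun y => X y + f y • Z y) Y x = nab g X Y x + f x • nab g Z Y x := by
  funext a
  simp [nab, add_mul, Finset.sum_add_distrib, Finset.mul_sum, mul_assoc]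

/-- The Killing equation in covariant form. -/
theorem IsStationaryFor.cform_nab {U : Set Pt} {g : Pt → Ten2} {k ξ : Pt → Fin 4 → ℝ}
    (hg : IsSmoothMetric U g) (h : IsStationaryFor U g k ξ) {x : Pt} (hx : x ∈ U)
    (Y Z : Pt → Fin 4 → ℂ) : cform (g x) (nab g Y (fun y => cvec (ξ y)) x) (Z x)
      + cform (g x) (Y x) (nab g Z (fun y => cvec (ξ y)) x) = 0 := by
  have sξ := fun a => differentiableAt_of_smooth hg.isOpen (contDiffOn_pi.1 h.smooth a) hx
  have hk : ∀ a b, ∑ c, (g x c b * covDeriv g ξ c a x + g x a c * covDeriv g ξ c b x) = 0 := by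
    intro a b
    rw [← h.killing x hx a b]
    have e1 := fun c => hg.pd_metric hx c a b
    have e2 := fun d c => hg.christoffel_symm hx d c a
    have e3 := fun d c => hg.christoffel_symm hx d c b
    simp only [covDeriv, e1, e2, e3, Finset.sum_add_distrib, mul_add, Finset.mul_sum]
    have e4 : ∑ c, ∑ d, ξ x c * (g x d b * christoffel g d a c x)
        = ∑ c, ∑ d, g x c b * (christoffel g c a d x * ξ x d) := by
      rw [Finset.sum_comm]
      exact Finset.sum_congr rfl fun _ _ => Finset.sum_congr rfl fun _ _ => by ring
    have e5 : ∑ c, ∑ d, ξ x c * (g x a d * christoffel g d b c x)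
        = ∑ c, ∑ d, g x a c * (christoffel g c b d x * ξ x d) := by
      rw [Finset.sum_comm]
      exact Finset.sum_congr rfl fun _ _ => Finset.sum_congr rfl fun _ _ => by ring
    rw [e4, e5]
    ring
  have hc : ∀ c a, cd g c (fun y => cvec (ξ y)) x a = (covDeriv g ξ a c x : ℂ) :=
    fun c a => cd_cvec sξ a c
  have e1 : ∀ Y : Pt → Fin 4 → ℂ, nab g Y (fun y => cvec (ξ y)) x
      = fun a => ∑ c, Y x c * (covDeriv g ξ a c x : ℂ) := by
    intro Y; funext a; simp only [nab, hc]
  rw [e1, e1]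
  have e2 : cform (g x) (fun a => ∑ c, Y x c * (covDeriv g ξ a c x : ℂ)) (Z x)
      + cform (g x) (Y x) (fun a => ∑ c, Z x c * (covDeriv g ξ a c x : ℂ))
      = ∑ a, ∑ b, Y x a * Z x b * ((∑ c, (g x c b * covDeriv g ξ c a x
        + g x a c * covDeriv g ξ c b x) : ℝ) : ℂ) := by
    simp only [cform]
    simp only [Fin.sum_univ_four, Complex.ofReal_add, Complex.ofReal_mul]
    ring
  rw [e2]
  simp [hk]

/-- A stationary algebraically special vacuum metric has local null frames for which `ξ` is a
combination of `l` and `k`. -/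
theorem IsStationaryFor.exists_frame {U : Set Pt} {g : Pt → Ten2} {k ξ : Pt → Fin 4 → ℝ}
    (hU : IsOpen U) (hA : IsAlgSpecialVacuum U g k) (hS : IsStationaryFor U g k ξ) {x₀ : Pt}
    (hx₀ : x₀ ∈ U) {m₀ : Fin 4 → ℂ} {l₀ : Fin 4 → ℝ} (h₀ : IsNullTetrad (g x₀) m₀ l₀ (k x₀)) :
    ∃ N e c, x₀ ∈ N ∧ N ⊆ U ∧ IsNullFrame N g e c ∧ (∀ y ∈ N, e 3 y = cvec (k y)) ∧
      (∀ y ∈ N, c.T y = 0) ∧ ∃ h : Pt → ℝ, ContDiffOn ℝ ∞ h N ∧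
        ∀ y ∈ N, cvec (ξ y) = e 2 y + (h y : ℂ) • e 3 y ∧
          c.μ y + c.μb y + h y * (c.ρ y + c.ρb y) = 0 ∧
          dd (e 3) (fun z => (h z : ℂ)) y = c.q y := by
  have hg := hA.metric hU
  have comm := fun x (hx : x ∈ U) => hg.cform_comm hx
  have sk := hA.smooth_k
  have sξ := hS.smooth
  have dk := fun x (hx : x ∈ U) a => differentiableAt_of_smooth hU (contDiffOn_pi.1 sk a) hx
  have dξ := fun x (hx : x ∈ U) a => differentiableAt_of_smooth hU (contDiffOn_pi.1 sξ a) hx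
  let w : Pt → ℝ := fun y => rform (g y) (ξ y) (ξ y)
  -- ξ is shifted along k to a null vector: g(l, l) = w + w g(ξ, k) = 0 because g(k, ξ) = -1. Hence
  -- ξ = l + hk with h = -w/2.
  let l : Pt → Fin 4 → ℝ := fun y => ξ y + (w y / 2) • k y
  let K : Pt → Fin 4 → ℂ := fun y => cvec (k y)
  let X : Pt → Fin 4 → ℂ := fun y => cvec (ξ y)
  let f : Pt → ℂ := fun y => ((w y / 2 : ℝ) : ℂ)
  have sw : ContDiffOn ℝ ∞ w U := hg.smooth_rform sξ sξ
  have sf : ContDiffOn ℝ ∞ f U := smooth_ofReal (sw.div_const 2)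
  have sl : ContDiffOn ℝ ∞ l U := sξ.add ((sw.div_const 2).smul sk)
  have sK : ContDiffOn ℝ ∞ K U := smooth_cvec sk
  have sX : ContDiffOn ℝ ∞ X U := smooth_cvec sξ
  have hl : (fun y => cvec (l y)) = fun y => X y + f y • K y := by
    funext y; simp only [l, X, f, K, cvec_add, cvec_smul]
  have cKK : ∀ y ∈ U, cform (g y) (K y) (K y) = 0 := by
    intro y hy
    have := sum_lower g k k y (hg.symm y hy)
    rw [hA.null y hy] at this
    simpa using this.symm
  have cKX : ∀ y ∈ U, cform (g y) (K y) (X y) = -1 := by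
    intro y hy
    have := sum_lower g k ξ y (hg.symm y hy)
    rw [hS.normalized y hy] at this
    simpa using this.symm
  have cXX : ∀ y, cform (g y) (X y) (X y) = 2 * f y := by
    intro y
    rw [cform_rform]; simp only [f, w]; push_cast; ring
  have cLL : ∀ y ∈ U, cform (g y) (X y + f y • K y) (X y + f y • K y) = 0 := by
    intro y hy
    simp only [cform_add_left, cform_add_right, cform_smul_left, cform_smul_right, cKK y hy,
      cKX y hy, comm y hy (X y) (K y), cXX]
    ring
  have cLK : ∀ y ∈ U, cform (g y) (X y + f y • K y) (K y) = -1 := by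
    intro y hy
    simp only [cform_add_left, cform_smul_left, cKK y hy, cKX y hy, comm y hy (X y) (K y)]
    ring
  have nKK : ∀ y ∈ U, nab g K K y = 0 := by
    intro y hy
    funext a
    have := sum_covDeriv (g := g) (ξ := k) (dk y hy) a
    rw [hA.geodesic y hy a] at this
    exact this.trans (by simp)
  have nXK : ∀ y ∈ U, ∃ t : ℝ, nab g X K y = (t : ℂ) • K y := by
    intro y hy
    obtain ⟨t, ht⟩ := hS.type_one y hy
    refine ⟨t, funext fun a => ?_⟩
    have := sum_covDeriv (g := g) (ξ := ξ) (dk y hy) a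
    rw [ht] at this
    exact this.trans (by simp [K, cvec])
  -- From [ξ, k] = 0 and vanishing torsion.
  have nKX : ∀ y ∈ U, nab g K X y = nab g X K y := by
    intro y hy
    rw [eq_comm, ← sub_eq_zero, hg.nab_sub_nab hy]
    funext a
    have e1 := fun i => pd_ofReal (x := y) i (dk y hy a)
    have e2 := fun i => pd_ofReal (x := y) i (dξ y hy a)
    have := hS.commute y hy a
    rw [Finset.sum_sub_distrib] at this
    simp only [br, dd, K, X, cvec, e1, e2, Pi.zero_apply]
    exact_mod_cast this
  have killing := fun y (hy : y ∈ U) Y Z => hS.cform_nab hg hy Y Z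
  have rform0 : ∀ v w : Fin 4 → ℝ, ∀ G, cform G (cvec v) (cvec w) = 0 → rform G v w = 0 := by
    intro v w G h
    rw [cform_rform] at h
    exact_mod_cast h
  obtain ⟨N, hN, hxN, hNU, m, sm, hm⟩ := exists_local_tetrad hg sk sl
    (fun y hy => rform0 _ _ _ (cKK y hy))
    (fun y hy => rform0 _ _ _ (by rw [congrFun hl y]; exact cLL y hy))
    (fun y hy => by
      have := cLK y hy
      rw [← congrFun hl y, comm y hy, cform_rform] at this
      exact_mod_cast this) hx₀ h₀
  have hgN := hg.mono hN hNU
  let M : Pt → Fin 4 → ℂ := fun y => star (m y)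
  have sM : ContDiffOn ℝ ∞ M N := contDiffOn_pi.2 fun a => smooth_star (smooth_apply sm a)
  let L : Pt → Fin 4 → ℂ := fun y => X y + f y • K y
  have hlL : ∀ y, cvec (l y) = L y := congrFun hl
  let e : Fin 4 → Pt → Fin 4 → ℂ := ![m, M, L, K]
  have sK' := sK.mono hNU
  have sX' := sX.mono hNU
  have sf' := sf.mono hNU
  have sL : ContDiffOn ℝ ∞ L N := sX'.add (sf'.smul sK')
  have starK : ∀ y, star (K y) = K y := fun y => star_cvec _
  have starL : ∀ y, star (L y) = L y := fun y => by rw [← hlL, star_cvec]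
  have starM : ∀ y, star (M y) = m y := fun y => star_star _
  have cstar := fun y v w => cform_star (g y) v w
  have gram : ∀ y ∈ N, ∀ i j, cform (g y) (e i y) (e j y) = eta i j := by
    intro y hy
    obtain ⟨h1, h2, h3, h4⟩ := hm y hy
    have hyU := hNU hy
    rw [hlL] at h3
    have c := comm y hyU
    have bb : cform (g y) (M y) (M y) = 0 := by rw [cstar, h1, star_zero]
    have bl : cform (g y) (M y) (L y) = 0 := by
      rw [← starL]; exact (cstar y _ _).trans (by rw [h3, star_zero])
    have bk : cform (g y) (M y) (K y) = 0 := by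
      rw [← starK]; exact (cstar y _ _).trans (by rw [h4, star_zero])
    intro i j
    match i, j with
    | 0, 0 => exact h1
    | 0, 1 => exact h2
    | 0, 2 => exact h3
    | 0, 3 => exact h4
    | 1, 0 => exact (c _ _).trans h2
    | 1, 1 => exact bb
    | 1, 2 => exact bl
    | 1, 3 => exact bk
    | 2, 0 => exact (c _ _).trans h3
    | 2, 1 => exact (c _ _).trans bl
    | 2, 2 => exact cLL y hyU
    | 2, 3 => exact cLK y hyU
    | 3, 0 => exact (c _ _).trans h4
    | 3, 1 => exact (c _ _).trans bk
    | 3, 2 => exact (c _ _).trans (cLK y hyU)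
    | 3, 3 => exact cKK y hyU
  have se : ∀ i, ContDiffOn ℝ ∞ (e i) N := by
    intro i
    match i with
    | 0 => exact sm
    | 1 => exact sM
    | 2 => exact sL
    | 3 => exact sK'
  have anti : ∀ y ∈ N, ∀ (Y : Pt → Fin 4 → ℂ) i j, cform (g y) (nab g Y (e i) y) (e j y)
      = -cform (g y) (nab g Y (e j) y) (e i y) := by
    intro y hy Y i j
    have h1 := hgN.dd_cform (X := Y) (se i) (se j) hy
    rw [dd_congr hN (fun z hz => gram z hz i j) hy, dd_const,
      comm y (hNU hy) (e i y)] at h1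
    linear_combination -h1
  have self : ∀ y ∈ N, ∀ (Y : Pt → Fin 4 → ℂ) i, cform (g y) (nab g Y (e i) y) (e i y) = 0 := by
    intro y hy Y i
    have := anti y hy Y i i
    linear_combination (1 / 2) * this
  have nL : ∀ y ∈ N, ∀ Y, nab g Y L y = nab g Y X y + (dd Y f y • K y + f y • nab g Y K y) :=
    fun y hy Y => nab_add_smul_right g hN sX' sK' sf' hy
  have nLl : ∀ y Y, nab g L Y y = nab g X Y y + f y • nab g K Y y :=
    fun y Y => nab_add_smul_left g X Y K f y
  have nLK : ∀ y ∈ N, nab g L K y = nab g X K y := by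
    intro y hy
    rw [nLl, nKK y (hNU hy), smul_zero, add_zero]
  -- Differentiate g(ξ, ξ)/2 along k, using ∇_k ξ = ∇_ξ k = t k and g(k, ξ) = -1.
  have nDf : ∀ y ∈ N, ∃ t : ℝ, nab g X K y = (t : ℂ) • K y ∧ dd K f y = -t := by
    intro y hy
    obtain ⟨t, ht⟩ := nXK y (hNU hy)
    refine ⟨t, ht, ?_⟩
    have h1 := hgN.dd_cform (X := K) sX' sX' hy
    have h2 : dd K (fun y => cform (g y) (X y) (X y)) y = 2 * dd K f y := by
      rw [dd_congr hN (fun z _ => cXX z) hy, dd_mul (differentiableAt_const _)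
        (differentiableAt_of_smooth hN sf' hy), dd_const]
      ring
    rw [h2, nKX y (hNU hy), ht, cform_smul_left, cform_smul_right, comm y (hNU hy) (X y),
      cKX y (hNU hy)] at h1
    linear_combination (1 / 2) * h1
  -- The derivative of the shift f k cancels ∇_k ξ = t k, so l is parallel along k.
  have nKL : ∀ y ∈ N, nab g K L y = 0 := by
    intro y hy
    obtain ⟨t, ht, h3⟩ := nDf y hy
    rw [nL y hy, nKX y (hNU hy), nKK y (hNU hy), ht, h3, smul_zero, add_zero, ← add_smul]
    simp
  have shear : ∀ y ∈ N, cform (g y) (nab g m K y) (m y) = 0 := by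
    intro y hy
    have tet : IsNullTetrad (g y) (m y) (l y) (k y) :=
      ⟨gram y hy 0 0, gram y hy 0 1, by rw [hlL]; exact gram y hy 0 2, gram y hy 0 3,
        by rw [hlL]; exact gram y hy 2 2, gram y hy 3 3, by rw [hlL]; exact gram y hy 3 2⟩
    have := hA.shearfree y (hNU hy) _ _ tet
    rwa [cform_covDerivLow (dk y (hNU hy)), comm y (hNU hy)] at this
  -- This is T = 0. The Killing equation on (m, k) gives ⟨∇_m ξ, k⟩ = 0, since ∇_k ξ is a multiple
  -- of k; differentiating g(k, ξ) = -1 along m moves the derivative onto k.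
  have mKL : ∀ y ∈ N, cform (g y) (nab g m K y) (L y) = 0 := by
    intro y hy
    obtain ⟨t, ht⟩ := nXK y (hNU hy)
    have h1 := killing y (hNU hy) m K
    have h2 := hgN.dd_cform (X := m) sK' sX' hy
    rw [dd_congr hN (fun z hz => cKX z (hNU hz)) hy, dd_const] at h2
    have h3 : cform (g y) (m y) (K y) = 0 := gram y hy 0 3
    have h4 : cform (g y) (nab g m K y) (K y) = 0 := self y hy m 3
    rw [nKX y (hNU hy), ht, cform_smul_right, h3, comm y (hNU hy)] at h1
    rw [show L y = X y + f y • K y from rfl, cform_add_right, cform_smul_right, h4]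
    linear_combination -h2 - h1
  -- The Killing equation on (m, m), together with the vanishing shear of k, makes l shearfree as
  -- well, as the table of coefficients requires.
  have mLm : ∀ y ∈ N, cform (g y) (nab g m L y) (m y) = 0 := by
    intro y hy
    have h1 := killing y (hNU hy) m m
    have h3 : cform (g y) (K y) (m y) = 0 := gram y hy 3 0
    rw [comm y (hNU hy) (m y)] at h1
    rw [nL y hy, cform_add_left, cform_add_left, cform_smul_left, cform_smul_left, h3,
      shear y hy]
    linear_combination (1 / 2) * h1
  have conj : ∀ A B C A' B' C' : Pt → Fin 4 → ℂ, (∀ y, star (A y) = A' y) →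
      (∀ y, star (B y) = B' y) → (∀ y, star (C y) = C' y) → ∀ y,
      cform (g y) (nab g A' B' y) (C' y) = star (cform (g y) (nab g A B y) (C y)) := by
    intro A B C A' B' C' hA hB hC y
    rw [← cstar, ← nab_star, hC]
    simp only [hA, hB]
  have starm : ∀ y, star (m y) = M y := fun _ => rfl
  have expand := fun y (hy : y ∈ N) v => frame_expansion (gram y hy) v
  have sc : ∀ i j n, ContDiffOn ℝ ∞ (fun y => cform (g y) (nab g (e i) (e j) y) (e n y)) N :=
    fun i j n => hgN.smooth_cform (hgN.smooth_nab (se i) (se j)) (se n)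
  let c : Coefs :=
    { ρ := fun y => cform (g y) (nab g M K y) (m y)
      ρb := fun y => cform (g y) (nab g m K y) (M y)
      F := fun y => -cform (g y) (nab g K m y) (M y)
      T := fun _ => 0
      Tb := fun _ => 0
      μ := fun y => cform (g y) (nab g m L y) (M y)
      μb := fun y => cform (g y) (nab g M L y) (m y)
      ν := fun y => cform (g y) (nab g L m y) (M y)
      j := fun y => -cform (g y) (nab g L m y) (L y)
      jb := fun y => -cform (g y) (nab g L M y) (L y)
      a := fun y => cform (g y) (nab g m M y) (m y)
      ab := fun y => cform (g y) (nab g M m y) (M y)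
      q := fun y => -cform (g y) (nab g L K y) (L y) }
  have nmK : ∀ y ∈ N, nab g m K y = c.ρb y • m y := by
    intro y hy
    have h4 : cform (g y) (nab g m K y) (K y) = 0 := self y hy m 3
    refine (expand y hy _).trans ?_
    change _ • m y + cform (g y) _ (m y) • M y - cform (g y) _ (K y) • L y
      - cform (g y) _ (L y) • K y = _
    rw [shear y hy, mKL y hy, h4]
    simp only [zero_smul, add_zero, sub_zero]; rfl
  have nLK' : ∀ y ∈ N, nab g L K y = c.q y • K y := by
    intro y hy
    obtain ⟨t, ht⟩ := nXK y (hNU hy)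
    have h3 : cform (g y) (K y) (L y) = -1 := gram y hy 3 2
    simp only [c, nLK y hy, ht, cform_smul_left, h3]
    simp
  have nmL : ∀ y ∈ N, nab g m L y = c.μ y • m y := by
    intro y hy
    have h4 : cform (g y) (nab g m L y) (L y) = 0 := self y hy m 2
    have h5 : cform (g y) (nab g m L y) (K y) = 0 := by
      rw [show cform (g y) (nab g m L y) (K y) = -cform (g y) (nab g m K y) (L y) from
        anti y hy m 2 3, mKL y hy, neg_zero]
    refine (expand y hy _).trans ?_
    change _ • m y + cform (g y) _ (m y) • M y - cform (g y) _ (K y) • L y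
      - cform (g y) _ (L y) • K y = _
    rw [mLm y hy, h4, h5]
    simp only [zero_smul, add_zero, sub_zero]; rfl
  have nKm : ∀ y ∈ N, nab g K m y = -c.F y • m y := by
    intro y hy
    have h1 : cform (g y) (nab g K m y) (m y) = 0 := self y hy K 0
    have h2 : cform (g y) (nab g K m y) (K y) = 0 := by
      rw [show cform (g y) (nab g K m y) (K y) = -cform (g y) (nab g K K y) (m y) from
        anti y hy K 0 3, nKK y (hNU hy), cform_zero_left, neg_zero]
    have h3 : cform (g y) (nab g K m y) (L y) = 0 := by
      rw [show cform (g y) (nab g K m y) (L y) = -cform (g y) (nab g K L y) (m y) from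
        anti y hy K 0 2, nKL y hy, cform_zero_left, neg_zero]
    refine (expand y hy _).trans ?_
    change _ • m y + cform (g y) _ (m y) • M y - cform (g y) _ (K y) • L y
      - cform (g y) _ (L y) • K y = _
    rw [h1, h2, h3]
    simp only [zero_smul, add_zero, sub_zero, c, neg_neg]; rfl
  have nLm : ∀ y ∈ N, nab g L m y = c.ν y • m y + c.j y • K y := by
    intro y hy
    have h1 : cform (g y) (nab g L m y) (m y) = 0 := self y hy L 0
    have h2 : cform (g y) (nab g L m y) (K y) = 0 := by
      have h3 : cform (g y) (K y) (m y) = 0 := gram y hy 3 0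
      rw [show cform (g y) (nab g L m y) (K y) = -cform (g y) (nab g L K y) (m y) from
        anti y hy L 0 3, nLK' y hy, cform_smul_left, h3, mul_zero, neg_zero]
    refine (expand y hy _).trans ?_
    change _ • m y + cform (g y) _ (m y) • M y - cform (g y) _ (K y) • L y
      - cform (g y) _ (L y) • K y = _
    rw [h1, h2]
    simp only [zero_smul, add_zero, c, neg_smul, sub_eq_add_neg, neg_zero]; rfl
  have nmM : ∀ y ∈ N, nab g m M y = c.a y • M y + c.ρb y • L y + c.μ y • K y := by
    intro y hy
    have h1 : cform (g y) (nab g m M y) (M y) = 0 := self y hy m 1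
    refine (expand y hy _).trans ?_
    change cform (g y) _ (M y) • m y + cform (g y) _ (m y) • M y - cform (g y) _ (K y) • L y
      - cform (g y) _ (L y) • K y = _
    rw [h1, show cform (g y) (nab g m M y) (K y) = -c.ρb y from anti y hy m 1 3,
      show cform (g y) (nab g m M y) (L y) = -c.μ y from anti y hy m 1 2]
    simp only [zero_smul, zero_add, c, neg_smul, sub_neg_eq_add]
  have conj_ρ : ∀ y, c.ρb y = star (c.ρ y) := conj M K m m K M starM starK starm
  have conj_μ : ∀ y, c.μb y = star (c.μ y) := conj m L M M L m starm starL starM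
  have conj_a : ∀ y, c.ab y = star (c.a y) := conj m M m M m M starm starM starm
  have nMm : ∀ y ∈ N, nab g M m y = c.ab y • m y + c.ρ y • L y + c.μb y • K y := by
    intro y hy
    have h1 : nab g M m y = star (nab g m M y) := by
      rw [← nab_star]; simp only [starm, starM]
    rw [h1, nmM y hy, conj_a, conj_μ, star_add, star_add, star_smul, star_smul, star_smul, starL,
      starK, starM, conj_ρ, star_star]
  have imag_F : ∀ y ∈ N, star (c.F y) = -c.F y := by
    intro y hy
    simp only [c, star_neg]
    rw [← conj K m M K M m starK starm starM,
      show cform (g y) (nab g K M y) (m y) = -cform (g y) (nab g K m y) (M y) from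
        anti y hy K 1 0]
  have imag_ν : ∀ y ∈ N, star (c.ν y) = -c.ν y := by
    intro y hy
    simp only [c]
    rw [← conj L m M L M m starL starm starM,
      show cform (g y) (nab g L M y) (m y) = -cform (g y) (nab g L m y) (M y) from
        anti y hy L 1 0]
  have real_q : ∀ y, star (c.q y) = c.q y := by
    intro y
    simp only [c, star_neg]
    rw [← conj L K L L K L starL starK starL]
  have bsub := fun y (hy : y ∈ N) i j => (hgN.nab_sub_nab (X := e i) (Y := e j) hy).symm
  refine ⟨N, e, c, hxN, hNU, IsNullFrame.of_brackets hN hgN.smooth hgN.symm sm sL sK'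
    (fun _ _ => rfl) (fun y _ => starL y) (fun y _ => starK y) (fun y hy => gram y hy 0 0)
    (fun y hy => gram y hy 0 1) (fun y hy => gram y hy 0 2) (fun y hy => gram y hy 0 3)
    (fun y hy => gram y hy 2 2) (fun y hy => gram y hy 2 3) (fun y hy => gram y hy 3 3)
    (fun y hy => ?_) (fun y hy => ?_) (fun y hy => ?_) (fun y hy => ?_)
    (fun y _ => conj_ρ y) (fun y _ => (star_zero ℂ).symm) (fun y _ => conj_μ y)
    (fun y _ => ?_) (fun y _ => conj_a y) imag_F imag_ν (fun y _ => real_q y)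
    (sc 1 3 0) (sc 3 0 1).neg contDiffOn_const (sc 0 2 1) (sc 2 0 1) (sc 2 0 2).neg (sc 0 1 0)
    (sc 2 3 2).neg, fun y _ => rfl, fun y _ => rfl, fun y => -(w y / 2),
    ((sw.mono hNU).div_const 2).neg, fun y hy => ⟨?_, ?_, ?_⟩⟩
  · refine (bsub y hy 0 1).trans ?_
    change nab g m M y - nab g M m y = -c.ab y • m y + c.a y • M y + (c.ρb y - c.ρ y) • L y
      + (c.μ y - c.μb y) • K y
    rw [nmM y hy, nMm y hy]
    module
  · refine (bsub y hy 2 0).trans ?_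
    change nab g L m y - nab g m L y = (c.ν y - c.μ y) • m y - (0 : ℂ) • L y + c.j y • K y
    rw [nLm y hy, nmL y hy]
    module
  · refine (bsub y hy 3 0).trans ?_
    change nab g K m y - nab g m K y = -(c.ρb y + c.F y) • m y + (0 : ℂ) • K y
    rw [nKm y hy, nmK y hy]
    module
  · refine (bsub y hy 3 2).trans ?_
    change nab g K L y - nab g L K y = -c.q y • K y
    rw [nKL y hy, nLK' y hy]
    module
  · simp only [c, star_neg]
    rw [← conj L m L L M L starL starm starL]
  · change X y = X y + f y • K y + ((-(w y / 2) : ℝ) : ℂ) • K y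
    simp only [f]
    push_cast
    module
  -- The Killing equation on (m, m̄): ξ has no expansion, so that of l is -h times that of k.
  · have h1 := killing y (hNU hy) m M
    have h3 : cform (g y) (K y) (m y) = 0 := gram y hy 3 0
    have h4 : cform (g y) (K y) (M y) = 0 := gram y hy 3 1
    rw [comm y (hNU hy) (m y)] at h1
    change cform (g y) (nab g m L y) (M y) + cform (g y) (nab g M L y) (m y)
      + ((-(w y / 2) : ℝ) : ℂ) * (cform (g y) (nab g M K y) (m y)
      + cform (g y) (nab g m K y) (M y)) = 0
    rw [nL y hy, nL y hy]
    simp only [cform_add_left, cform_smul_left, h3, h4, f]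
    push_cast
    linear_combination h1
  · obtain ⟨t, ht, h1⟩ := nDf y hy
    have h3 : cform (g y) (K y) (L y) = -1 := gram y hy 3 2
    have h2 : (fun z => ((-(w z / 2) : ℝ) : ℂ)) = fun z => -f z := by
      funext z; simp only [f]; push_cast; rfl
    change dd K _ y = -cform (g y) (nab g L K y) (L y)
    rw [h2, dd_neg, h1, nLK y hy, ht, cform_smul_left, h3]
    ring

/-! ### Splitting of stationary metrics -/

/-- Exchanging m and m̄ conjugates the divergence, which is why Σ is determined only up to sign. -/
theorem IsNullTetrad.conj {G : Ten2} {m : Fin 4 → ℂ} {l k : Fin 4 → ℝ} (h : IsNullTetrad G m l k) :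
    IsNullTetrad G (star m) l k where
  m_m := by rw [cform_star, h.m_m, star_zero]
  m_conj := by rw [cform_star, h.m_conj, star_one]
  m_l := by rw [← star_cvec l, cform_star, h.m_l, star_zero]
  m_k := by rw [← star_cvec k, cform_star, h.m_k, star_zero]
  l_l := h.l_l
  k_k := h.k_k
  k_l := h.k_l

theorem IsNullFrame.differentiableAt_k {N : Set Pt} {g : Pt → Ten2} {e : Fin 4 → Pt → Fin 4 → ℂ}
    {c : Coefs} {k : Pt → Fin 4 → ℝ} {x : Pt} (H : IsNullFrame N g e c) (hx : x ∈ N)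
    (hk : ∀ y ∈ N, e 3 y = cvec (k y)) (a : Fin 4) :
    DifferentiableAt ℝ (fun y => k y a) x := by
  refine differentiableAt_of_smooth H.metric.isOpen
    ((smooth_re (smooth_apply (H.smooth 3) a)).congr fun y hy => ?_) hx
  rw [hk y hy]; simp [cvec]

/-- Every tetrad yields the same complex divergence, up to conjugation. -/
theorem IsNullFrame.divergence_cases {N : Set Pt} {g : Pt → Ten2} {e : Fin 4 → Pt → Fin 4 → ℂ}
    {c : Coefs} {k : Pt → Fin 4 → ℝ} {x : Pt} (H : IsNullFrame N g e c) (hx : x ∈ N)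
    (hk : ∀ y ∈ N, e 3 y = cvec (k y)) {m : Fin 4 → ℂ} {l : Fin 4 → ℝ}
    (h : IsNullTetrad (g x) m l (k x)) :
    cform (covDerivLow g k x) m (star m) = c.ρ x ∨
      cform (covDerivLow g k x) m (star m) = c.ρb x := by
  have ex := frame_expansion (H.gram x hx) m
  rw [hk x hx, h.m_k] at ex
  have h2 := h.m_m
  have h3 := h.m_conj
  set α := cform (g x) m (e 1 x)
  set β := cform (g x) m (e 0 x)
  set δ := cform (g x) m (e 2 x)
  have ex' : m = ∑ i, ![α, β, 0, -δ] i • e i x := by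
    rw [Fin.sum_univ_four]
    conv_lhs => rw [ex]
    simp [hk x hx, sub_eq_add_neg]
  have e10 : star (e 1 x) = e 0 x := by rw [H.conj_m x hx, star_star]
  have ex2 : star m = ∑ i, ![star β, star α, 0, -star δ] i • e i x := by
    rw [ex', Fin.sum_univ_four, Fin.sum_univ_four]
    simp [e10, ← H.conj_m x hx, H.real_k x hx]
    abel
  have key := cform_covDerivLow (g := g) (H.differentiableAt_k hx hk) m (fun _ => star m)
  rw [key, ← nab_congr H.metric.isOpen hk hx, nab_left g (fun _ => star m) (e 3) x _ e ex2,
    Fin.sum_univ_four, H.nab_m_k hx, H.nab_mb_k hx, H.nab_k_k hx]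
  rw [ex2] at h3
  rw [ex', Fin.sum_univ_four] at h2 h3 ⊢
  rw [Fin.sum_univ_four] at h3
  simp only [cform_add_left, cform_add_right, cform_sub_right, cform_smul_left, cform_smul_right,
    cform_zero_right, H.gram x hx] at h2 h3 ⊢
  simp [eta] at h2 h3 ⊢
  have h4 : α * β = 0 := by linear_combination (1 / 2) * h2
  -- A null m is, up to a multiple of k, a multiple of the frame's m or of its m̄. The normalization
  -- makes the factor a phase, which drops out of the divergence.
  rcases mul_eq_zero.1 h4 with h0 | h0
  · right
    rw [h0] at h3 ⊢
    simp at h3 ⊢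
    linear_combination c.ρb x * h3
  · left
    rw [h0] at h3 ⊢
    simp at h3 ⊢
    linear_combination c.ρ x * h3

/-- By the Sachs equation this says that l + hk annihilates ρ. The twist relation gives Δ(ρ̄ - ρ);
the expansion relation, combined with the k-derivative of μ + μ̄ = -h(ρ + ρ̄), gives Δ(ρ + ρ̄). -/
theorem IsNullFrame.l_ρ {N : Set Pt} {g : Pt → Ten2} {e : Fin 4 → Pt → Fin 4 → ℂ} {c : Coefs}
    (H : IsNullFrame N g e c) (hT : ∀ y ∈ N, c.T y = 0)
    (sachs : ∀ y ∈ N, dd (e 3) c.ρ y = -c.ρ y ^ 2 ∧ dd (e 3) c.ρb y = -c.ρb y ^ 2) {h : Pt → ℂ}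
    (sh : ContDiffOn ℝ ∞ h N) (hμ : ∀ y ∈ N, c.μ y + c.μb y + h y * (c.ρ y + c.ρb y) = 0)
    (hq : ∀ y ∈ N, dd (e 3) h y = c.q y) {x : Pt} (hx : x ∈ N) :
    dd (e 2) c.ρ x = h x * c.ρ x ^ 2 ∧ dd (e 2) c.ρb x = h x * c.ρb x ^ 2 := by
  have hN := H.metric.isOpen
  have d := fun {f : Pt → ℂ} (hf : ContDiffOn ℝ ∞ f N) => differentiableAt_of_smooth hN hf hx
  have h1 := H.dd_l_twist hx hT
  have h2 := H.dd_l_expansion hx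
  have h3 : dd (e 3) (fun y => c.μ y + c.μb y + h y * (c.ρ y + c.ρb y)) x = 0 := by
    rw [dd_congr hN hμ hx, dd_const]
  rw [dd_add ((d H.smooth_μ).fun_add (d H.smooth_μb))
    ((d sh).fun_mul ((d H.smooth_ρ).fun_add (d H.smooth_ρb))), dd_add (d H.smooth_μ)
    (d H.smooth_μb), dd_mul (d sh) ((d H.smooth_ρ).fun_add (d H.smooth_ρb)),
    dd_add (d H.smooth_ρ) (d H.smooth_ρb), (sachs x hx).1, (sachs x hx).2, hq x hx] at h3
  have h4 := hμ x hx
  constructor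
  · linear_combination (1 / 2) * h2 - (1 / 2) * h1 + (1 / 2) * h3
      + (1 / 2) * (c.ρb x - c.ρ x) * h4
  · linear_combination (1 / 2) * h2 + (1 / 2) * h1 + (1 / 2) * h3
      - (1 / 2) * (c.ρb x - c.ρ x) * h4

/-- The correction term annihilates k because k is null. -/
theorem lower_splitMetric {g : Pt → Ten2} {k : Pt → Fin 4 → ℝ} {r s : Pt → ℝ} {m₀ : ℝ} {x : Pt}
    (h : ∑ a, lower g k x a * k x a = 0) (a : Fin 4) :
    lower (splitMetric g k r s m₀) k x a = lower g k x a := by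
  have : ∀ c, splitMetric g k r s m₀ x a c * k x c = g x a c * k x c
      + 2 * m₀ * r x / (r x ^ 2 + s x ^ 2) * lower g k x a * (lower g k x c * k x c) := by
    intro c; simp only [splitMetric, Matrix.of_apply]; ring
  rw [lower, Finset.sum_congr rfl fun c _ => this c, Finset.sum_add_distrib, ← Finset.mul_sum, h]
  simp [lower]

/-- The Lie derivative of the 1-form `k` along a Killing field commuting with `k` vanishes. -/
theorem IsStationaryFor.lie_lower {U : Set Pt} {g : Pt → Ten2} {k ξ : Pt → Fin 4 → ℝ}
    (hg : IsSmoothMetric U g) (sk : ContDiffOn ℝ ∞ k U) (h : IsStationaryFor U g k ξ) {x : Pt}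
    (hx : x ∈ U) (a : Fin 4) :
    ∑ c, (ξ x c * pd c (fun y => lower g k y a) x + lower g k x c * pd a (fun y => ξ y c) x)
      = 0 := by
  have hU := hg.isOpen
  have dg := fun a b => differentiableAt_of_smooth hU (hg.smooth a b) hx
  have dk := fun a => differentiableAt_of_smooth hU (contDiffOn_pi.1 sk a) hx
  have e1 : ∀ c, pd c (fun y => lower g k y a) x
      = ∑ d, (pd c (fun y => g y a d) x * k x d + g x a d * pd c (fun y => k y d) x) := by
    intro c
    simp only [lower]
    rw [pd_sum _ _ fun d _ => (dg a d).fun_mul (dk d)]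
    exact Finset.sum_congr rfl fun d _ => pd_mul c (dg a d) (dk d)
  -- The Lie derivative of g(k, ·) is (L_ξ g)(k, ·) + g(L_ξ k, ·), and both terms vanish.
  have e2 : ∑ d, k x d * ∑ c, (ξ x c * pd c (fun y => g y a d) x + g x c d * pd a (fun y => ξ y c) x
      + g x a c * pd d (fun y => ξ y c) x) + ∑ d, g x a d *
      ∑ c, (ξ x c * pd c (fun y => k y d) x - k x c * pd c (fun y => ξ y d) x) = 0 := by
    simp [h.killing x hx, h.commute x hx]
  rw [← e2]
  simp only [e1]
  simp only [lower, Fin.sum_univ_four]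
  ring

/-- (r + iΣ)ρ = 1 means Re ρ = r/(r² + Σ²). In this form the added term does not depend on the sign
of Σ. -/
theorem splitMetric_eq {g : Pt → Ten2} {k : Pt → Fin 4 → ℝ} {r s : Pt → ℝ} {m₀ : ℝ} {x : Pt}
    {ρ : ℂ} (h : ((r x : ℂ) + Complex.I * s x) * ρ = 1) (a b : Fin 4) :
    splitMetric g k r s m₀ x a b
      = g x a b + 2 * (m₀ * ρ.re) * (lower g k x a * lower g k x b) := by
  have h1 := congrArg Complex.re h
  have h2 := congrArg Complex.im h
  simp at h1 h2
  have h0 : r x ^ 2 + s x ^ 2 ≠ 0 := by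
    intro h0
    have hr : r x = 0 := by nlinarith [sq_nonneg (r x), sq_nonneg (s x)]
    have hs : s x = 0 := by nlinarith [sq_nonneg (r x), sq_nonneg (s x)]
    rw [hr, hs] at h1
    simp at h1
  have h3 : ρ.re = r x / (r x ^ 2 + s x ^ 2) := by
    rw [eq_div_iff h0]
    linear_combination r x * h1 + s x * h2
  rw [splitMetric, Matrix.of_apply, h3]
  ring

/-- The Kerr-Schild transformation with `V = m₀ Re ρ` of a vacuum null frame. -/
theorem IsNullFrame.split {N : Set Pt} {g g' : Pt → Ten2} {e : Fin 4 → Pt → Fin 4 → ℂ} {c : Coefs}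
    {k : Pt → Fin 4 → ℝ} (H : IsNullFrame N g e c) (hk : ∀ y ∈ N, e 3 y = cvec (k y))
    {m₀ : ℝ} (hg' : ∀ y ∈ N, ∀ a b,
      g' y a b = g y a b + 2 * (m₀ * (c.ρ y).re) * (lower g k y a * lower g k y b)) :
    IsNullFrame N g' (ksFrame e fun y => ((m₀ * (c.ρ y).re : ℝ) : ℂ))
      (c.ks e fun y => ((m₀ * (c.ρ y).re : ℝ) : ℂ)) ∧
    ∀ y ∈ N, ((m₀ * (c.ρ y).re : ℝ) : ℂ) = (m₀ / 2 : ℂ) * (c.ρ y + c.ρb y) := by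
  refine ⟨H.kerrSchild hk (contDiffOn_const.mul (smooth_re H.smooth_ρ)) hg', fun y hy => ?_⟩
  have h : c.ρ y + star (c.ρ y) = ((2 * (c.ρ y).re : ℝ) : ℂ) := Complex.add_conj (c.ρ y)
  rw [H.conj_ρ y hy, h]
  push_cast
  ring

/-- The vacuum property is preserved if `ρ` is constant along `l + h k`. -/
theorem IsNullFrame.split_vacuum {N : Set Pt} {g g' : Pt → Ten2} {e : Fin 4 → Pt → Fin 4 → ℂ}
    {c : Coefs} {k : Pt → Fin 4 → ℝ} (H : IsNullFrame N g e c)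
    (hk : ∀ y ∈ N, e 3 y = cvec (k y)) {m₀ : ℝ} (hg' : ∀ y ∈ N, ∀ a b,
      g' y a b = g y a b + 2 * (m₀ * (c.ρ y).re) * (lower g k y a * lower g k y b))
    (hv : ∀ y ∈ N, ∀ a b, ricci g a b y = 0) (hT : ∀ y ∈ N, c.T y = 0) {h : Pt → ℂ}
    (hl : ∀ y ∈ N, dd (e 2) c.ρ y = h y * c.ρ y ^ 2 ∧ dd (e 2) c.ρb y = h y * c.ρb y ^ 2)
    (hμ : ∀ y ∈ N, c.μ y + c.μb y + h y * (c.ρ y + c.ρb y) = 0) {x : Pt} (hx : x ∈ N)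
    (a b : Fin 4) : ricci g' a b x = 0 := by
  have hN := H.metric.isOpen
  obtain ⟨H', hV⟩ := H.split hk hg'
  have R := fun y hy => H.ricci_zero hy (hv y hy)
  have sachs := fun y hy => H.sachs hy (R y hy 3 3)
  have dT : ∀ i, ∀ y ∈ N, dd (e i) c.T y = 0 := fun i y hy => by
    rw [dd_congr hN hT hy, dd_const]
  have hm : ∀ y ∈ N, dd (e 0) c.ρ y = 0 := by
    intro y hy
    have := R y hy 3 0
    rw [ricci_km, hT y hy, dT 3 y hy] at this
    linear_combination -this
  have ha : dd (e 3) c.a x = dd (e 0) c.F x - (c.ρb x + c.F x) * c.a x + c.F x * c.T x := by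
    have := R x hx 0 3
    rw [ricci_mk] at this
    linear_combination this
  refine H'.vacuum hx ?_ ?_ ?_ ?_ ?_ ?_ a b
  · have := R x hx 3 3
    rw [ricci_kk] at this ⊢
    exact this
  · have := R x hx 3 0
    rw [ricci_km] at this ⊢
    exact this
  · rw [H.ks_ricci_kl hV sachs hx, R x hx]
  · rw [H.ks_ricci_mmb hV sachs hx, R x hx]
  · rw [H.ks_ricci_ml hV sachs hx (by rw [dT 3 x hx, hT x hx, mul_zero])
      (by rw [hm x hx, hT x hx]; ring) ha, R x hx, hT x hx]
    ring
  -- With Δρ = hρ² and its conjugate the defect is ρ² + ρ̄² times h(ρ + ρ̄) + μ + μ̄, which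
  -- vanishes.
  · rw [H.ks_ricci_ll hV sachs hx hT hm, R x hx, (hl x hx).1, (hl x hx).2]
    linear_combination -3 * (m₀ / 2 : ℂ) * (c.ρ x ^ 2 + c.ρb x ^ 2) * hμ x hx

/-- Stationary diverging algebraically special vacuum metrics split. -/
theorem IsStationaryFor.split {U : Set Pt} {g : Pt → Ten2} {k ξ : Pt → Fin 4 → ℝ}
    {r s : Pt → ℝ} (hU : IsOpen U) (hA : IsAlgSpecialVacuum U g k) (hD : IsDiverging U g k r s)
    (hS : IsStationaryFor U g k ξ) (m₀ : ℝ) :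
    IsAlgSpecialVacuum U (splitMetric g k r s m₀) k ∧
      IsDiverging U (splitMetric g k r s m₀) k r s ∧
      IsStationaryFor U (splitMetric g k r s m₀) k ξ := by
  have hg := hA.metric hU
  set g' := splitMetric g k r s m₀ with hg'
  have frames : ∀ x ∈ U, ∃ N e c, x ∈ N ∧ N ⊆ U ∧ IsNullFrame N g e c ∧
      (∀ y ∈ N, e 3 y = cvec (k y)) ∧ (∀ y ∈ N, c.T y = 0) ∧ (∃ h : Pt → ℝ, ContDiffOn ℝ ∞ h N ∧
        ∀ y ∈ N, cvec (ξ y) = e 2 y + (h y : ℂ) • e 3 y ∧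
          c.μ y + c.μb y + h y * (c.ρ y + c.ρb y) = 0 ∧
          dd (e 2) c.ρ y = h y * c.ρ y ^ 2 ∧ dd (e 2) c.ρb y = h y * c.ρb y ^ 2 ∧
          dd (e 3) c.ρ y = -c.ρ y ^ 2) ∧
      (∀ y ∈ N, ((r y : ℂ) + Complex.I * s y) * c.ρ y = 1 ∨
        ((r y : ℂ) + Complex.I * s y) * c.ρb y = 1) ∧
      (∀ y ∈ N, ∀ a b,
        g' y a b = g y a b + 2 * (m₀ * (c.ρ y).re) * (lower g k y a * lower g k y b)) := by
    intro x hx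
    obtain ⟨m₁, l₁, tet, -⟩ := hD x hx
    obtain ⟨N, e, c, hxN, hNU, H, hk, hT, h, sh, hh⟩ := hS.exists_frame hU hA hx tet
    have R := fun y hy => H.ricci_zero hy (hA.vacuum y (hNU hy))
    have sachs := fun y hy => H.sachs hy (R y hy 3 3)
    have lρ := fun y hy => H.l_ρ hT sachs (smooth_ofReal sh) (fun y hy => (hh y hy).2.1)
      (fun y hy => (hh y hy).2.2) (x := y) hy
    -- The tetrads realizing r + iΣ are given point by point, so the orientation may differ from
    -- that of the local frame.
    have hr : ∀ y ∈ N, ((r y : ℂ) + Complex.I * s y) * c.ρ y = 1 ∨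
        ((r y : ℂ) + Complex.I * s y) * c.ρb y = 1 := by
      intro y hy
      obtain ⟨m, l, tet, h1⟩ := hD y (hNU hy)
      rcases H.divergence_cases hy hk tet with h2 | h2
      · left; rwa [h2] at h1
      · right; rwa [h2] at h1
    refine ⟨N, e, c, hxN, hNU, H, hk, hT, ⟨h, sh, fun y hy => ⟨(hh y hy).1, (hh y hy).2.1,
      (lρ y hy).1, (lρ y hy).2, (sachs y hy).1⟩⟩, hr, fun y hy a b => ?_⟩
    rcases hr y hy with h2 | h2
    · exact splitMetric_eq h2 a b
    · have := splitMetric_eq (g := g) (k := k) (m₀ := m₀) h2 a b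
      rwa [H.conj_ρ y hy, show (star (c.ρ y)).re = (c.ρ y).re from Complex.conj_re _] at this
  refine ⟨IsAlgSpecialVacuum.of_frames hA.smooth_k fun x hx => ?_, fun x hx => ?_, hS.smooth,
    fun x hx a b => ?_, hS.commute, fun x hx => ?_, fun x hx => ?_⟩
  · obtain ⟨N, e, c, hxN, hNU, H, hk, hT, ⟨h, sh, hh⟩, -, hg⟩ := frames x hx
    refine ⟨N, _, _, hxN, (H.split hk hg).1, hk, hT, fun y hy => ?_⟩
    exact H.split_vacuum hk hg (fun y hy => hA.vacuum y (hNU hy)) hT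
      (fun y hy => ⟨(hh y hy).2.2.1, (hh y hy).2.2.2.1⟩) (fun y hy => (hh y hy).2.1) hy
  · obtain ⟨N, e, c, hxN, hNU, H, hk, hT, -, hr, hg⟩ := frames x hx
    have H' := (H.split hk hg).1
    rcases hr x hxN with h | h
    · exact H'.divergence_eq hxN hk h
    · obtain ⟨l, hl⟩ := H'.exists_real_l x hxN
      have h1 := H'.divergence (x := x) hk (fun a => H'.differentiableAt_k hxN hk a) hxN
      -- For the opposite orientation the tetrad with m̄ in place of m is used.
      refine ⟨star (e 0 x), l, (H'.isNullTetrad hxN (hk x hxN) hl).conj, ?_⟩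
      rw [cform_star]
      change cform (covDerivLow g' k x) (e 0 x) (star (e 0 x)) = c.ρ x at h1
      rw [h1, ← H.conj_ρ x hxN, h]
  · obtain ⟨N, e, c, hxN, hNU, H, hk, hT, ⟨h, sh, hh⟩, -, hg''⟩ := frames x hx
    have hN := H.metric.isOpen
    obtain ⟨hξ, -, h1, -, h2⟩ := hh x hxN
    have dρ := differentiableAt_of_smooth hN H.smooth_ρ hxN
    have d1 : DifferentiableAt ℝ (fun y => (c.ρ y).re) x :=
      differentiableAt_of_smooth hN (smooth_re H.smooth_ρ) hxN
    -- ξ = l + hk annihilates ρ: hρ² from l and -hρ² from hk. Together with the invariance of the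
    -- 1-form k, this makes the added term invariant under ξ.
    have hρ : ∑ a, ξ x a * pd a (fun y => (c.ρ y).re) x = 0 := by
      have h3 : dd (fun y => cvec (ξ y)) c.ρ x = 0 := by
        have : dd (fun y => cvec (ξ y)) c.ρ x = dd (e 2) c.ρ x + h x * dd (e 3) c.ρ x := by
          rw [← dd_ksFrame e (fun y => (h y : ℂ)) c.ρ x]
          simp only [dd, hξ]
        rw [this, h1, h2]; ring
      have h4 := congrArg Complex.re h3
      simpa [dd, cvec, pd_re _ dρ] using h4
    have lie := hS.lie_lower hg hA.smooth_k hx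
    have dl : ∀ a, DifferentiableAt ℝ (fun y => lower g k y a) x := by
      intro a
      refine differentiableAt_of_smooth hU (ContDiffOn.sum fun b _ =>
        (hg.smooth a b).mul (contDiffOn_pi.1 hA.smooth_k b)) hx
    have dg := differentiableAt_of_smooth hU (hg.smooth a b) hx
    have e1 : ∀ i, pd i (fun y => g' y a b) x = pd i (fun y => g y a b) x
        + 2 * m₀ * (pd i (fun y => (c.ρ y).re) x * (lower g k x a * lower g k x b)
        + (c.ρ x).re * (pd i (fun y => lower g k y a) x * lower g k x b
          + lower g k x a * pd i (fun y => lower g k y b) x)) := by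
      intro i
      have d2 := (dl a).fun_mul (dl b)
      rw [pd_congr hN (fun y hy => hg'' y hy a b) hxN, pd_add i dg
        (((differentiableAt_const _).fun_mul ((differentiableAt_const _).fun_mul d1)).fun_mul d2),
        pd_mul i ((differentiableAt_const _).fun_mul ((differentiableAt_const _).fun_mul d1)) d2,
        pd_mul i (differentiableAt_const _) ((differentiableAt_const _).fun_mul d1),
        pd_mul i (differentiableAt_const _) d1, pd_mul i (dl a) (dl b), pd_const, pd_const]
      ring
    have l1 := lie a
    have l2 := lie b
    have l3 := hS.killing x hx a b
    simp only [e1, hg'' x hxN]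
    simp only [Fin.sum_univ_four] at l1 l2 l3 hρ ⊢
    linear_combination l3 + 2 * m₀ * (lower g k x a * lower g k x b) * hρ
      + 2 * m₀ * (c.ρ x).re * (lower g k x b * l1 + lower g k x a * l2)
  · simp only [hg', lower_splitMetric (hA.null x hx)]
    exact hS.normalized x hx
  · obtain ⟨N, e, c, hxN, hNU, H, hk, hT, ⟨h, sh, hh⟩, -, hg''⟩ := frames x hx
    have H' := (H.split hk hg'').1
    set V : Pt → ℂ := fun y => ((m₀ * (c.ρ y).re : ℝ) : ℂ)
    obtain ⟨q, hq⟩ : ∃ q : ℝ, (c.ks e V).q x = q :=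
      ⟨_, (Complex.conj_eq_iff_re.1 (H'.real_q x hxN)).symm⟩
    refine ⟨q, fun a => ?_⟩
    have dk := fun a => H'.differentiableAt_k hxN hk a
    have h1 := sum_covDeriv (g := g') (ξ := ξ) dk a
    -- The new frame contains l + Vk, so ξ equals this vector plus (h - V)k; its covariant
    -- derivative of k remains a multiple of k.
    have h2 : cvec (ξ x) = ∑ i, ![0, 0, 1, h x - V x] i • ksFrame e V i x := by
      rw [(hh x hxN).1, Fin.sum_univ_four]
      simp only [ksFrame, Matrix.cons_val]
      module
    have hk' : ∀ y ∈ N, ksFrame e V 3 y = cvec (k y) := hk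
    rw [← nab_congr H'.metric.isOpen hk' hxN, nab_left g' _ _ x _ (ksFrame e V) h2,
      Fin.sum_univ_four, H'.nab_l_k hxN, H'.nab_k_k hxN, hq, hk' x hxN] at h1
    simp [cvec] at h1
    exact_mod_cast h1.symm

/-! ### The null frame of canonical coordinates -/

/-- The complex divergence `1 / (r + iΣ)`. -/
def divg (s : Pt → ℝ) (y : Pt) : ℂ := ((rCoord y : ℂ) + Complex.I * (s y : ℂ))⁻¹

/-- The conjugate `1 / (r - iΣ)` of the complex divergence. -/
def divgBar (s : Pt → ℝ) (y : Pt) : ℂ := ((rCoord y : ℂ) - Complex.I * (s y : ℂ))⁻¹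

/-- The factor `P / (r - iΣ)` of `m`. -/
def scale (P s : Pt → ℝ) (y : Pt) : ℂ := (P y : ℂ) * divgBar s y

/-- The factor `P / (r + iΣ)` of `\bar m`. -/
def scaleBar (P s : Pt → ℝ) (y : Pt) : ℂ := (P y : ℂ) * divg s y

/-- The frame `(m, \bar m, l, k)` dual to `(ω¹, ω², ω³, ω⁴)`. -/
def canonicalFrame (P s : Pt → ℝ) (L W : Pt → ℂ) (H : Pt → ℝ) : Fin 4 → Pt → Fin 4 → ℂ :=
  ![fun y => scale P s y • ![1 / 2, -Complex.I / 2, -W y, -L y],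
    fun y => scaleBar P s y • ![1 / 2, Complex.I / 2, -star (W y), -star (L y)],
    fun y => ![0, 0, -(H y : ℂ), 1],
    fun y => cvec (kRay y)]

section Derivatives

variable (P s : Pt → ℝ) (L W : Pt → ℂ) (H : Pt → ℝ) (f : Pt → ℂ) (x : Pt)

theorem dd_canonical_m : dd (canonicalFrame P s L W H 0) f x
    = scale P s x * (dz f x - W x * pd 2 f x - L x * pd 3 f x) := by
  simp [dd, canonicalFrame, Fin.sum_univ_four, dz]
  ring

theorem dd_canonical_mb : dd (canonicalFrame P s L W H 1) f x
    = scaleBar P s x * (dzbar f x - star (W x) * pd 2 f x - star (L x) * pd 3 f x) := by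
  simp [dd, canonicalFrame, Fin.sum_univ_four, dzbar]
  ring

theorem dd_canonical_l : dd (canonicalFrame P s L W H 2) f x = pd 3 f x - H x * pd 2 f x := by
  simp [dd, canonicalFrame, Fin.sum_univ_four]
  ring

theorem dd_canonical_k : dd (canonicalFrame P s L W H 3) f x = pd 2 f x := by
  simp [dd, canonicalFrame, Fin.sum_univ_four, cvec, kRay]

end Derivatives

theorem divg_inv_ne {s : Pt → ℝ} {x : Pt} (h : rCoord x ^ 2 + s x ^ 2 ≠ 0) :
    (rCoord x : ℂ) + Complex.I * (s x : ℂ) ≠ 0 ∧ (rCoord x : ℂ) - Complex.I * (s x : ℂ) ≠ 0 := by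
  have h1 : ((rCoord x : ℂ) + Complex.I * (s x : ℂ)) * ((rCoord x : ℂ) - Complex.I * (s x : ℂ))
      ≠ 0 := by
    have h2 : ((rCoord x : ℂ) + Complex.I * (s x : ℂ)) * ((rCoord x : ℂ) - Complex.I * (s x : ℂ))
        = ((rCoord x ^ 2 + s x ^ 2 : ℝ) : ℂ) := by
      push_cast
      linear_combination -(s x : ℂ) ^ 2 * Complex.I_sq
    rw [h2]
    exact_mod_cast h
  exact ⟨left_ne_zero_of_mul h1, right_ne_zero_of_mul h1⟩

theorem star_divg (s : Pt → ℝ) (x : Pt) : star (divg s x) = divgBar s x := by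
  simp [divg, divgBar, sub_eq_add_neg]

theorem star_divgBar (s : Pt → ℝ) (x : Pt) : star (divgBar s x) = divg s x := by
  rw [← star_divg, star_star]

theorem star_scale (P s : Pt → ℝ) (x : Pt) : star (scale P s x) = scaleBar P s x := by
  simp only [scale, scaleBar, star_mul', star_divgBar]
  simp

theorem cform_canonical (P s : Pt → ℝ) (L W : Pt → ℂ) (H : Pt → ℝ) (x : Pt) (v w : Fin 4 → ℂ) :
    cform (canonicalMetric P s L W H x) v w
      = (∑ a, omega1 P s x a * v a) * (∑ a, star (omega1 P s x a) * w a)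
        + (∑ a, star (omega1 P s x a) * v a) * (∑ a, omega1 P s x a * w a)
        - (∑ a, (omega3 L x a : ℂ) * v a) * (∑ a, (omega4 L W H x a : ℂ) * w a)
        - (∑ a, (omega4 L W H x a : ℂ) * v a) * (∑ a, (omega3 L x a : ℂ) * w a) := by
  have h : ∀ a b, (canonicalMetric P s L W H x a b : ℂ)
      = omega1 P s x a * star (omega1 P s x b) + star (omega1 P s x a) * omega1 P s x b
        - (omega3 L x a : ℂ) * omega4 L W H x b - (omega4 L W H x a : ℂ) * omega3 L x b := by
    intro a b
    have h1 : omega1 P s x a * star (omega1 P s x b) + star (omega1 P s x a) * omega1 P s x b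
        = ((2 * (omega1 P s x a * star (omega1 P s x b)).re : ℝ) : ℂ) := by
      rw [← Complex.add_conj]
      simp [mul_comm]
    rw [h1, canonicalMetric, Matrix.of_apply]
    push_cast
    ring
  simp only [cform, h, Finset.sum_mul_sum, ← Finset.sum_add_distrib, ← Finset.sum_sub_distrib]
  exact Finset.sum_congr rfl fun _ _ => Finset.sum_congr rfl fun _ _ => by ring

theorem two_re (z : ℂ) : ((2 * z.re : ℝ) : ℂ) = z + star z := (Complex.add_conj z).symm

theorem sum_omega3 (L : Pt → ℂ) (x : Pt) (v : Fin 4 → ℂ) : ∑ a, (omega3 L x a : ℂ) * v a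
    = v 3 + L x * (v 0 + Complex.I * v 1) + star (L x) * (v 0 - Complex.I * v 1) := by
  simp only [omega3, Fin.sum_univ_four, Complex.ofReal_add, two_re, dzForm]
  simp
  ring

theorem sum_omega4 (L W : Pt → ℂ) (H : Pt → ℝ) (x : Pt) (v : Fin 4 → ℂ) :
    ∑ a, (omega4 L W H x a : ℂ) * v a
    = v 2 + W x * (v 0 + Complex.I * v 1) + star (W x) * (v 0 - Complex.I * v 1)
      + H x * ∑ a, (omega3 L x a : ℂ) * v a := by
  have h : ∀ a, (omega4 L W H x a : ℂ) = ((Pi.single 2 1 : Fin 4 → ℝ) a : ℂ)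
      + (W x * dzForm a + star (W x * dzForm a)) + H x * (omega3 L x a : ℂ) := by
    intro a
    rw [omega4, Complex.ofReal_add, Complex.ofReal_add, two_re, Complex.ofReal_mul]
  rw [Finset.mul_sum]
  simp only [h, Fin.sum_univ_four, dzForm]
  simp
  ring

theorem sum_omega1 (P s : Pt → ℝ) (x : Pt) (v : Fin 4 → ℂ) : ∑ a, omega1 P s x a * v a
    = ((rCoord x : ℂ) - Complex.I * (s x : ℂ)) / (P x : ℂ) * (v 0 + Complex.I * v 1) := by
  simp only [omega1, Fin.sum_univ_four, dzForm]
  simp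
  ring

theorem sum_star_omega1 (P s : Pt → ℝ) (x : Pt) (v : Fin 4 → ℂ) :
    ∑ a, star (omega1 P s x a) * v a
    = ((rCoord x : ℂ) + Complex.I * (s x : ℂ)) / (P x : ℂ) * (v 0 - Complex.I * v 1) := by
  simp only [omega1, Fin.sum_univ_four, dzForm]
  simp
  ring

/-- The data of a metric in canonical form, with the consequences of the normalization of
`Γ₄₁`. -/
structure IsCanonicalData (U : Set Pt) (P s : Pt → ℝ) (L W : Pt → ℂ) (H : Pt → ℝ) : Prop where
  isOpen : IsOpen U
  smooth_P : ContDiffOn ℝ ∞ P U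
  smooth_s : ContDiffOn ℝ ∞ s U
  smooth_L : ContDiffOn ℝ ∞ L U
  smooth_W : ContDiffOn ℝ ∞ W U
  smooth_H : ContDiffOn ℝ ∞ H U
  P_pos : ∀ x ∈ U, 0 < P x
  regular : ∀ x ∈ U, rCoord x ^ 2 + s x ^ 2 ≠ 0
  P_r : ∀ x ∈ U, pd 2 P x = 0
  L_r : ∀ x ∈ U, pd 2 L x = 0
  W_r : ∀ x ∈ U, pd 2 W x = -pd 3 L x
  s_r : ∀ x ∈ U, pd 2 s x = 0
  s_eq : ∀ x ∈ U, s x = sigmaOf P L x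

theorem smooth_rCoord {U : Set Pt} : ContDiffOn ℝ ∞ rCoord U :=
  (contDiff_apply ℝ ℝ (2 : Fin 4)).contDiffOn

theorem pd_rCoord (i : Fin 4) (x : Pt) : pd i rCoord x = if i = 2 then 1 else 0 := by
  have h : HasFDerivAt rCoord _ x := hasFDerivAt_apply (𝕜 := ℝ) (2 : Fin 4) x
  rw [pd, h.fderiv]
  fin_cases i <;> simp

theorem pd_rCoord_ofReal (i : Fin 4) (x : Pt) :
    pd i (fun y => (rCoord y : ℂ)) x = if i = 2 then 1 else 0 := by
  rw [pd_ofReal i (differentiableAt_of_smooth isOpen_univ smooth_rCoord trivial), pd_rCoord]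
  split_ifs <;> simp

namespace IsCanonicalData

variable {U : Set Pt} {P s : Pt → ℝ} {L W : Pt → ℂ} {H : Pt → ℝ}
  (D : IsCanonicalData U P s L W H) {x : Pt}
include D

theorem divg_mul (hx : x ∈ U) : ((rCoord x : ℂ) + Complex.I * (s x : ℂ)) * divg s x = 1 :=
  mul_inv_cancel₀ (divg_inv_ne (D.regular x hx)).1

theorem divgBar_mul (hx : x ∈ U) : ((rCoord x : ℂ) - Complex.I * (s x : ℂ)) * divgBar s x = 1 :=
  mul_inv_cancel₀ (divg_inv_ne (D.regular x hx)).2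

theorem divg_ne (hx : x ∈ U) : divg s x ≠ 0 := inv_ne_zero (divg_inv_ne (D.regular x hx)).1

theorem divgBar_ne (hx : x ∈ U) : divgBar s x ≠ 0 :=
  inv_ne_zero (divg_inv_ne (D.regular x hx)).2

theorem P_ne (hx : x ∈ U) : (P x : ℂ) ≠ 0 := by exact_mod_cast (D.P_pos x hx).ne'

theorem scale_ne (hx : x ∈ U) : scale P s x ≠ 0 := mul_ne_zero (D.P_ne hx) (D.divgBar_ne hx)

theorem scaleBar_ne (hx : x ∈ U) : scaleBar P s x ≠ 0 := mul_ne_zero (D.P_ne hx) (D.divg_ne hx)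

/-- `2 i Σ ρ \bar ρ = \bar ρ - ρ` -/
theorem twist_divg (hx : x ∈ U) :
    2 * Complex.I * (s x : ℂ) * divg s x * divgBar s x = divgBar s x - divg s x := by
  linear_combination divgBar s x * D.divg_mul hx - divg s x * D.divgBar_mul hx

theorem smooth_divg : ContDiffOn ℝ ∞ (divg s) U :=
  ((smooth_ofReal smooth_rCoord).add (contDiffOn_const.mul (smooth_ofReal D.smooth_s))).inv
    fun x hx => (divg_inv_ne (D.regular x hx)).1

theorem smooth_divgBar : ContDiffOn ℝ ∞ (divgBar s) U :=
  ((smooth_ofReal smooth_rCoord).sub (contDiffOn_const.mul (smooth_ofReal D.smooth_s))).inv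
    fun x hx => (divg_inv_ne (D.regular x hx)).2

theorem smooth_scale : ContDiffOn ℝ ∞ (scale P s) U :=
  (smooth_ofReal D.smooth_P).mul D.smooth_divgBar

theorem smooth_scaleBar : ContDiffOn ℝ ∞ (scaleBar P s) U :=
  (smooth_ofReal D.smooth_P).mul D.smooth_divg

theorem pd_divg (hx : x ∈ U) (i : Fin 4) : pd i (divg s) x
    = -divg s x ^ 2 * ((if i = 2 then 1 else 0) + Complex.I * ((pd i s x : ℝ) : ℂ)) := by
  have ds := differentiableAt_of_smooth D.isOpen D.smooth_s hx
  have d1 := differentiableAt_of_smooth D.isOpen (smooth_ofReal smooth_rCoord) hx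
  have d2 := differentiableAt_of_smooth D.isOpen (smooth_ofReal D.smooth_s) hx
  have d3 := (differentiableAt_const Complex.I).fun_mul d2
  refine (pd_inv i (d1.fun_add d3) (divg_inv_ne (D.regular x hx)).1).trans ?_
  rw [pd_add i d1 d3, pd_mul i (differentiableAt_const _) d2, pd_const, pd_rCoord_ofReal,
      pd_ofReal i ds,
    divg]
  ring

theorem pd_divgBar (hx : x ∈ U) (i : Fin 4) : pd i (divgBar s) x
    = -divgBar s x ^ 2 * ((if i = 2 then 1 else 0) - Complex.I * ((pd i s x : ℝ) : ℂ)) := by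
  have ds := differentiableAt_of_smooth D.isOpen D.smooth_s hx
  have d1 := differentiableAt_of_smooth D.isOpen (smooth_ofReal smooth_rCoord) hx
  have d2 := differentiableAt_of_smooth D.isOpen (smooth_ofReal D.smooth_s) hx
  have d3 := (differentiableAt_const Complex.I).fun_mul d2
  refine (pd_inv i (d1.fun_sub d3) (divg_inv_ne (D.regular x hx)).2).trans ?_
  rw [pd_sub i d1 d3, pd_mul i (differentiableAt_const _) d2, pd_const, pd_rCoord_ofReal,
      pd_ofReal i ds,
    divgBar]
  ring

theorem pd_scale_r (hx : x ∈ U) : pd 2 (scale P s) x = -divgBar s x * scale P s x := by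
  have dP := differentiableAt_of_smooth D.isOpen D.smooth_P hx
  refine (pd_mul 2 (differentiableAt_of_smooth D.isOpen (smooth_ofReal D.smooth_P) hx)
    (differentiableAt_of_smooth D.isOpen D.smooth_divgBar hx)).trans ?_
  rw [pd_ofReal 2 dP, D.P_r x hx, D.pd_divgBar hx, D.s_r x hx, scale]
  simp
  ring

end IsCanonicalData

theorem smooth_div {U : Set Pt} {f g : Pt → ℂ} (hf : ContDiffOn ℝ ∞ f U) (hg : ContDiffOn ℝ ∞ g U)
    (h : ∀ x ∈ U, g x ≠ 0) : ContDiffOn ℝ ∞ (fun y => f y / g y) U :=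
  (hf.mul (hg.inv h)).congr fun _ _ => div_eq_mul_inv _ _

/-- The rotation coefficients of the canonical frame. -/
def canonicalCoefs (P s : Pt → ℝ) (L W : Pt → ℂ) (H : Pt → ℝ) : Coefs :=
  let e := canonicalFrame P s L W H
  let n : Pt → ℂ := fun y => dd (e 2) (scale P s) y / scale P s y
  let t : Pt → ℂ := fun y => (divgBar s y - divg s y) * H y + (scale P s y * dd (e 1) W y
    - scaleBar P s y * dd (e 0) (fun z => star (W z)) y)
  let T : Pt → ℂ := fun y => scale P s y * pd 3 L y
  let j : Pt → ℂ := fun y => dd (e 0) (fun z => (H z : ℂ)) y - scale P s y * dd (e 2) W y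
    - T y * H y
  let a : Pt → ℂ := fun y => dd (e 0) (scaleBar P s) y / scaleBar P s y
  { ρ := divg s
    ρb := divgBar s
    F := fun _ => 0
    T := T
    Tb := fun y => star (T y)
    μ := fun y => (1 / 2) * (-(n y + star (n y)) + t y)
    μb := fun y => (1 / 2) * (-(n y + star (n y)) - t y)
    ν := fun y => (1 / 2) * (n y - star (n y) + t y)
    j := j
    jb := fun y => star (j y)
    a := a
    ab := fun y => star (a y)
    q := fun y => pd 2 (fun z => (H z : ℂ)) y }

/-- The defining relation 2iΣ = P²(∂̄L - ∂L̄) divided by r² + Σ². The left side is the l-coefficient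
of [m, m̄]. -/
theorem IsCanonicalData.twist {U : Set Pt} {P s : Pt → ℝ} {L W : Pt → ℂ} {H : Pt → ℝ}
    (D : IsCanonicalData U P s L W H) {x : Pt} (hx : x ∈ U) :
    scale P s x * dd (canonicalFrame P s L W H 1) L x
      - scaleBar P s x * dd (canonicalFrame P s L W H 0) (fun z => star (L z)) x
      = divgBar s x - divg s x := by
  have h0 : pd 2 (fun z => star (L z)) x = 0 := by rw [pd_star, D.L_r x hx, star_zero]
  have h1 : dzbar L x - star (L x) * pd 3 L x = star (dTwist L (fun y => star (L y)) x) := by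
    simp only [dTwist, dz, dzbar, pd_star]
    simp
  have h2 : star (dTwist L (fun y => star (L y)) x) - dTwist L (fun y => star (L y)) x
      = 2 * Complex.I * ((star (dTwist L (fun y => star (L y)) x)).im : ℂ) := by
    apply Complex.ext <;> simp
    ring
  have h3 : (s x : ℂ) = (P x : ℂ) ^ 2 * ((star (dTwist L (fun y => star (L y)) x)).im : ℂ) := by
    rw [D.s_eq x hx, sigmaOf]; push_cast; ring
  rw [dd_canonical_m, dd_canonical_mb, D.L_r x hx, h0, ← D.twist_divg hx, h3]
  simp only [mul_zero, sub_zero, scale, scaleBar]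
  rw [h1]
  have h4 : dz (fun z => star (L z)) x - L x * pd 3 (fun z => star (L z)) x
    = dTwist L (fun y => star (L y)) x := rfl
  rw [h4]
  linear_combination (P x : ℂ) ^ 2 * divg s x * divgBar s x * h2

-- The commutators give only ν - μ = n and μ - μ̄ = t. Since ν is imaginary, Re μ = -Re n, and μ and
-- ν are then determined; this explains the factors 1/2 in `canonicalCoefs`. The dual 1-forms give
-- the Gram matrix without expanding the metric.
set_option maxHeartbeats 800000 in
theorem IsCanonicalData.isNullFrame {U : Set Pt} {P s : Pt → ℝ} {L W : Pt → ℂ} {H : Pt → ℝ}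
    (D : IsCanonicalData U P s L W H) :
    IsNullFrame U (canonicalMetric P s L W H) (canonicalFrame P s L W H)
      (canonicalCoefs P s L W H) := by
  have hU := D.isOpen
  set e := canonicalFrame P s L W H with he
  have se0 : ContDiffOn ℝ ∞ (e 0) U := by
    refine D.smooth_scale.smul (contDiffOn_pi.2 fun a => ?_)
    fin_cases a
    · exact contDiffOn_const
    · exact contDiffOn_const
    · exact D.smooth_W.neg
    · exact D.smooth_L.neg
  have sH := smooth_ofReal D.smooth_H
  have se2 : ContDiffOn ℝ ∞ (e 2) U := by
    refine contDiffOn_pi.2 fun a => ?_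
    fin_cases a
    · exact contDiffOn_const
    · exact contDiffOn_const
    · exact sH.neg
    · exact contDiffOn_const
  have se3 : ContDiffOn ℝ ∞ (e 3) U := contDiffOn_const (c := cvec (Pi.single 2 1))
  have conj : ∀ x, e 1 x = star (e 0 x) := by
    intro x
    change scaleBar P s x • _ = star (scale P s x • _)
    rw [star_smul, star_scale]
    congr 1
    funext a
    fin_cases a <;> simp
  have se1 : ContDiffOn ℝ ∞ (e 1) U :=
    contDiffOn_pi.2 fun a => (smooth_star (smooth_apply se0 a)).congr fun x _ =>
      congrFun (conj x) a
  have real_l : ∀ x, star (e 2 x) = e 2 x := by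
    intro x
    funext a
    fin_cases a <;> simp [e, canonicalFrame]
  have real_k : ∀ x, star (e 3 x) = e 3 x := fun x => star_cvec _
  have dL := fun x (hx : x ∈ U) => differentiableAt_of_smooth hU D.smooth_L hx
  have dW := fun x (hx : x ∈ U) => differentiableAt_of_smooth hU D.smooth_W hx
  have dH := fun x (hx : x ∈ U) => differentiableAt_of_smooth hU sH hx
  have dLb := fun x (hx : x ∈ U) => differentiableAt_of_smooth hU (smooth_star D.smooth_L) hx
  have dWb := fun x (hx : x ∈ U) => differentiableAt_of_smooth hU (smooth_star D.smooth_W) hx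
  have df := fun x (hx : x ∈ U) => differentiableAt_of_smooth hU D.smooth_scale hx
  have dfb := fun x (hx : x ∈ U) => differentiableAt_of_smooth hU D.smooth_scaleBar hx
  have sn : ContDiffOn ℝ ∞ (fun y => dd (e 2) (scale P s) y / scale P s y) U :=
    smooth_div (smooth_dd hU se2 D.smooth_scale) D.smooth_scale fun x hx => D.scale_ne hx
  have st : ContDiffOn ℝ ∞ (fun y => (divgBar s y - divg s y) * H y + (scale P s y * dd (e 1) W y
      - scaleBar P s y * dd (e 0) (fun z => star (W z)) y)) U :=
    ((D.smooth_divgBar.sub D.smooth_divg).mul sH).add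
      ((D.smooth_scale.mul (smooth_dd hU se1 D.smooth_W)).sub
        (D.smooth_scaleBar.mul (smooth_dd hU se0 (smooth_star D.smooth_W))))
  have sT : ContDiffOn ℝ ∞ (fun y => scale P s y * pd 3 L y) U :=
    D.smooth_scale.mul (smooth_pd hU D.smooth_L 3)
  have star_scaleBar : ∀ y, star (scaleBar P s y) = scale P s y := fun y => by
    rw [← star_scale, star_star]
  have ddconj : ∀ (f : Pt → ℂ) y, dd (e 1) f y = star (dd (e 0) (fun z => star (f z)) y) := by
    intro f y
    rw [← dd_star]
    simp only [conj, star_star, dd]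
  have t_imag : ∀ y, star ((divgBar s y - divg s y) * H y + (scale P s y * dd (e 1) W y
      - scaleBar P s y * dd (e 0) (fun z => star (W z)) y))
      = -((divgBar s y - divg s y) * H y + (scale P s y * dd (e 1) W y
      - scaleBar P s y * dd (e 0) (fun z => star (W z)) y)) := by
    intro y
    simp only [star_add, star_sub, star_mul', star_divg, star_divgBar, star_scale, star_scaleBar,
      ddconj, star_star]
    simp
    ring
  have half : star (1 / 2 : ℂ) = 1 / 2 := by simp
  have m0 : ∀ x, e 0 x 0 + Complex.I * e 0 x 1 = scale P s x := by
    intro x; simp [e, canonicalFrame]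
    linear_combination (-1 / 2 : ℂ) * scale P s x * Complex.I_sq
  have m1 : ∀ x, e 0 x 0 - Complex.I * e 0 x 1 = 0 := by
    intro x; simp [e, canonicalFrame]
    linear_combination (1 / 2 : ℂ) * scale P s x * Complex.I_sq
  have b0 : ∀ x, e 1 x 0 + Complex.I * e 1 x 1 = 0 := by
    intro x; simp [e, canonicalFrame]
    linear_combination (1 / 2 : ℂ) * scaleBar P s x * Complex.I_sq
  have b1 : ∀ x, e 1 x 0 - Complex.I * e 1 x 1 = scaleBar P s x := by
    intro x; simp [e, canonicalFrame]
    linear_combination (-1 / 2 : ℂ) * scaleBar P s x * Complex.I_sq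
  have e02 : ∀ x, e 0 x 2 = -scale P s x * W x := by intro x; simp [e, canonicalFrame]
  have e03 : ∀ x, e 0 x 3 = -scale P s x * L x := by intro x; simp [e, canonicalFrame]
  have e12 : ∀ x, e 1 x 2 = -scaleBar P s x * star (W x) := by intro x; simp [e, canonicalFrame]
  have e13 : ∀ x, e 1 x 3 = -scaleBar P s x * star (L x) := by intro x; simp [e, canonicalFrame]
  have w3m : ∀ x, ∑ a, (omega3 L x a : ℂ) * e 0 x a = 0 := by
    intro x; rw [sum_omega3, m0, m1, e03]; ring
  have w4m : ∀ x, ∑ a, (omega4 L W H x a : ℂ) * e 0 x a = 0 := by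
    intro x; rw [sum_omega4, m0, m1, e02, w3m]; ring
  have w3b : ∀ x, ∑ a, (omega3 L x a : ℂ) * e 1 x a = 0 := by
    intro x; rw [sum_omega3, b0, b1, e13]; ring
  have w4b : ∀ x, ∑ a, (omega4 L W H x a : ℂ) * e 1 x a = 0 := by
    intro x; rw [sum_omega4, b0, b1, e12, w3b]; ring
  have w3l : ∀ x, ∑ a, (omega3 L x a : ℂ) * e 2 x a = 1 := by
    intro x; rw [sum_omega3]; simp [e, canonicalFrame]
  have w4l : ∀ x, ∑ a, (omega4 L W H x a : ℂ) * e 2 x a = 0 := by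
    intro x; rw [sum_omega4, w3l]; simp [e, canonicalFrame]
  have w3k : ∀ x, ∑ a, (omega3 L x a : ℂ) * e 3 x a = 0 := by
    intro x; rw [sum_omega3]; simp [e, canonicalFrame, cvec, kRay]
  have w4k : ∀ x, ∑ a, (omega4 L W H x a : ℂ) * e 3 x a = 1 := by
    intro x; rw [sum_omega4, w3k]; simp [e, canonicalFrame, cvec, kRay]
  have l0 : ∀ x, e 2 x 0 = 0 := fun x => rfl
  have l1 : ∀ x, e 2 x 1 = 0 := fun x => rfl
  have k0 : ∀ x, e 3 x 0 = 0 := fun x => by simp [e, canonicalFrame, cvec, kRay]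
  have k1 : ∀ x, e 3 x 1 = 0 := fun x => by simp [e, canonicalFrame, cvec, kRay]
  have c0 : ∀ x ∈ U, ∀ X : Pt → Fin 4 → ℂ, (fun a => dd X (fun y => e 0 y a) x)
      = ![dd X (scale P s) x * (1 / 2), dd X (scale P s) x * (-Complex.I / 2),
        -(dd X (scale P s) x * W x + scale P s x * dd X W x),
        -(dd X (scale P s) x * L x + scale P s x * dd X L x)] := by
    intro x hx X
    have h2 : (fun y => e 0 y 2) = fun y => -(scale P s y * W y) := by
      funext y; rw [e02]; ring
    have h3 : (fun y => e 0 y 3) = fun y => -(scale P s y * L y) := by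
      funext y; rw [e03]; ring
    have hc : ∀ c : ℂ, dd X (fun y => scale P s y * c) x = dd X (scale P s) x * c := by
      intro c; rw [dd_mul (df x hx) (differentiableAt_const c), dd_const]; ring
    funext a
    match a with
    | 0 => exact hc _
    | 1 => exact hc _
    | 2 => rw [h2, dd_neg, dd_mul (df x hx) (dW x hx)]; rfl
    | 3 => rw [h3, dd_neg, dd_mul (df x hx) (dL x hx)]; rfl
  have c1 : ∀ x ∈ U, ∀ X : Pt → Fin 4 → ℂ, (fun a => dd X (fun y => e 1 y a) x)
      = ![dd X (scaleBar P s) x * (1 / 2), dd X (scaleBar P s) x * (Complex.I / 2),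
        -(dd X (scaleBar P s) x * star (W x) + scaleBar P s x * dd X (fun y => star (W y)) x),
        -(dd X (scaleBar P s) x * star (L x) + scaleBar P s x * dd X (fun y => star (L y)) x)] := by
    intro x hx X
    have h2 : (fun y => e 1 y 2) = fun y => -(scaleBar P s y * star (W y)) := by
      funext y; rw [e12]; ring
    have h3 : (fun y => e 1 y 3) = fun y => -(scaleBar P s y * star (L y)) := by
      funext y; rw [e13]; ring
    have hc : ∀ c : ℂ, dd X (fun y => scaleBar P s y * c) x = dd X (scaleBar P s) x * c := by
      intro c; rw [dd_mul (dfb x hx) (differentiableAt_const c), dd_const]; ring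
    funext a
    match a with
    | 0 => exact hc _
    | 1 => exact hc _
    | 2 => rw [h2, dd_neg, dd_mul (dfb x hx) (dWb x hx)]; rfl
    | 3 => rw [h3, dd_neg, dd_mul (dfb x hx) (dLb x hx)]; rfl
  have c2 : ∀ x, ∀ X : Pt → Fin 4 → ℂ, (fun a => dd X (fun y => e 2 y a) x)
      = ![0, 0, -dd X (fun y => (H y : ℂ)) x, 0] := by
    intro x X
    funext a
    match a with
    | 0 => exact dd_const _
    | 1 => exact dd_const _
    | 2 => exact dd_neg
    | 3 => exact dd_const _
  have c3 : ∀ x, ∀ X : Pt → Fin 4 → ℂ, (fun a => dd X (fun y => e 3 y a) x) = 0 :=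
    fun x X => funext fun a => dd_const (cvec (Pi.single 2 1) a)
  have v0 : ∀ x, e 0 x = ![scale P s x * (1 / 2), scale P s x * (-Complex.I / 2),
      -scale P s x * W x, -scale P s x * L x] := by
    intro x; funext a; fin_cases a <;> simp [e, canonicalFrame]
  have v1 : ∀ x, e 1 x = ![scaleBar P s x * (1 / 2), scaleBar P s x * (Complex.I / 2),
      -scaleBar P s x * star (W x), -scaleBar P s x * star (L x)] := by
    intro x; funext a; fin_cases a <;> simp [e, canonicalFrame]
  have v2 : ∀ x, e 2 x = ![0, 0, -(H x : ℂ), 1] := fun x => rfl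
  have v3 : ∀ x, e 3 x = ![0, 0, 1, 0] := by
    intro x; funext a; fin_cases a <;> simp [e, canonicalFrame, cvec, kRay]
  have brv : ∀ X Y : Pt → Fin 4 → ℂ, ∀ x, br X Y x
      = (fun a => dd X (fun y => Y y a) x) - fun a => dd Y (fun y => X y a) x := fun _ _ _ => rfl
  refine IsNullFrame.of_brackets hU ?_ ?_ se0 se2 se3 (fun x _ => conj x) (fun x _ => real_l x)
    (fun x _ => real_k x) (fun x hx => ?_) (fun x hx => ?_) (fun x hx => ?_) (fun x hx => ?_)
    (fun x hx => ?_) (fun x hx => ?_) (fun x hx => ?_) (fun x hx => ?_) (fun x hx => ?_)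
    (fun x hx => ?_) (fun x hx => ?_) (fun x _ => (star_divg s x).symm) (fun x _ => rfl)
    (fun x _ => ?_) (fun x _ => rfl) (fun x _ => rfl) (fun x _ => by simp [canonicalCoefs])
    (fun x _ => ?_) (fun x hx => ?_) D.smooth_divg contDiffOn_const sT
    (contDiffOn_const.mul ((sn.add (smooth_star sn)).neg.add st))
    (contDiffOn_const.mul ((sn.sub (smooth_star sn)).add st))
    (((smooth_dd hU se0 sH).sub (D.smooth_scale.mul (smooth_dd hU se2 D.smooth_W))).sub
      (sT.mul sH))
    (smooth_div (smooth_dd hU se0 D.smooth_scaleBar) D.smooth_scaleBar fun x hx => D.scaleBar_ne hx)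
    (smooth_pd hU sH 2)
  · intro a b
    have s1 : ∀ a, ContDiffOn ℝ ∞ (fun y => omega1 P s y a) U := fun a =>
      ((smooth_div ((smooth_ofReal smooth_rCoord).sub (contDiffOn_const.mul
        (smooth_ofReal D.smooth_s)))
          (smooth_ofReal D.smooth_P) fun x hx => D.P_ne hx).mul contDiffOn_const)
    have s3 : ∀ a, ContDiffOn ℝ ∞ (fun y => omega3 L y a) U := fun a =>
      contDiffOn_const.add (contDiffOn_const.mul (smooth_re (D.smooth_L.mul contDiffOn_const)))
    have s4 : ∀ a, ContDiffOn ℝ ∞ (fun y => omega4 L W H y a) U := fun a =>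
      (contDiffOn_const.add (contDiffOn_const.mul
        (smooth_re (D.smooth_W.mul contDiffOn_const)))).add (D.smooth_H.mul (s3 a))
    exact (contDiffOn_const.mul (smooth_re ((s1 a).mul (smooth_star (s1 b))))).sub
      (((s3 a).mul (s4 b)).add ((s4 a).mul (s3 b)))
  · intro x _ a b
    simp only [canonicalMetric, Matrix.of_apply]
    have : (omega1 P s x a * star (omega1 P s x b)).re
        = (omega1 P s x b * star (omega1 P s x a)).re := by
      simp; ring
    rw [this]; ring
  · rw [cform_canonical, w3m, w4m, sum_omega1, sum_star_omega1, m0, m1]; ring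
  · rw [cform_canonical, w3m, w4m, sum_omega1, sum_star_omega1, sum_omega1, sum_star_omega1, m0,
      m1, b0, b1]
    have h1 := D.divg_mul hx
    have h2 := D.divgBar_mul hx
    have h3 := D.P_ne hx
    have h4 : ((rCoord x : ℂ) - Complex.I * (s x : ℂ)) / (P x : ℂ) * scale P s x = 1 := by
      rw [scale, div_mul_eq_mul_div, div_eq_iff h3]
      linear_combination (P x : ℂ) * h2
    have h5 : ((rCoord x : ℂ) + Complex.I * (s x : ℂ)) / (P x : ℂ) * scaleBar P s x = 1 := by
      rw [scaleBar, div_mul_eq_mul_div, div_eq_iff h3]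
      linear_combination (P x : ℂ) * h1
    rw [h4, h5]
    ring
  · rw [cform_canonical, w3m, w4m, sum_omega1, sum_star_omega1, sum_omega1, sum_star_omega1, m0,
      m1, l0, l1]; ring
  · rw [cform_canonical, w3m, w4m, sum_omega1, sum_star_omega1, sum_omega1, sum_star_omega1, m0,
      m1, k0, k1]; ring
  · rw [cform_canonical, w3l, w4l, sum_omega1, sum_star_omega1, l0, l1]; ring
  · rw [cform_canonical, w3l, w4l, w3k, w4k]
    simp only [sum_omega1, sum_star_omega1, l0, l1]; ring
  · rw [cform_canonical, w3k, w4k, sum_omega1, sum_star_omega1, k0, k1]; ring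
  · obtain ⟨a, ha⟩ : ∃ a, dd (e 0) (scaleBar P s) x = a * scaleBar P s x :=
      ⟨_, (div_mul_cancel₀ _ (D.scaleBar_ne hx)).symm⟩
    have h2 : dd (e 1) (scale P s) x = star a * scale P s x := by
      rw [← star_scaleBar, ← star_mul', ← ha, ddconj]; simp only [star_scale]
    have ha' : (canonicalCoefs P s L W H).a x = a := by
      change dd (e 0) (scaleBar P s) x / scaleBar P s x = a
      rw [ha, mul_div_cancel_right₀ _ (D.scaleBar_ne hx)]
    have hab : (canonicalCoefs P s L W H).ab x = star a := congrArg star ha'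
    have hμ : (canonicalCoefs P s L W H).μ x - (canonicalCoefs P s L W H).μb x
        = (divgBar s x - divg s x) * H x + (scale P s x * dd (e 1) W x
          - scaleBar P s x * dd (e 0) (fun z => star (W z)) x) := by
      simp only [canonicalCoefs, ← he]; ring
    have h4 := D.twist hx
    rw [← he] at h4
    rw [hμ, ha', hab, brv, c1 x hx, c0 x hx, v0, v1, v2, v3, ha, h2]
    change _ = -star a • _ + a • _ + (divgBar s x - divg s x) • _ + _
    rw [← h4]
    funext b
    fin_cases b <;> simp <;> ring
  · have hn : (canonicalCoefs P s L W H).ν x - (canonicalCoefs P s L W H).μ x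
        = dd (e 2) (scale P s) x / scale P s x := by
      simp only [canonicalCoefs, ← he]; ring
    obtain ⟨n, hn'⟩ : ∃ n, dd (e 2) (scale P s) x = n * scale P s x :=
      ⟨_, (div_mul_cancel₀ _ (D.scale_ne hx)).symm⟩
    rw [hn, hn', mul_div_cancel_right₀ _ (D.scale_ne hx), brv, c0 x hx, c2 x, v0, v2, v3, hn']
    change _ = _ - (scale P s x * pd 3 L x) • _ + (dd (e 0) (fun z => (H z : ℂ)) x
      - scale P s x * dd (e 2) W x - (scale P s x * pd 3 L x) * H x) • _
    have hL : dd (e 2) L x = pd 3 L x := by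
      rw [he, dd_canonical_l, D.L_r x hx]; ring
    rw [hL]
    funext b
    fin_cases b <;> simp <;> ring
  -- The consequence W_r = -L_u of the normalization of Γ₄₁ is what makes the k-coefficient of [k,
  -- m] equal to T.
  · rw [brv, c0 x hx, c3, v0, v3]
    change _ = -(divgBar s x + 0) • _ + (scale P s x * pd 3 L x) • _
    have h1 : dd (e 3) (scale P s) x = -divgBar s x * scale P s x := by
      rw [he, dd_canonical_k, D.pd_scale_r hx]
    have h2 : dd (e 3) L x = 0 := by rw [he, dd_canonical_k, D.L_r x hx]
    have h3 : dd (e 3) W x = -pd 3 L x := by rw [he, dd_canonical_k, D.W_r x hx]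
    rw [h1, h2, h3]
    funext b
    fin_cases b <;> simp <;> ring
  · rw [brv, c2, c3, v3]
    change _ = -(pd 2 (fun z => (H z : ℂ)) x) • _
    rw [he, dd_canonical_k]
    funext b
    fin_cases b <;> simp
  · have h := t_imag x
    simp only [canonicalCoefs, ← he]
    generalize dd (e 2) (scale P s) x / scale P s x = n
    generalize (divgBar s x - divg s x) * (H x : ℂ) + (scale P s x * dd (e 1) W x
      - scaleBar P s x * dd (e 0) (fun z => star (W z)) x) = q at h ⊢
    simp only [star_mul', star_add, star_neg, half, star_star, h]
    ring
  · have h := t_imag x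
    simp only [canonicalCoefs, ← he]
    generalize dd (e 2) (scale P s) x / scale P s x = n
    generalize (divgBar s x - divg s x) * (H x : ℂ) + (scale P s x * dd (e 1) W x
      - scaleBar P s x * dd (e 0) (fun z => star (W z)) x) = q at h ⊢
    simp only [star_mul', star_add, star_sub, half, star_star, h]
    ring
  · change star (pd 2 (fun z => (H z : ℂ)) x) = pd 2 (fun z => (H z : ℂ)) x
    rw [pd_ofReal 2 (differentiableAt_of_smooth hU D.smooth_H hx)]
    simp

/-! ### The normalization of `Γ₄₁` -/

section Symmetries

variable {U : Set Pt} {x : Pt} {j : Fin 4} (hU : IsOpen U)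
include hU

theorem pd_pd_zero {F : Type} [NormedAddCommGroup F] [NormedSpace ℝ F] {f : Pt → F}
    (sf : ContDiffOn ℝ ∞ f U) (hf : ∀ y ∈ U, pd j f y = 0) (hx : x ∈ U) (i : Fin 4) :
    pd j (pd i f) x = 0 := by
  rw [pd_comm hU sf hx, pd_congr hU (g := fun _ => 0) hf hx, pd_const]

theorem smooth_dz {f : Pt → ℂ} (sf : ContDiffOn ℝ ∞ f U) : ContDiffOn ℝ ∞ (dz f) U :=
  contDiffOn_const.mul ((smooth_pd hU sf 0).sub (contDiffOn_const.mul (smooth_pd hU sf 1)))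

theorem smooth_dzbar {f : Pt → ℂ} (sf : ContDiffOn ℝ ∞ f U) : ContDiffOn ℝ ∞ (dzbar f) U :=
  contDiffOn_const.mul ((smooth_pd hU sf 0).add (contDiffOn_const.mul (smooth_pd hU sf 1)))

theorem pd_dz {f : Pt → ℂ} (sf : ContDiffOn ℝ ∞ f U) (hx : x ∈ U) :
    pd j (dz f) x = dz (pd j f) x := by
  have d := fun i => differentiableAt_of_smooth hU (smooth_pd hU sf i) hx
  have h := pd_mul j (differentiableAt_const (1 / 2 : ℂ))
    ((d 0).fun_sub ((differentiableAt_const Complex.I).fun_mul (d 1)))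
  rw [pd_const, pd_sub j (d 0) ((differentiableAt_const Complex.I).fun_mul (d 1)),
    pd_mul j (differentiableAt_const _) (d 1), pd_const, pd_comm hU sf hx j,
    pd_comm hU sf hx j] at h
  refine Eq.trans h ?_
  rw [dz]; ring

theorem pd_dz_zero {f : Pt → ℂ} (sf : ContDiffOn ℝ ∞ f U) (hf : ∀ y ∈ U, pd j f y = 0)
    (hx : x ∈ U) : pd j (dz f) x = 0 := by
  rw [pd_dz hU sf hx, dz, pd_congr hU (g := fun _ => 0) hf hx, pd_congr hU (g := fun _ => 0) hf hx,
    pd_const, pd_const]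
  simp

theorem smooth_dTwist {L f : Pt → ℂ} (sL : ContDiffOn ℝ ∞ L U) (sf : ContDiffOn ℝ ∞ f U) :
    ContDiffOn ℝ ∞ (dTwist L f) U := (smooth_dz hU sf).sub (sL.mul (smooth_pd hU sf 3))

theorem smooth_sigmaOf {P : Pt → ℝ} {L : Pt → ℂ} (sP : ContDiffOn ℝ ∞ P U)
    (sL : ContDiffOn ℝ ∞ L U) : ContDiffOn ℝ ∞ (sigmaOf P L) U :=
  (sP.pow 2).mul (smooth_im (smooth_star (smooth_dTwist hU sL (smooth_star sL))))

theorem pd_sigmaOf_zero {P : Pt → ℝ} {L : Pt → ℂ} (sP : ContDiffOn ℝ ∞ P U)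
    (sL : ContDiffOn ℝ ∞ L U) (hP : ∀ y ∈ U, pd j P y = 0) (hL : ∀ y ∈ U, pd j L y = 0)
    (hx : x ∈ U) : pd j (sigmaOf P L) x = 0 := by
  have d := fun {F : Type} [NormedAddCommGroup F] [NormedSpace ℝ F] {f : Pt → F}
    (hf : ContDiffOn ℝ ∞ f U) => differentiableAt_of_smooth hU hf hx
  have sLb := smooth_star sL
  have hLb : ∀ y ∈ U, pd j (fun z => star (L z)) y = 0 := fun y hy => by
    rw [pd_star, hL y hy, star_zero]
  have st := smooth_dTwist hU sL sLb
  have ht : pd j (dTwist L (fun y => star (L y))) x = 0 := by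
    refine (pd_sub j (d (smooth_dz hU sLb)) (d (sL.mul (smooth_pd hU sLb 3)))).trans ?_
    refine (congrArg _ (pd_mul j (d sL) (d (smooth_pd hU sLb 3)))).trans ?_
    rw [pd_dz_zero hU sLb hLb hx, hL x hx, pd_pd_zero hU sLb hLb hx]
    ring
  have h := pd_mul j ((d sP).fun_mul (d sP)) (d (smooth_im (smooth_star st)))
  rw [pd_mul j (d sP) (d sP), pd_im j (d (smooth_star st)), pd_star, ht, hP x hx] at h
  have e : sigmaOf P L = fun y => P y * P y * (star (dTwist L (fun y => star (L y)) y)).im := by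
    funext y; rw [sigmaOf]; ring
  rw [e, h]
  simp

theorem smooth_nabla {P f : Pt → ℝ} (sP : ContDiffOn ℝ ∞ P U) (sf : ContDiffOn ℝ ∞ f U) :
    ContDiffOn ℝ ∞ (nabla P f) U :=
  (sP.pow 2).mul (contDiffOn_const.mul ((smooth_pd hU (smooth_pd hU sf 0) 0).add
    (smooth_pd hU (smooth_pd hU sf 1) 1)))

theorem pd_nabla_zero {P f : Pt → ℝ} (sP : ContDiffOn ℝ ∞ P U) (sf : ContDiffOn ℝ ∞ f U)
    (hP : ∀ y ∈ U, pd j P y = 0) (hf : ∀ y ∈ U, pd j f y = 0) (hx : x ∈ U) :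
    pd j (nabla P f) x = 0 := by
  have d := fun {f : Pt → ℝ} (hf : ContDiffOn ℝ ∞ f U) => differentiableAt_of_smooth hU hf hx
  have s2 := fun i => smooth_pd hU (smooth_pd hU sf i) i
  have h2 : ∀ i, pd j (pd i (pd i f)) x = 0 := fun i =>
    pd_pd_zero hU (smooth_pd hU sf i) (fun y hy => pd_pd_zero hU sf hf hy i) hx i
  have h := pd_mul j ((d sP).fun_mul (d sP)) ((differentiableAt_const (1 / 4 : ℝ)).fun_mul
    ((d (s2 0)).fun_add (d (s2 1))))
  rw [pd_mul j (d sP) (d sP), pd_mul j (differentiableAt_const _) ((d (s2 0)).fun_add (d (s2 1))),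
    pd_add j (d (s2 0)) (d (s2 1)), h2, h2, hP x hx, pd_const] at h
  have e : nabla P f = fun y => P y * P y * ((1 / 4) * (pd 0 (pd 0 f) y + pd 1 (pd 1 f) y)) := by
    funext y; rw [nabla]; ring
  rw [e, h]
  simp

end Symmetries

/-- ∂_r has constant components, so k_{a;b} is a lowered Christoffel symbol; its antisymmetric part
consists of first derivatives of the covector k alone. -/
theorem covDerivLow_kRay {U : Set Pt} {g : Pt → Ten2} (hg : IsSmoothMetric U g) {x : Pt}
    (hx : x ∈ U) (a b : Fin 4) : covDerivLow g kRay x a b = (1 / 2) * (pd b (fun y => g y a 2) x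
      + pd 2 (fun y => g y a b) x - pd a (fun y => g y b 2) x) := by
  have h : ∀ c, covDeriv g kRay c b x = christoffel g c b 2 x := by
    intro c
    have h1 : pd b (fun y => kRay y c) x = 0 := pd_const b ((Pi.single 2 1 : Fin 4 → ℝ) c)
    rw [covDeriv, h1]
    simp [kRay, Pi.single_apply]
  simp only [covDerivLow, Matrix.of_apply, h]
  exact hg.lower_christoffel hx a b 2

theorem canonicalMetric_r (P s : Pt → ℝ) (L W : Pt → ℂ) (H : Pt → ℝ) (x : Pt) (a : Fin 4) :
    canonicalMetric P s L W H x a 2 = -omega3 L x a := by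
  simp [canonicalMetric, omega1, omega4, omega3, dzForm]

theorem canonicalMetric_u (P s : Pt → ℝ) (L W : Pt → ℂ) (H : Pt → ℝ) (x : Pt) (a : Fin 4) :
    canonicalMetric P s L W H x a 3
      = -(2 * H x * omega3 L x a + (Pi.single 2 1 : Fin 4 → ℝ) a + 2 * (W x * dzForm a).re) := by
  simp [canonicalMetric, omega1, omega4, omega3, dzForm]
  ring

theorem pd_two_re {f : Pt → ℂ} {x : Pt} (hf : DifferentiableAt ℝ f x) (c : ℂ) (i : Fin 4) :
    pd i (fun y => 2 * (f y * c).re) x = 2 * (pd i f x * c).re := by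
  have d := hf.fun_mul (differentiableAt_const c)
  have d' : DifferentiableAt ℝ (fun y => (f y * c).re) x := Complex.reCLM.differentiableAt.comp x d
  rw [pd_mul i (differentiableAt_const _) d', pd_const, pd_re i d,
    pd_mul i hf (differentiableAt_const c), pd_const]
  simp

theorem pd_omega3 {L : Pt → ℂ} {x : Pt} (hL : DifferentiableAt ℝ L x) (a i : Fin 4) :
    pd i (fun y => omega3 L y a) x = 2 * (pd i L x * dzForm a).re := by
  have d := hL.fun_mul (differentiableAt_const (dzForm a))
  have d' : DifferentiableAt ℝ (fun y => (L y * dzForm a).re) x :=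
    Complex.reCLM.differentiableAt.comp x d
  rw [← pd_two_re hL]
  refine (pd_add i (differentiableAt_const _) ((differentiableAt_const _).fun_mul d')).trans ?_
  rw [pd_const, zero_add]

theorem sum_two_re {v : Fin 4 → ℂ} (z : ℂ) : ∑ a, v a * ((2 * (z * dzForm a).re : ℝ) : ℂ)
    = z * (v 0 + Complex.I * v 1) + star z * (v 0 - Complex.I * v 1) := by
  simp only [two_re, Fin.sum_univ_four, dzForm]
  simp
  ring

section Frame

variable (P s : Pt → ℝ) (L W : Pt → ℂ) (H : Pt → ℝ) (x : Pt)

theorem canonical_m_add : canonicalFrame P s L W H 0 x 0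
    + Complex.I * canonicalFrame P s L W H 0 x 1 = scale P s x := by
  simp [canonicalFrame]
  linear_combination (-1 / 2 : ℂ) * scale P s x * Complex.I_sq

theorem canonical_m_sub : canonicalFrame P s L W H 0 x 0
    - Complex.I * canonicalFrame P s L W H 0 x 1 = 0 := by
  simp [canonicalFrame]
  linear_combination (1 / 2 : ℂ) * scale P s x * Complex.I_sq

theorem canonical_mb_add : canonicalFrame P s L W H 1 x 0
    + Complex.I * canonicalFrame P s L W H 1 x 1 = 0 := by
  simp [canonicalFrame]
  linear_combination (1 / 2 : ℂ) * scaleBar P s x * Complex.I_sq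

theorem canonical_mb_sub : canonicalFrame P s L W H 1 x 0
    - Complex.I * canonicalFrame P s L W H 1 x 1 = scaleBar P s x := by
  simp [canonicalFrame]
  linear_combination (-1 / 2 : ℂ) * scaleBar P s x * Complex.I_sq

theorem sum_omega3_m : ∑ a, canonicalFrame P s L W H 0 x a * (omega3 L x a : ℂ) = 0 := by
  rw [Finset.sum_congr rfl fun a _ => mul_comm _ _, sum_omega3, canonical_m_add, canonical_m_sub]
  simp [canonicalFrame]
  ring

end Frame

/-- The consequences of the normalization of `Γ₄₁`. -/
theorem IsCanonical.data {U : Set Pt} {P s : Pt → ℝ} {L W : Pt → ℂ} {H : Pt → ℝ}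
    (hU : IsOpen U) (h : IsCanonical U P s L W H)
    (hg : IsSmoothMetric U (canonicalMetric P s L W H)) : IsCanonicalData U P s L W H := by
  set e := canonicalFrame P s L W H with he
  set g := canonicalMetric P s L W H with hg'
  have dL := fun x (hx : x ∈ U) => differentiableAt_of_smooth hU h.smooth_L hx
  have dW := fun x (hx : x ∈ U) => differentiableAt_of_smooth hU h.smooth_W hx
  have dH := fun x (hx : x ∈ U) => differentiableAt_of_smooth hU h.smooth_H hx
  have dω : ∀ x ∈ U, ∀ a, DifferentiableAt ℝ (fun y => omega3 L y a) x := fun x hx a =>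
    (differentiableAt_const _).fun_add ((differentiableAt_const _).fun_mul
      (Complex.reCLM.differentiableAt.comp x ((dL x hx).fun_mul (differentiableAt_const _))))
  have gr : ∀ x ∈ U, ∀ a b, pd b (fun y => g y a 2) x = -(2 * (pd b L x * dzForm a).re) := by
    intro x hx a b
    rw [← pd_omega3 (dL x hx), ← pd_neg]
    simp only [hg', canonicalMetric_r]
  have γ := fun x hx b => h.gamma41 x hx b
  -- The du-component of Γ₄₁ vanishes. Terms proportional to ω³ are annihilated by m, and what is
  -- left is a multiple of L_u + W_r.
  have key : ∀ x ∈ U, pd 2 W x = -pd 3 L x := by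
    intro x hx
    have gu : ∀ a, pd 2 (fun y => g y a 3) x
        = -(2 * pd 2 H x * omega3 L x a + 2 * (pd 2 W x * dzForm a).re) := by
      intro a
      have d1 : DifferentiableAt ℝ (fun y => (W y * dzForm a).re) x :=
        Complex.reCLM.differentiableAt.comp x ((dW x hx).fun_mul (differentiableAt_const _))
      have d2 := (differentiableAt_const (𝕜 := ℝ) (x := x) (2 : ℝ)).fun_mul d1
      have d3 := (differentiableAt_const (𝕜 := ℝ) (x := x) (2 : ℝ)).fun_mul (dH x hx)
      have d4 := d3.fun_mul (dω x hx a)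
      have d5 := d4.fun_add (differentiableAt_const (𝕜 := ℝ) (x := x)
        ((Pi.single 2 1 : Fin 4 → ℝ) a))
      simp only [hg', canonicalMetric_u]
      rw [pd_neg, pd_add 2 d5 d2, pd_add 2 d4 (differentiableAt_const _), pd_const,
        pd_mul 2 d3 (dω x hx a), pd_mul 2 (differentiableAt_const _) (dH x hx), pd_const,
        pd_two_re (dW x hx), pd_omega3 (dL x hx), h.L_r x hx]
      simp
    have h1 := γ x hx 3
    have h2 : ∀ a, (covDerivLow g kRay x a 3 : ℂ)
        = (-1 / 2 : ℂ) * (((2 * (pd 3 L x * dzForm a).re : ℝ) : ℂ)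
          + 2 * (pd 2 H x : ℝ) * (omega3 L x a : ℂ)
          + ((2 * (pd 2 W x * dzForm a).re : ℝ) : ℂ)) := by
      intro a
      have h3 : dzForm 3 = 0 := rfl
      rw [covDerivLow_kRay hg hx, gr x hx, gr x hx, gu, h3]
      push_cast
      simp
      ring
    have h3 : ∑ a, e 0 x a * (covDerivLow g kRay x a 3 : ℂ)
        = (-1 / 2 : ℂ) * (scale P s x * (pd 3 L x + pd 2 W x)) := by
      have e1 : ∀ a, e 0 x a * (covDerivLow g kRay x a 3 : ℂ) = (-1 / 2 : ℂ) *
          (e 0 x a * ((2 * (pd 3 L x * dzForm a).re : ℝ) : ℂ)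
          + 2 * (pd 2 H x : ℝ) * (e 0 x a * (omega3 L x a : ℂ))
          + e 0 x a * ((2 * (pd 2 W x * dzForm a).re : ℝ) : ℂ)) := fun a => by rw [h2]; ring
      simp only [e1]
      rw [← Finset.mul_sum, Finset.sum_add_distrib, Finset.sum_add_distrib, ← Finset.mul_sum,
        sum_two_re, sum_two_re, he, sum_omega3_m, canonical_m_add, canonical_m_sub]
      ring
    have h4 : ∑ a, e 0 x a * (covDerivLow g kRay x a 3 : ℂ) = 0 := h1.trans (by simp [dzForm])
    have hf : scale P s x ≠ 0 := mul_ne_zero (by exact_mod_cast (h.P_pos x hx).ne')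
      (inv_ne_zero (divg_inv_ne (h.regular x hx)).2)
    rw [h3] at h4
    have h5 := (mul_eq_zero.1 ((mul_eq_zero.1 h4).resolve_left (by norm_num))).resolve_left hf
    linear_combination h5
  -- Γ₄₁ on m̄ gives the divergence ρ. Subtracting the conjugate leaves the antisymmetric part of
  -- k_{a;b}, that is, dω³ on (m, m̄) up to sign, which involves only L; comparison with ρ - ρ̄
  -- determines Σ.
  have hs : ∀ x ∈ U, s x = sigmaOf P L x := by
    intro x hx
    have hP : (P x : ℂ) ≠ 0 := by exact_mod_cast (h.P_pos x hx).ne'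
    have e1 : ∀ a, e 1 x a = star (e 0 x a) := by
      have h0 : star (scale P s x) = scaleBar P s x := star_scale P s x
      intro a
      fin_cases a <;> simp [he, canonicalFrame, ← h0]
    have S1 : ∑ b, e 1 x b * ∑ a, e 0 x a * (covDerivLow g kRay x a b : ℂ) = divg s x := by
      have h1 : ∀ b, ∑ a, e 0 x a * (covDerivLow g kRay x a b : ℂ) = star (dzForm b) / (P x : ℂ) :=
        γ x hx
      simp only [h1, Fin.sum_univ_four, dzForm]
      have h2 := canonical_mb_sub P s L W H x
      rw [← he] at h2
      simp
      field_simp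
      rw [scaleBar] at h2
      linear_combination h2
    have S2 : ∑ b, e 0 x b * ∑ a, e 1 x a * (covDerivLow g kRay x a b : ℂ) = divgBar s x := by
      rw [← star_divg, ← S1]
      simp [star_sum, e1]
    have S3 : ∑ b, ∑ a, e 1 x b * e 0 x a * ((covDerivLow g kRay x a b : ℂ)
        - (covDerivLow g kRay x b a : ℂ)) = divg s x - divgBar s x := by
      rw [← S1, ← S2]
      simp only [Finset.mul_sum, mul_sub, Finset.sum_sub_distrib]
      congr 1
      · exact Finset.sum_congr rfl fun _ _ => Finset.sum_congr rfl fun _ _ => by ring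
      · rw [Finset.sum_comm]
        exact Finset.sum_congr rfl fun _ _ => Finset.sum_congr rfl fun _ _ => by ring
    have S4 : ∀ a b, (covDerivLow g kRay x a b : ℂ) - (covDerivLow g kRay x b a : ℂ)
        = ((2 * (pd a L x * dzForm b).re : ℝ) : ℂ) - ((2 * (pd b L x * dzForm a).re : ℝ) : ℂ) := by
      intro a b
      rw [covDerivLow_kRay hg hx, covDerivLow_kRay hg hx, gr x hx, gr x hx, hg.pd_symm hx 2 a b]
      push_cast
      ring
    simp only [S4] at S3
    have S5 : ∑ b, ∑ a, e 1 x b * e 0 x a * (((2 * (pd a L x * dzForm b).re : ℝ) : ℂ)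
        - ((2 * (pd b L x * dzForm a).re : ℝ) : ℂ))
        = scaleBar P s x * dd (e 0) (fun z => star (L z)) x - scale P s x * dd (e 1) L x := by
      have h1 : ∀ z, ∑ b, e 1 x b * ((2 * (z * dzForm b).re : ℝ) : ℂ)
          = star z * scaleBar P s x := by
        intro z
        rw [sum_two_re, he, canonical_mb_add, canonical_mb_sub]; ring
      have h2 : ∀ z, ∑ b, e 0 x b * ((2 * (z * dzForm b).re : ℝ) : ℂ) = z * scale P s x := by
        intro z
        rw [sum_two_re, he, canonical_m_add, canonical_m_sub]; ring
      simp only [mul_sub, Finset.sum_sub_distrib]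
      congr 1
      · rw [Finset.sum_comm, dd, Finset.mul_sum]
        refine Finset.sum_congr rfl fun a _ => ?_
        rw [pd_star, mul_left_comm, mul_comm (scaleBar P s x), ← h1, Finset.mul_sum]
        exact Finset.sum_congr rfl fun _ _ => by ring
      · rw [dd, Finset.mul_sum]
        refine Finset.sum_congr rfl fun a _ => ?_
        rw [mul_left_comm, mul_comm (scale P s x), ← h2, Finset.mul_sum]
        exact Finset.sum_congr rfl fun _ _ => by ring
    rw [S5] at S3
    have h0 : pd 2 (fun z => star (L z)) x = 0 := by rw [pd_star, h.L_r x hx, star_zero]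
    have h1 : dzbar L x - star (L x) * pd 3 L x = star (dTwist L (fun y => star (L y)) x) := by
      simp only [dTwist, dz, dzbar, pd_star]
      simp
    have h4 : dz (fun z => star (L z)) x - L x * pd 3 (fun z => star (L z)) x
      = dTwist L (fun y => star (L y)) x := rfl
    rw [he, dd_canonical_m, dd_canonical_mb, h0, h.L_r x hx, mul_zero, mul_zero, sub_zero, sub_zero,
      h1, h4] at S3
    have h2 : star (dTwist L (fun y => star (L y)) x) - dTwist L (fun y => star (L y)) x
        = 2 * Complex.I * ((star (dTwist L (fun y => star (L y)) x)).im : ℂ) := by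
      apply Complex.ext <;> simp
      ring
    have n1 := (divg_inv_ne (h.regular x hx)).1
    have n2 := (divg_inv_ne (h.regular x hx)).2
    have m1 : ((rCoord x : ℂ) + Complex.I * (s x : ℂ)) * divg s x = 1 := mul_inv_cancel₀ n1
    have m2 : ((rCoord x : ℂ) - Complex.I * (s x : ℂ)) * divgBar s x = 1 := mul_inv_cancel₀ n2
    have h6 : (P x : ℂ) ^ 2 * (dTwist L (fun y => star (L y)) x
        - star (dTwist L (fun y => star (L y)) x)) = -2 * Complex.I * s x := by
      simp only [scale, scaleBar] at S3
      generalize dTwist L (fun y => star (L y)) x = t at S3 ⊢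
      generalize star t = t' at S3 ⊢
      have e3 : (P x : ℂ) ^ 2 * (t - t') * (divg s x * divgBar s x) = divg s x - divgBar s x := by
        linear_combination S3
      have e4 : (P x : ℂ) ^ 2 * (t - t') * (((rCoord x : ℂ) + Complex.I * (s x : ℂ)) * divg s x
          * (((rCoord x : ℂ) - Complex.I * (s x : ℂ)) * divgBar s x))
          = ((rCoord x : ℂ) - Complex.I * (s x : ℂ)) * (((rCoord x : ℂ) + Complex.I * (s x : ℂ))
            * divg s x) - ((rCoord x : ℂ) + Complex.I * (s x : ℂ)) * (((rCoord x : ℂ)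
            - Complex.I * (s x : ℂ)) * divgBar s x) := by
        linear_combination ((rCoord x : ℂ) + Complex.I * (s x : ℂ))
          * ((rCoord x : ℂ) - Complex.I * (s x : ℂ)) * e3
      rw [m1, m2] at e4
      linear_combination e4
    have h7 : Complex.I * (s x : ℂ) = Complex.I * (sigmaOf P L x : ℂ) := by
      rw [sigmaOf]
      push_cast
      linear_combination (1 / 2 : ℂ) * h6 + (1 / 2 : ℂ) * (P x : ℂ) ^ 2 * h2
    exact_mod_cast mul_left_cancel₀ Complex.I_ne_zero h7
  exact
    { isOpen := hU
      smooth_P := h.smooth_P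
      smooth_s := h.smooth_s
      smooth_L := h.smooth_L
      smooth_W := h.smooth_W
      smooth_H := h.smooth_H
      P_pos := h.P_pos
      regular := h.regular
      P_r := h.P_r
      L_r := h.L_r
      W_r := key
      s_r := fun x hx => by
        rw [pd_congr hU hs hx, pd_sigmaOf_zero hU h.smooth_P h.smooth_L h.P_r h.L_r hx]
      s_eq := hs }

/-- The normalization of `Γ₄₁` in terms of the canonical frame. -/
theorem IsCanonicalData.isCanonical {U : Set Pt} {P s : Pt → ℝ} {L W : Pt → ℂ} {H : Pt → ℝ}
    (D : IsCanonicalData U P s L W H) (hT : ∀ x ∈ U, pd 3 L x = 0) : IsCanonical U P s L W H where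
  smooth_P := D.smooth_P
  smooth_s := D.smooth_s
  smooth_L := D.smooth_L
  smooth_W := D.smooth_W
  smooth_H := D.smooth_H
  P_pos := D.P_pos
  regular := D.regular
  P_r := D.P_r
  L_r := D.L_r
  gamma41 := by
    intro x hx
    have F := D.isNullFrame
    have T0 : (canonicalCoefs P s L W H).T x = 0 := by simp [canonicalCoefs, hT x hx]
    set e := canonicalFrame P s L W H with he
    have hk : ∀ y ∈ U, e 3 y = cvec (kRay y) := fun y _ => rfl
    -- Both 1-forms are compared on the frame. Γ₄₁ on e_i is the m̄-component of ∇_{e_i} k, which is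
    -- nonzero only for e_i = m̄.
    have h1 : ∀ i, ∑ b, e i x b * (∑ a, e 0 x a
        * (covDerivLow (canonicalMetric P s L W H) kRay x a b : ℂ)
        - star (dzForm b) / (P x : ℂ)) = 0 := by
      intro i
      have h2 : ∑ b, e i x b * ∑ a, e 0 x a
          * (covDerivLow (canonicalMetric P s L W H) kRay x a b : ℂ)
          = cform (covDerivLow (canonicalMetric P s L W H) kRay x) (e 0 x) (e i x) := by
        simp only [cform, Finset.mul_sum]
        rw [Finset.sum_comm]
        exact Finset.sum_congr rfl fun _ _ => Finset.sum_congr rfl fun _ _ => by ring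
      have h3 : ∑ b, e i x b * (star (dzForm b) / (P x : ℂ))
          = (e i x 0 - Complex.I * e i x 1) / (P x : ℂ) := by
        simp [Fin.sum_univ_four, dzForm]
        ring
      simp only [mul_sub, Finset.sum_sub_distrib]
      rw [h2, h3, cform_covDerivLow (F.differentiableAt_k hx hk), ← nab_congr F.metric.isOpen hk hx,
        F.nab_eq hx, cform_sum_right]
      simp only [cform_smul_right, F.gram x hx]
      have hP := D.P_ne hx
      match i with
      | 0 => rw [he, canonical_m_sub]; simp [Coefs.γ, eta, Fin.sum_univ_four]
      | 1 =>
        rw [he, canonical_mb_sub, scaleBar, mul_div_cancel_left₀ _ hP]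
        simp [Coefs.γ, eta, Fin.sum_univ_four, canonicalCoefs]
      | 2 => simp [Coefs.γ, eta, Fin.sum_univ_four, he, canonicalFrame]
      | 3 => simp [Coefs.γ, eta, Fin.sum_univ_four, he, canonicalFrame, cvec, kRay]
    have h4 := Matrix.eq_zero_of_mulVec_eq_zero (det_frame_ne_zero (F.gram x hx))
      (v := fun b => ∑ a, e 0 x a * (covDerivLow (canonicalMetric P s L W H) kRay x a b : ℂ)
        - star (dzForm b) / (P x : ℂ)) (funext fun i => h1 i)
    exact fun b => sub_eq_zero.1 (congrFun h4 b)

/-! ### Metrics without dependence on `u` of `P` and `L` -/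

/-- Two sets of rotation coefficients which agree on `U`. -/
structure Coefs.EqOn (c c' : Coefs) (U : Set Pt) : Prop where
  ρ : ∀ x ∈ U, c.ρ x = c'.ρ x
  ρb : ∀ x ∈ U, c.ρb x = c'.ρb x
  F : ∀ x ∈ U, c.F x = c'.F x
  T : ∀ x ∈ U, c.T x = c'.T x
  Tb : ∀ x ∈ U, c.Tb x = c'.Tb x
  μ : ∀ x ∈ U, c.μ x = c'.μ x
  μb : ∀ x ∈ U, c.μb x = c'.μb x
  ν : ∀ x ∈ U, c.ν x = c'.ν x
  j : ∀ x ∈ U, c.j x = c'.j x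
  jb : ∀ x ∈ U, c.jb x = c'.jb x
  a : ∀ x ∈ U, c.a x = c'.a x
  ab : ∀ x ∈ U, c.ab x = c'.ab x
  q : ∀ x ∈ U, c.q x = c'.q x

theorem Coefs.EqOn.γ {c c' : Coefs} {U : Set Pt} (h : c.EqOn c' U) {x : Pt} (hx : x ∈ U)
    (i j k : Fin 4) : c.γ i j k x = c'.γ i j k x := by
  fin_cases i <;> fin_cases j <;> fin_cases k <;>
    simp [Coefs.γ, h.ρ x hx, h.ρb x hx, h.F x hx, h.T x hx, h.Tb x hx, h.μ x hx, h.μb x hx,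
      h.ν x hx, h.j x hx, h.jb x hx, h.a x hx, h.ab x hx, h.q x hx]

theorem IsNullFrame.congr {U : Set Pt} {g : Pt → Ten2} {e : Fin 4 → Pt → Fin 4 → ℂ}
    {c c' : Coefs} (H : IsNullFrame U g e c) (h : c.EqOn c' U) : IsNullFrame U g e c' where
  metric := H.metric
  smooth := H.smooth
  smooth_coef := fun i j k => (H.smooth_coef i j k).congr fun x hx => (h.γ hx i j k).symm
  gram := H.gram
  bracket := fun x hx i j => by simp only [H.bracket x hx, h.γ hx]
  antisymm := fun x _ i j k => c'.antisymm i j k x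
  conj_m := H.conj_m
  real_l := H.real_l
  real_k := H.real_k
  conj_ρ := fun x hx => by rw [← h.ρ x hx, ← h.ρb x hx, H.conj_ρ x hx]
  conj_T := fun x hx => by rw [← h.T x hx, ← h.Tb x hx, H.conj_T x hx]
  conj_μ := fun x hx => by rw [← h.μ x hx, ← h.μb x hx, H.conj_μ x hx]
  conj_j := fun x hx => by rw [← h.j x hx, ← h.jb x hx, H.conj_j x hx]
  conj_a := fun x hx => by rw [← h.a x hx, ← h.ab x hx, H.conj_a x hx]
  imag_F := fun x hx => by rw [← h.F x hx, H.imag_F x hx]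
  imag_ν := fun x hx => by rw [← h.ν x hx, H.imag_ν x hx]
  real_q := fun x hx => by rw [← h.q x hx, H.real_q x hx]

/-- A metric in canonical form with `P_u = L_u = 0` and `W = iΣ_ζ`. -/
structure IsReducedData (U : Set Pt) (P s : Pt → ℝ) (L W : Pt → ℂ) (H : Pt → ℝ) : Prop
    extends IsCanonicalData U P s L W H where
  P_u : ∀ x ∈ U, pd 3 P x = 0
  L_u : ∀ x ∈ U, pd 3 L x = 0
  W_eq : ∀ x ∈ U, W x = Complex.I * dz (fun y => (s y : ℂ)) x

/-- The rotation coefficients of the canonical frame of such a metric. -/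
def reducedCoefs (P s : Pt → ℝ) (L W : Pt → ℂ) (H : Pt → ℝ) : Coefs :=
  let e := canonicalFrame P s L W H
  let N : Pt → ℂ := fun y => (nabla P s y : ℂ)
  { ρ := divg s
    ρb := divgBar s
    F := fun _ => 0
    T := fun _ => 0
    Tb := fun _ => 0
    μ := fun y => -H y * divg s y + Complex.I * divg s y * divgBar s y * N y
    μb := fun y => -H y * divgBar s y - Complex.I * divg s y * divgBar s y * N y
    ν := fun y => H y * (divgBar s y - divg s y) + Complex.I * divg s y * divgBar s y * N y
    j := dd (e 0) (fun y => (H y : ℂ))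
    jb := dd (e 1) (fun y => (H y : ℂ))
    a := fun y => divgBar s y * dz (fun z => (P z : ℂ)) y
    ab := fun y => divg s y * dzbar (fun z => (P z : ℂ)) y
    q := dd (e 3) (fun y => (H y : ℂ)) }

/-! ### Second derivatives in ζ and ζ̄ -/

theorem star_dz (f : Pt → ℂ) (x : Pt) : star (dz f x) = dzbar (fun y => star (f y)) x := by
  simp only [dz, dzbar, pd_star]
  simp

theorem dz_dzbar {U : Set Pt} (hU : IsOpen U) {f : Pt → ℝ} (sf : ContDiffOn ℝ ∞ f U) {x : Pt}
    (hx : x ∈ U) : dz (dzbar fun y => (f y : ℂ)) x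
      = (((1 / 4) * (pd 0 (pd 0 f) x + pd 1 (pd 1 f) x) : ℝ) : ℂ) := by
  have sc := smooth_ofReal sf
  have d := fun i => differentiableAt_of_smooth hU (smooth_pd hU sc i) hx
  have h : ∀ j, pd j (dzbar fun y => (f y : ℂ)) x = (1 / 2) * (pd j (pd 0 fun y => (f y : ℂ)) x
      + Complex.I * pd j (pd 1 fun y => (f y : ℂ)) x) := by
    intro j
    refine (pd_mul j (differentiableAt_const (1 / 2 : ℂ))
      ((d 0).fun_add ((differentiableAt_const Complex.I).fun_mul (d 1)))).trans ?_
    rw [pd_const, pd_add j (d 0) ((differentiableAt_const Complex.I).fun_mul (d 1)),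
      pd_mul j (differentiableAt_const _) (d 1), pd_const]
    ring
  have h2 : ∀ i, pd i (pd i fun y => (f y : ℂ)) x = ((pd i (pd i f) x : ℝ) : ℂ) := by
    intro i
    rw [pd_congr hU (fun y hy => pd_ofReal i (differentiableAt_of_smooth hU sf hy)) hx,
      pd_ofReal i (differentiableAt_of_smooth hU (smooth_pd hU sf i) hx)]
  rw [dz, h, h, pd_comm hU sc hx 1 0, h2, h2]
  push_cast
  linear_combination (-1 / 4 : ℂ) * ((pd 1 (pd 1 f) x : ℝ) : ℂ) * Complex.I_sq

theorem dzbar_dz {U : Set Pt} (hU : IsOpen U) {f : Pt → ℝ} (sf : ContDiffOn ℝ ∞ f U) {x : Pt}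
    (hx : x ∈ U) : dzbar (dz fun y => (f y : ℂ)) x
      = (((1 / 4) * (pd 0 (pd 0 f) x + pd 1 (pd 1 f) x) : ℝ) : ℂ) := by
  have h : (fun y => star (dzbar (fun z => (f z : ℂ)) y)) = dz fun z => (f z : ℂ) := by
    funext y
    have := star_dz (fun z => (f z : ℂ)) y
    simp only [RCLike.star_def, Complex.conj_ofReal] at this
    rw [← this]; simp
  rw [← h, ← star_dz, dz_dzbar hU sf hx]
  simp

/-- P²(ln P)_{ζζ̄} = P P_{ζζ̄} - P_ζ P_ζ̄: the form in which ∇(ln P) arises from δ, δ̄ and the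
coefficients a, ā in the mm̄ component. -/
theorem nabla_logP {U : Set Pt} (hU : IsOpen U) {P : Pt → ℝ} (sP : ContDiffOn ℝ ∞ P U)
    (hP : ∀ y ∈ U, 0 < P y) {x : Pt} (hx : x ∈ U) : nabla P (logP P) x
      = (1 / 4) * (P x * (pd 0 (pd 0 P) x + pd 1 (pd 1 P) x) - pd 0 P x ^ 2 - pd 1 P x ^ 2) := by
  have h1 : ∀ i, ∀ y ∈ U, pd i (logP P) y = (P y)⁻¹ * pd i P y := by
    intro i y hy
    have dP := differentiableAt_of_smooth hU sP hy
    have h : HasFDerivAt (logP P) ((P y)⁻¹ • fderiv ℝ P y) y :=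
      dP.hasFDerivAt.log (hP y hy).ne'
    rw [pd, h.fderiv]; rfl
  have h2 : ∀ i, pd i (fun y => (P y)⁻¹) x = -(P x ^ 2)⁻¹ * pd i P x := by
    intro i
    have dP := differentiableAt_of_smooth hU sP hx
    have h : HasFDerivAt (fun y => (P y)⁻¹) ((-(P x ^ 2)⁻¹) • fderiv ℝ P x) x :=
      (hasDerivAt_inv (hP x hx).ne').comp_hasFDerivAt x dP.hasFDerivAt
    rw [pd, h.fderiv]; rfl
  have h3 : ∀ i, pd i (pd i (logP P)) x
      = -(P x ^ 2)⁻¹ * pd i P x ^ 2 + (P x)⁻¹ * pd i (pd i P) x := by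
    intro i
    have dP := differentiableAt_of_smooth hU sP hx
    have dInv : DifferentiableAt ℝ (fun y => (P y)⁻¹) x := dP.inv (hP x hx).ne'
    rw [pd_congr hU (h1 i) hx, pd_mul i dInv
      (differentiableAt_of_smooth hU (smooth_pd hU sP i) hx), h2]
    ring
  have hne := (hP x hx).ne'
  rw [nabla, h3, h3]
  field_simp
  ring

theorem smooth_logP {U : Set Pt} {P : Pt → ℝ} (sP : ContDiffOn ℝ ∞ P U)
    (hP : ∀ y ∈ U, 0 < P y) : ContDiffOn ℝ ∞ (logP P) U :=
  sP.log fun y hy => (hP y hy).ne'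

theorem pd_logP_zero {U : Set Pt} (hU : IsOpen U) {P : Pt → ℝ} (sP : ContDiffOn ℝ ∞ P U)
    (hP : ∀ y ∈ U, 0 < P y) {j : Fin 4} {x : Pt} (hx : x ∈ U) (h : pd j P x = 0) :
    pd j (logP P) x = 0 := by
  have dP := differentiableAt_of_smooth hU sP hx
  have h1 : HasFDerivAt (logP P) ((P x)⁻¹ • fderiv ℝ P x) x :=
    dP.hasFDerivAt.log (hP x hx).ne'
  rw [pd, h1.fderiv]
  change (P x)⁻¹ * pd j P x = 0
  rw [h, mul_zero]

section

variable {P s : Pt → ℝ} {L W : Pt → ℂ} {H : Pt → ℝ} {f : Pt → ℂ} {x : Pt}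

theorem dd_m_of_pd_eq_zero (hr : pd 2 f x = 0) (hu : pd 3 f x = 0) :
    dd (canonicalFrame P s L W H 0) f x = scale P s x * dz f x := by
  rw [dd_canonical_m, hr, hu]; ring

theorem dd_mb_of_pd_eq_zero (hr : pd 2 f x = 0) (hu : pd 3 f x = 0) :
    dd (canonicalFrame P s L W H 1) f x = scaleBar P s x * dzbar f x := by
  rw [dd_canonical_mb, hr, hu]; ring

theorem dd_l_of_pd_eq_zero (hr : pd 2 f x = 0) :
    dd (canonicalFrame P s L W H 2) f x = pd 3 f x := by
  rw [dd_canonical_l, hr]; ring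

end

namespace IsReducedData

variable {U : Set Pt} {P s : Pt → ℝ} {L W : Pt → ℂ} {H : Pt → ℝ}
  (R : IsReducedData U P s L W H) {x : Pt}
include R

theorem s_u (hx : x ∈ U) : pd 3 s x = 0 := by
  rw [pd_congr R.isOpen R.s_eq hx, pd_sigmaOf_zero R.isOpen R.smooth_P R.smooth_L R.P_u R.L_u hx]

theorem pd_s (hx : x ∈ U) (i : Fin 4) : pd i (fun y => (s y : ℂ)) x = ((pd i s x : ℝ) : ℂ) :=
  pd_ofReal i (differentiableAt_of_smooth R.isOpen R.smooth_s hx)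

/-- The point of W = iΣ_ζ: since Σ depends on neither r nor u, δ(r + iΣ) is proportional to -W +
iΣ_ζ = 0. -/
theorem m_divg (hx : x ∈ U) : dd (canonicalFrame P s L W H 0) (divg s) x = 0 := by
  have h0 := R.pd_divg hx 0
  have h1 := R.pd_divg hx 1
  have hW := R.W_eq x hx
  rw [dz, R.pd_s hx, R.pd_s hx] at hW
  rw [dd_canonical_m, dz, h0, h1, R.pd_divg hx 2, R.pd_divg hx 3, R.s_r x hx, R.s_u hx, hW]
  simp
  ring_nf
  simp

theorem k_divg (hx : x ∈ U) : dd (canonicalFrame P s L W H 3) (divg s) x = -divg s x ^ 2 := by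
  rw [dd_canonical_k, R.pd_divg hx 2, R.s_r x hx]; simp

theorem k_divgBar (hx : x ∈ U) :
    dd (canonicalFrame P s L W H 3) (divgBar s) x = -divgBar s x ^ 2 := by
  rw [dd_canonical_k, R.pd_divgBar hx 2, R.s_r x hx]; simp

/-- l + H∂_r = ∂_u and ρ does not depend on u, so Δρ = -H Dρ. Thus H plays the role that h has in
the stationary case, without any symmetry of H itself. -/
theorem l_divg (hx : x ∈ U) : dd (canonicalFrame P s L W H 2) (divg s) x = H x * divg s x ^ 2 := by
  rw [dd_canonical_l, R.pd_divg hx 2, R.pd_divg hx 3, R.s_r x hx, R.s_u hx]; simp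

theorem l_divgBar (hx : x ∈ U) :
    dd (canonicalFrame P s L W H 2) (divgBar s) x = H x * divgBar s x ^ 2 := by
  rw [dd_canonical_l, R.pd_divgBar hx 2, R.pd_divgBar hx 3, R.s_r x hx, R.s_u hx]; simp

end IsReducedData

namespace IsReducedData

variable {U : Set Pt} {P s : Pt → ℝ} {L W : Pt → ℂ} {H : Pt → ℝ}
  (R : IsReducedData U P s L W H) {x : Pt}
include R

theorem pd_W (hx : x ∈ U) : pd 2 W x = 0 ∧ pd 3 W x = 0 := by
  have ss := smooth_ofReal R.smooth_s
  have h : ∀ i, (∀ y ∈ U, pd i (fun y => (s y : ℂ)) y = 0) → pd i W x = 0 := by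
    intro i hi
    rw [pd_congr R.isOpen R.W_eq hx,
      pd_mul i (differentiableAt_const _)
        (differentiableAt_of_smooth R.isOpen (smooth_dz R.isOpen ss) hx),
      pd_const, pd_dz_zero R.isOpen ss hi hx]
    ring
  exact ⟨h 2 fun y hy => by rw [R.pd_s hy, R.s_r y hy, Complex.ofReal_zero],
    h 3 fun y hy => by rw [R.pd_s hy, R.s_u hy, Complex.ofReal_zero]⟩

theorem dzbar_W (hx : x ∈ U) : (P x : ℂ) ^ 2 * dzbar W x = Complex.I * (nabla P s x : ℂ) := by
  have ss := smooth_ofReal R.smooth_s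
  have d := differentiableAt_of_smooth R.isOpen (smooth_dz R.isOpen ss) hx
  have h : dzbar W x = Complex.I * dzbar (dz fun y => (s y : ℂ)) x := by
    simp only [dzbar]
    rw [pd_congr R.isOpen R.W_eq hx, pd_congr R.isOpen R.W_eq hx,
      pd_mul 0 (differentiableAt_const _) d, pd_mul 1 (differentiableAt_const _) d, pd_const,
      pd_const]
    ring
  rw [h, dzbar_dz R.isOpen R.smooth_s hx, nabla]
  push_cast
  ring

theorem pd_P (hx : x ∈ U) : pd 2 (fun y => (P y : ℂ)) x = 0 ∧ pd 3 (fun y => (P y : ℂ)) x = 0 := by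
  have d := differentiableAt_of_smooth R.isOpen R.smooth_P hx
  rw [pd_ofReal 2 d, pd_ofReal 3 d, R.P_r x hx, R.P_u x hx]
  simp

/-- Specialization of `canonicalCoefs`: L_u = 0 removes T, the u-independence of P and Σ leaves only
H in the derivative of P/(r - iΣ) along l, and W = iΣ_ζ turns the derivatives of W in [m, m̄] into
∇Σ. -/
theorem isNullFrame : IsNullFrame U (canonicalMetric P s L W H) (canonicalFrame P s L W H)
    (reducedCoefs P s L W H) := by
  have D := R.toIsCanonicalData
  have hU := D.isOpen
  set e := canonicalFrame P s L W H with he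
  have dP := fun x (hx : x ∈ U) => differentiableAt_of_smooth hU (smooth_ofReal D.smooth_P) hx
  have dρ := fun x (hx : x ∈ U) => differentiableAt_of_smooth hU D.smooth_divg hx
  have dρb := fun x (hx : x ∈ U) => differentiableAt_of_smooth hU D.smooth_divgBar hx
  have hn : ∀ x ∈ U, dd (e 2) (scale P s) x / scale P s x = H x * divgBar s x := by
    intro x hx
    rw [div_eq_iff (D.scale_ne hx)]
    refine (dd_mul (dP x hx) (dρb x hx)).trans ?_
    rw [R.l_divgBar hx, dd_canonical_l, (R.pd_P hx).1, (R.pd_P hx).2, scale]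
    ring
  have hT : ∀ x ∈ U, scale P s x * pd 3 L x = 0 := fun x hx => by rw [R.L_u x hx, mul_zero]
  have hW : ∀ x ∈ U, dd (e 2) W x = 0 := fun x hx => by
    rw [dd_canonical_l, (R.pd_W hx).1, (R.pd_W hx).2]; ring
  have hm : ∀ x ∈ U, scale P s x * dd (e 1) W x
      - scaleBar P s x * dd (e 0) (fun z => star (W z)) x
      = 2 * Complex.I * divg s x * divgBar s x * (nabla P s x : ℂ) := by
    intro x hx
    have h1 : dz (fun z => star (W z)) x = star (dzbar W x) := by
      simp only [dz, dzbar, pd_star]; simp; ring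
    have h3 := congrArg star (R.dzbar_W hx)
    simp only [star_mul', star_pow, RCLike.star_def, Complex.conj_ofReal, Complex.conj_I] at h3
    rw [dd_mb_of_pd_eq_zero (R.pd_W hx).1 (R.pd_W hx).2, dd_m_of_pd_eq_zero
      (by rw [pd_star, (R.pd_W hx).1, star_zero]) (by rw [pd_star, (R.pd_W hx).2, star_zero]),
      scale, scaleBar, h1, RCLike.star_def]
    linear_combination divg s x * divgBar s x * (R.dzbar_W hx - h3)
  have ha : ∀ x ∈ U, dd (e 0) (scaleBar P s) x / scaleBar P s x
      = divgBar s x * dz (fun z => (P z : ℂ)) x := by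
    intro x hx
    rw [div_eq_iff (D.scaleBar_ne hx)]
    refine (dd_mul (dP x hx) (dρ x hx)).trans ?_
    rw [R.m_divg hx, dd_m_of_pd_eq_zero (R.pd_P hx).1 (R.pd_P hx).2, scale, scaleBar]
    ring
  have hj : ∀ x ∈ U, (canonicalCoefs P s L W H).j x = dd (e 0) (fun y => (H y : ℂ)) x := by
    intro x hx
    change dd (e 0) (fun z => (H z : ℂ)) x - scale P s x * dd (e 2) W x
      - (scale P s x * pd 3 L x) * H x = _
    rw [hT x hx, hW x hx]; ring
  have sn : ∀ x, star ((H x : ℂ) * divgBar s x) = H x * divg s x := fun x => by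
    rw [star_mul', star_divgBar]; simp
  refine D.isNullFrame.congr ⟨fun x _ => rfl, fun x _ => rfl, fun x _ => rfl, hT,
    fun x hx => ?_, fun x hx => ?_, fun x hx => ?_, fun x hx => ?_, hj, fun x hx => ?_, ha,
    fun x hx => ?_, fun x hx => ?_⟩
  · change star (scale P s x * pd 3 L x) = 0
    rw [hT x hx, star_zero]
  · simp only [canonicalCoefs, reducedCoefs, ← he]
    rw [hn x hx, hm x hx, sn]; ring
  · simp only [canonicalCoefs, reducedCoefs, ← he]
    rw [hn x hx, hm x hx, sn]; ring
  · simp only [canonicalCoefs, reducedCoefs, ← he]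
    rw [hn x hx, hm x hx, sn]; ring
  · change star ((canonicalCoefs P s L W H).j x) = dd (e 1) (fun y => (H y : ℂ)) x
    rw [hj x hx]
    exact (D.isNullFrame.dd_conj_m hx fun y _ => by simp).symm
  · change star (dd (e 0) (scaleBar P s) x / scaleBar P s x)
      = divg s x * dzbar (fun z => (P z : ℂ)) x
    rw [ha x hx, star_mul', star_divgBar, star_dz]
    simp
  · exact (dd_canonical_k P s L W H _ x).symm

theorem mb_divgBar (hx : x ∈ U) : dd (canonicalFrame P s L W H 1) (divgBar s) x = 0 := by
  rw [R.isNullFrame.dd_conj_m hx fun y _ => (star_divg s y).symm, R.m_divg hx, star_zero]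

theorem ricci_kk_eq (hx : x ∈ U) :
    frameRicci (canonicalFrame P s L W H) (reducedCoefs P s L W H).γ 3 3 x = 0 := by
  rw [ricci_kk]
  simp only [reducedCoefs]
  rw [R.k_divg hx, R.k_divgBar hx]
  ring

theorem ricci_km_eq (hx : x ∈ U) :
    frameRicci (canonicalFrame P s L W H) (reducedCoefs P s L W H).γ 3 0 x = 0 := by
  rw [ricci_km]
  simp only [reducedCoefs]
  rw [R.m_divg hx, dd_const]
  ring

/-- `δ` of `ρ f_{\bar ζ}`, for a real function `f` of `(ζ, \bar ζ)` alone -/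
theorem dd_dd {f : Pt → ℝ} (sf : ContDiffOn ℝ ∞ f U) (hr : ∀ y ∈ U, pd 2 f y = 0)
    (hu : ∀ y ∈ U, pd 3 f y = 0) (hx : x ∈ U) :
    dd (canonicalFrame P s L W H 0) (fun y => divg s y * dzbar (fun z => (f z : ℂ)) y) x
      = divg s x * scale P s x * (((1 / 4) * (pd 0 (pd 0 f) x + pd 1 (pd 1 f) x) : ℝ) : ℂ) := by
  have hU := R.isOpen
  have sc := smooth_ofReal sf
  have h : ∀ i, (∀ y ∈ U, pd i f y = 0) → ∀ y ∈ U, pd i (fun z => (f z : ℂ)) y = 0 :=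
    fun i hi y hy => by
      rw [pd_ofReal i (differentiableAt_of_smooth hU sf hy), hi y hy, Complex.ofReal_zero]
  have h2 : ∀ i, (∀ y ∈ U, pd i f y = 0) → pd i (dzbar fun z => (f z : ℂ)) x = 0 := by
    intro i hi
    have : (dzbar fun z => (f z : ℂ)) = fun y => star (dz (fun z => (f z : ℂ)) y) := by
      funext y; rw [star_dz]; simp
    rw [this, pd_star, pd_dz_zero hU sc (h i hi) hx, star_zero]
  rw [dd_mul (differentiableAt_of_smooth hU R.smooth_divg hx)
    (differentiableAt_of_smooth hU (smooth_dzbar hU sc) hx), R.m_divg hx,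
    dd_m_of_pd_eq_zero (h2 2 hr) (h2 3 hu), dz_dzbar hU sf hx]
  ring

theorem dd_ab (hx : x ∈ U) : dd (canonicalFrame P s L W H 0) (reducedCoefs P s L W H).ab x
    = divg s x * scale P s x * (((1 / 4) * (pd 0 (pd 0 P) x + pd 1 (pd 1 P) x) : ℝ) : ℂ) :=
  R.dd_dd R.smooth_P R.P_r R.P_u hx

theorem dd_a (hx : x ∈ U) : dd (canonicalFrame P s L W H 1) (reducedCoefs P s L W H).a x
    = divgBar s x * scaleBar P s x
      * (((1 / 4) * (pd 0 (pd 0 P) x + pd 1 (pd 1 P) x) : ℝ) : ℂ) := by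
  have h : ∀ y ∈ U, (reducedCoefs P s L W H).a y = star ((reducedCoefs P s L W H).ab y) :=
    fun y hy => by rw [R.isNullFrame.conj_a y hy, star_star]
  rw [R.isNullFrame.dd_conj_m hx h, R.dd_ab hx, star_mul', star_mul', star_divg, star_scale]
  simp only [RCLike.star_def, Complex.conj_ofReal]

theorem smooth_nabla_s : ContDiffOn ℝ ∞ (nabla P s) U :=
  smooth_nabla R.isOpen R.smooth_P R.smooth_s

theorem pd_nabla_s (hx : x ∈ U) : pd 2 (nabla P s) x = 0 ∧ pd 3 (nabla P s) x = 0 :=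
  ⟨pd_nabla_zero R.isOpen R.smooth_P R.smooth_s R.P_r R.s_r hx,
    pd_nabla_zero R.isOpen R.smooth_P R.smooth_s R.P_u (fun _ hy => R.s_u hy) hx⟩

/-- This component and the mm̄ one involve derivatives of H only in r. The explicit H satisfies
these equations; for the converse they are solved. -/
theorem ricci_kl_eq (hx : x ∈ U) :
    frameRicci (canonicalFrame P s L W H) (reducedCoefs P s L W H).γ 3 2 x
      = -H x * (divg s x - divgBar s x) ^ 2
        + Complex.I * divg s x * divgBar s x * (divg s x - divgBar s x) * (nabla P s x : ℂ)
        + (divg s x + divgBar s x) * pd 2 (fun y => (H y : ℂ)) x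
        + pd 2 (pd 2 (fun y => (H y : ℂ))) x := by
  have h : dd (canonicalFrame P s L W H 3) (fun y => (H y : ℂ)) = pd 2 (fun y => (H y : ℂ)) :=
    funext fun y => dd_canonical_k P s L W H _ y
  rw [ricci_kl]
  simp only [reducedCoefs]
  rw [R.l_divg hx, R.l_divgBar hx, h, dd_canonical_k]
  ring

theorem ricci_mmb_eq (hx : x ∈ U) :
    frameRicci (canonicalFrame P s L W H) (reducedCoefs P s L W H).γ 0 1 x
      = 2 * divg s x * divgBar s x * (nabla P (logP P) x : ℂ)
        + Complex.I * divg s x * divgBar s x * (divg s x - divgBar s x) * (nabla P s x : ℂ)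
        - H x * (divg s x ^ 2 + divgBar s x ^ 2)
        - pd 2 (fun y => (H y : ℂ)) x * (divg s x + divgBar s x) := by
  have hU := R.isOpen
  have d := fun {f : Pt → ℂ} (hf : ContDiffOn ℝ ∞ f U) => differentiableAt_of_smooth hU hf hx
  have sH := smooth_ofReal R.smooth_H
  have sN := smooth_ofReal R.smooth_nabla_s
  have hμ : dd (canonicalFrame P s L W H 3) (reducedCoefs P s L W H).μb x
      = -pd 2 (fun y => (H y : ℂ)) x * divgBar s x + H x * divgBar s x ^ 2
        + Complex.I * divg s x * divgBar s x * (divg s x + divgBar s x) * (nabla P s x : ℂ) := by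
    have e1 : (reducedCoefs P s L W H).μb = fun y => -((H y : ℂ) * divgBar s y)
        - Complex.I * (divg s y * (divgBar s y * (nabla P s y : ℂ))) := by
      funext y; simp only [reducedCoefs]; ring
    have s1 := R.smooth_divgBar.mul sN
    have s2 := R.smooth_divg.mul s1
    have s3 := (contDiffOn_const (c := Complex.I)).mul s2
    have s4 := sH.mul R.smooth_divgBar
    rw [e1, dd_sub (d s4.neg) (d s3), dd_neg, dd_mul (d sH) (d R.smooth_divgBar),
      dd_mul (differentiableAt_const _) (d s2), dd_mul (d R.smooth_divg) (d s1),
      dd_mul (d R.smooth_divgBar) (d sN), dd_const, R.k_divg hx, R.k_divgBar hx, dd_canonical_k,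
      dd_canonical_k, pd_ofReal 2 (differentiableAt_of_smooth hU R.smooth_nabla_s hx),
      (R.pd_nabla_s hx).1]
    simp only [Complex.ofReal_zero]
    ring
  rw [ricci_mmb, R.dd_ab hx, R.dd_a hx, hμ]
  have hP : ∀ i, pd i (fun y => (P y : ℂ)) x = ((pd i P x : ℝ) : ℂ) := fun i =>
    pd_ofReal i (differentiableAt_of_smooth hU R.smooth_P hx)
  simp only [reducedCoefs, scale, scaleBar, dz, dzbar, hP]
  rw [R.l_divg hx, dd_canonical_k, nabla_logP hU R.smooth_P R.P_pos hx]
  push_cast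
  linear_combination (1 / 2) * divg s x * divgBar s x * ((pd 1 P x : ℝ) : ℂ) ^ 2 * Complex.I_sq

end IsReducedData

/-! ### The vacuum equations in terms of `m + iM` -/

/-- The complex mass `m + iM`, `M = 2Σ∇(ln P) + ∇Σ`. -/
def complexMass (P s m : Pt → ℝ) (y : Pt) : ℂ :=
  (m y : ℂ) + Complex.I * (((2 * s y * nabla P (logP P) y + nabla P s y : ℝ)) : ℂ)

/-- `H = ∇(ln P) - Re (ρ (m + iM))` -/
structure IsMassData (U : Set Pt) (P s : Pt → ℝ) (L W : Pt → ℂ) (H m : Pt → ℝ) : Prop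
    extends IsReducedData U P s L W H where
  smooth_m : ContDiffOn ℝ ∞ m U
  m_r : ∀ x ∈ U, pd 2 m x = 0
  H_eq : ∀ x ∈ U, H x = nabla P (logP P) x
    - (m x * rCoord x + (2 * s x * nabla P (logP P) x + nabla P s x) * s x)
      / (rCoord x ^ 2 + s x ^ 2)

namespace IsMassData

variable {U : Set Pt} {P s : Pt → ℝ} {L W : Pt → ℂ} {H m : Pt → ℝ}
  (R : IsMassData U P s L W H m) {x : Pt}
include R

/-- With Z = m + iM, H is real-affine in Z and polynomial in ρ and ρ̄, whose derivatives are known;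
the remaining Ricci components become algebra in these variables. -/
theorem H_eq_complex (hx : x ∈ U) : (H x : ℂ) = (nabla P (logP P) x : ℂ)
    - (1 / 2) * (divg s x * complexMass P s m x + divgBar s x * star (complexMass P s m x)) := by
  have h1 := R.divg_mul hx
  have h2 := R.divgBar_mul hx
  have h3 : (rCoord x ^ 2 + s x ^ 2 : ℂ) ≠ 0 := by exact_mod_cast R.regular x hx
  rw [R.H_eq x hx]
  simp only [complexMass, star_add, star_mul', RCLike.star_def, Complex.conj_ofReal,
    Complex.conj_I]
  push_cast
  rw [sub_right_inj, div_eq_iff h3]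
  set M : ℂ := 2 * (s x : ℂ) * (nabla P (logP P) x : ℂ) + (nabla P s x : ℂ)
  have h4 : (rCoord x ^ 2 + s x ^ 2 : ℂ) = ((rCoord x : ℂ) + Complex.I * (s x : ℂ))
      * ((rCoord x : ℂ) - Complex.I * (s x : ℂ)) := by
    linear_combination (s x : ℂ) ^ 2 * Complex.I_sq
  rw [h4]
  linear_combination (-1 / 2) * ((rCoord x : ℂ) - Complex.I * (s x : ℂ))
      * ((m x : ℂ) + Complex.I * M) * h1
    + (-1 / 2) * ((rCoord x : ℂ) + Complex.I * (s x : ℂ)) * ((m x : ℂ) - Complex.I * M) * h2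
    + (s x : ℂ) * M * Complex.I_sq

/-- `iρ\barρ∇Σ` in terms of the mass -/
theorem nabla_s_eq (hx : x ∈ U) : Complex.I * divg s x * divgBar s x * (nabla P s x : ℂ)
    = (1 / 2) * divg s x * divgBar s x * (complexMass P s m x - star (complexMass P s m x))
      - (nabla P (logP P) x : ℂ) * (divgBar s x - divg s x) := by
  simp only [complexMass, star_add, star_mul', RCLike.star_def, Complex.conj_ofReal,
    Complex.conj_I]
  push_cast
  linear_combination -(nabla P (logP P) x : ℂ) * R.twist_divg hx

theorem smooth_logNabla : ContDiffOn ℝ ∞ (nabla P (logP P)) U :=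
  smooth_nabla R.isOpen R.smooth_P (smooth_logP R.smooth_P R.P_pos)

theorem pd_logNabla (hx : x ∈ U) : pd 2 (nabla P (logP P)) x = 0 ∧ pd 3 (nabla P (logP P)) x = 0 :=
  ⟨pd_nabla_zero R.isOpen R.smooth_P (smooth_logP R.smooth_P R.P_pos) R.P_r
      (fun _ hy => pd_logP_zero R.isOpen R.smooth_P R.P_pos hy (R.P_r _ hy)) hx,
    pd_nabla_zero R.isOpen R.smooth_P (smooth_logP R.smooth_P R.P_pos) R.P_u
      (fun _ hy => pd_logP_zero R.isOpen R.smooth_P R.P_pos hy (R.P_u _ hy)) hx⟩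

theorem smooth_M : ContDiffOn ℝ ∞ (fun y => 2 * s y * nabla P (logP P) y + nabla P s y) U :=
  ((contDiffOn_const.mul R.smooth_s).mul R.smooth_logNabla).add R.smooth_nabla_s

theorem pd_M (hx : x ∈ U) (i : Fin 4) (hs : pd i s x = 0) (hk : pd i (nabla P (logP P)) x = 0)
    (hn : pd i (nabla P s) x = 0) :
    pd i (fun y => 2 * s y * nabla P (logP P) y + nabla P s y) x = 0 := by
  have d := fun {f : Pt → ℝ} (hf : ContDiffOn ℝ ∞ f U) => differentiableAt_of_smooth R.isOpen hf hx
  have s1 := (contDiffOn_const (c := (2 : ℝ))).mul R.smooth_s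
  rw [pd_add i (d (s1.mul R.smooth_logNabla)) (d R.smooth_nabla_s), pd_mul i (d s1)
      (d R.smooth_logNabla),
    pd_mul i (differentiableAt_const _) (d R.smooth_s), pd_const, hs, hk, hn]
  ring

theorem smooth_mass : ContDiffOn ℝ ∞ (complexMass P s m) U :=
  (smooth_ofReal R.smooth_m).add (contDiffOn_const.mul (smooth_ofReal R.smooth_M))

theorem pd_mass (hx : x ∈ U) (i : Fin 4)
    (hM : pd i (fun y => 2 * s y * nabla P (logP P) y + nabla P s y) x = 0) :
    pd i (complexMass P s m) x = ((pd i m x : ℝ) : ℂ) := by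
  have d := fun {f : Pt → ℝ} (hf : ContDiffOn ℝ ∞ f U) => differentiableAt_of_smooth R.isOpen hf hx
  have dM := differentiableAt_of_smooth R.isOpen (smooth_ofReal R.smooth_M) hx
  refine (pd_add i (differentiableAt_of_smooth R.isOpen (smooth_ofReal R.smooth_m) hx)
    ((differentiableAt_const _).fun_mul dM)).trans ?_
  rw [pd_mul i (differentiableAt_const _) dM, pd_const, pd_ofReal i (d R.smooth_m),
    pd_ofReal i (d R.smooth_M), hM]
  simp

theorem mass_r (hx : x ∈ U) : pd 2 (complexMass P s m) x = 0 := by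
  rw [R.pd_mass hx 2 (R.pd_M hx 2 (R.s_r x hx) (R.pd_logNabla hx).1 (R.pd_nabla_s hx).1),
      R.m_r x hx,
    Complex.ofReal_zero]

theorem mass_u (hx : x ∈ U) : pd 3 (complexMass P s m) x = ((pd 3 m x : ℝ) : ℂ) :=
  R.pd_mass hx 3 (R.pd_M hx 3 (R.s_u hx) (R.pd_logNabla hx).2 (R.pd_nabla_s hx).2)

theorem pd_H (hx : x ∈ U) : pd 2 (fun y => (H y : ℂ)) x
    = (1 / 2) * (divg s x ^ 2 * complexMass P s m x
      + divgBar s x ^ 2 * star (complexMass P s m x)) := by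
  have hU := R.isOpen
  have d := fun {f : Pt → ℂ} (hf : ContDiffOn ℝ ∞ f U) => differentiableAt_of_smooth hU hf hx
  have sk := smooth_ofReal R.smooth_logNabla
  have s1 := R.smooth_divg.mul R.smooth_mass
  have s2 := R.smooth_divgBar.mul (smooth_star R.smooth_mass)
  rw [pd_congr hU (fun y hy => R.H_eq_complex hy) hx,
    pd_sub 2 (d sk) (d (contDiffOn_const.mul (s1.add s2))),
    pd_mul 2 (differentiableAt_const _) (d (s1.add s2)), pd_add 2 (d s1) (d s2),
    pd_mul 2 (d R.smooth_divg) (d R.smooth_mass),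
    pd_mul 2 (d R.smooth_divgBar) (d (smooth_star R.smooth_mass)), pd_const, pd_star, R.mass_r hx,
    pd_ofReal 2 (differentiableAt_of_smooth hU R.smooth_logNabla hx), (R.pd_logNabla hx).1,
    R.pd_divg hx, R.pd_divgBar hx, R.s_r x hx]
  simp
  ring

theorem pd_pd_H (hx : x ∈ U) : pd 2 (pd 2 (fun y => (H y : ℂ))) x
    = -(divg s x ^ 3 * complexMass P s m x + divgBar s x ^ 3 * star (complexMass P s m x)) := by
  have hU := R.isOpen
  have d := fun {f : Pt → ℂ} (hf : ContDiffOn ℝ ∞ f U) => differentiableAt_of_smooth hU hf hx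
  have s1 := R.smooth_divg.mul R.smooth_mass
  have s2 := R.smooth_divgBar.mul (smooth_star R.smooth_mass)
  have s3 := R.smooth_divg.mul s1
  have s4 := R.smooth_divgBar.mul s2
  have h : ∀ y ∈ U, pd 2 (fun y => (H y : ℂ)) y
      = (1 / 2) * (divg s y * (divg s y * complexMass P s m y)
      + divgBar s y * (divgBar s y * star (complexMass P s m y))) := fun y hy => by
    rw [R.pd_H hy]; ring
  rw [pd_congr hU h hx,
    pd_mul 2 (differentiableAt_const _) (d (s3.add s4)), pd_add 2 (d s3) (d s4),
    pd_mul 2 (d R.smooth_divg) (d s1), pd_mul 2 (d R.smooth_divgBar) (d s2),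
    pd_mul 2 (d R.smooth_divg) (d R.smooth_mass),
    pd_mul 2 (d R.smooth_divgBar) (d (smooth_star R.smooth_mass)), pd_const, pd_star, R.mass_r hx,
    R.pd_divg hx, R.pd_divgBar hx, R.s_r x hx]
  simp
  ring

/-- No field equation for m is needed: the form of H and the definition of M already make this
component, and likewise the mm̄ one, vanish. -/
theorem ricci_kl_zero (hx : x ∈ U) :
    frameRicci (canonicalFrame P s L W H) (reducedCoefs P s L W H).γ 3 2 x = 0 := by
  rw [R.ricci_kl_eq hx, R.pd_H hx, R.pd_pd_H hx, R.H_eq_complex hx]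
  linear_combination (divg s x - divgBar s x) * R.nabla_s_eq hx

theorem ricci_mmb_zero (hx : x ∈ U) :
    frameRicci (canonicalFrame P s L W H) (reducedCoefs P s L W H).γ 0 1 x = 0 := by
  rw [R.ricci_mmb_eq hx, R.pd_H hx, R.H_eq_complex hx]
  linear_combination (divg s x - divgBar s x) * R.nabla_s_eq hx

theorem ν_eq (hx : x ∈ U) : (reducedCoefs P s L W H).ν x
    = (1 / 2) * (divg s x ^ 2 * complexMass P s m x
    - divgBar s x ^ 2 * star (complexMass P s m x)) := by
  simp only [reducedCoefs]
  rw [R.H_eq_complex hx]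
  linear_combination R.nabla_s_eq hx

theorem μ_eq (hx : x ∈ U) : (reducedCoefs P s L W H).μ x
    = (1 / 2) * (divg s x ^ 2 + divg s x * divgBar s x) * complexMass P s m x
      - divgBar s x * (nabla P (logP P) x : ℂ) := by
  simp only [reducedCoefs]
  rw [R.H_eq_complex hx]
  linear_combination R.nabla_s_eq hx

/-- After Dδ is commuted on H the terms assemble to δ(ν + DH), and ν + DH = ρ²(m + iM) while δρ = 0.
So this vacuum equation is δ(m + iM) = 0, the source of cL = (A + iM)_ζ. -/
theorem ricci_ml_eq (hx : x ∈ U) :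
    frameRicci (canonicalFrame P s L W H) (reducedCoefs P s L W H).γ 0 2 x
      = divg s x ^ 2 * dd (canonicalFrame P s L W H 0) (complexMass P s m) x := by
  have hU := R.isOpen
  have F := R.isNullFrame
  have d := fun {f : Pt → ℂ} (hf : ContDiffOn ℝ ∞ f U) => differentiableAt_of_smooth hU hf hx
  have sH := smooth_ofReal R.smooth_H
  set e := canonicalFrame P s L W H with he
  have h1 : dd (e 2) (reducedCoefs P s L W H).a x
      = H x * divgBar s x * (reducedCoefs P s L W H).a x := by
    have sP := smooth_ofReal R.smooth_P
    refine (dd_mul (d R.smooth_divgBar) (d (smooth_dz hU sP))).trans ?_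
    rw [R.l_divgBar hx, dd_l_of_pd_eq_zero (pd_dz_zero hU sP (fun y hy => (R.pd_P hy).1) hx),
      pd_dz_zero hU sP (fun y hy => (R.pd_P hy).2) hx]
    simp only [reducedCoefs]
    ring
  have h2 := F.dd_comm_k_m hx sH
  have h3 : dd (e 0) (reducedCoefs P s L W H).ν x + dd (e 0) (dd (e 3) fun y => (H y : ℂ)) x
      = divg s x ^ 2 * dd (e 0) (complexMass P s m) x := by
    refine (dd_add (d F.smooth_ν) (d F.smooth_q)).symm.trans ?_
    have h : ∀ y ∈ U, (reducedCoefs P s L W H).ν y + dd (e 3) (fun y => (H y : ℂ)) y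
        = divg s y * (divg s y * complexMass P s m y) := by
      intro y hy
      rw [dd_canonical_k, R.pd_H hy, R.ν_eq hy]
      ring
    refine (dd_congr hU h hx).trans ?_
    rw [dd_mul (d R.smooth_divg) (d (R.smooth_divg.mul R.smooth_mass)),
      dd_mul (d R.smooth_divg) (d R.smooth_mass), R.m_divg hx]
    ring
  rw [ricci_ml, h1]
  simp only [reducedCoefs] at h2 h3 ⊢
  linear_combination h2 + h3

/-- `δ\bar δ - a\bar δ` applied to `H` -/
theorem dd_jb (hδ : ∀ y ∈ U, dd (canonicalFrame P s L W H 0) (complexMass P s m) y = 0)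
    (hx : x ∈ U) : dd (canonicalFrame P s L W H 0) (reducedCoefs P s L W H).jb x
      - (reducedCoefs P s L W H).a x * (reducedCoefs P s L W H).jb x
      = divg s x * divgBar s x * (nabla P (nabla P (logP P)) x : ℂ)
        - (1 / 2) * (complexMass P s m x * (-2 * divg s x ^ 2
            * ((1 / 2) * divg s x * divgBar s x * (complexMass P s m x - star (complexMass P s m x))
              - (nabla P (logP P) x : ℂ) * (divgBar s x - divg s x)))
          + divg s x * ((divgBar s x - divg s x) * ((pd 3 m x : ℝ) : ℂ))) := by
  have hU := R.isOpen
  have F := R.isNullFrame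
  have d := fun {f : Pt → ℂ} (hf : ContDiffOn ℝ ∞ f U) {y : Pt} (hy : y ∈ U) =>
    differentiableAt_of_smooth hU hf hy
  have sk := smooth_ofReal R.smooth_logNabla
  have sρ := R.smooth_divg
  have sρb := R.smooth_divgBar
  have sZ := R.smooth_mass
  have hδb : ∀ y ∈ U, dd (canonicalFrame P s L W H 1) (fun z => star (complexMass P s m z)) y = 0 :=
    fun y hy => by rw [F.dd_conj_m hy fun z _ => rfl, hδ y hy, star_zero]
  set e := canonicalFrame P s L W H with he
  set Z := complexMass P s m with hZ
  have sρ1 := smooth_dd hU (F.smooth 1) sρ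
  have sZ1 := smooth_dd hU (F.smooth 1) sZ
  have hk : ∀ y ∈ U, dd (e 1) (fun z => (nabla P (logP P) z : ℂ)) y
      = P y * (divg s y * dzbar (fun z => (nabla P (logP P) z : ℂ)) y) := by
    intro y hy
    have hr : ∀ i, pd i (nabla P (logP P)) y = 0
        → pd i (fun z => (nabla P (logP P) z : ℂ)) y = 0 := fun i hi => by
      rw [pd_ofReal i (differentiableAt_of_smooth hU R.smooth_logNabla hy), hi, Complex.ofReal_zero]
    rw [dd_mb_of_pd_eq_zero (hr 2 (R.pd_logNabla hy).1) (hr 3 (R.pd_logNabla hy).2), scaleBar]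
    ring
  -- In δ̄H the conjugate half of the mass term drops out, because δ̄ annihilates both ρ̄ and the
  -- conjugate of m + iM.
  have hjb : ∀ y ∈ U, (reducedCoefs P s L W H).jb y
      = P y * (divg s y * dzbar (fun z => (nabla P (logP P) z : ℂ)) y)
        - (1 / 2) * (dd (e 1) (divg s) y * Z y + divg s y * dd (e 1) Z y) := by
    intro y hy
    change dd (e 1) (fun z => (H z : ℂ)) y = _
    have s1 := sρ.mul sZ
    have s2 := sρb.mul (smooth_star sZ)
    rw [dd_congr hU (fun z hz => R.H_eq_complex hz) hy,
      dd_sub (d sk hy) (d (contDiffOn_const.mul (s1.add s2)) hy),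
      dd_mul (differentiableAt_const _) (d (s1.add s2) hy), dd_add (d s1 hy) (d s2 hy),
      dd_mul (d sρ hy) (d sZ hy), dd_mul (d sρb hy) (d (smooth_star sZ) hy), dd_const, hδb y hy,
      R.mb_divgBar hy, hk y hy]
    ring
  -- Since δ annihilates ρ and m + iM, their second derivatives δδ̄ come entirely from the
  -- commutator [m, m̄].
  have hcρ : dd (e 0) (dd (e 1) (divg s)) x = (reducedCoefs P s L W H).a x * dd (e 1) (divg s) x
      - 2 * divg s x ^ 2 * (Complex.I * divg s x * divgBar s x * (nabla P s x : ℂ)) := by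
    have h0 : dd (e 1) (dd (e 0) (divg s)) x = 0 :=
      (dd_congr hU (fun y hy => R.m_divg hy) hx).trans (dd_const 0)
    rw [F.dd_comm_m_mb hx sρ, h0, R.m_divg hx, R.k_divg hx, R.l_divg hx]
    simp only [reducedCoefs]
    ring
  have hcZ : dd (e 0) (dd (e 1) Z) x = (reducedCoefs P s L W H).a x * dd (e 1) Z x
      + (divgBar s x - divg s x) * ((pd 3 m x : ℝ) : ℂ) := by
    have h0 : dd (e 1) (dd (e 0) Z) x = 0 := (dd_congr hU hδ hx).trans (dd_const 0)
    rw [F.dd_comm_m_mb hx sZ, h0, hδ x hx, dd_canonical_k, R.mass_r hx,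
      dd_l_of_pd_eq_zero (R.mass_r hx), R.mass_u hx]
    simp only [reducedCoefs]
    ring
  have sP := smooth_ofReal R.smooth_P
  have s3 := sρ.mul (smooth_dzbar hU sk)
  have s4 := sρ1.mul sZ
  have s5 := sρ.mul sZ1
  have h1 := R.dd_dd R.smooth_logNabla (fun y hy => (R.pd_logNabla hy).1)
    (fun y hy => (R.pd_logNabla hy).2) hx
  rw [hjb x hx, dd_congr hU hjb hx, dd_sub (d (sP.mul s3) hx)
      (d (contDiffOn_const.mul (s4.add s5)) hx), dd_mul (d sP hx) (d s3 hx), h1,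
    dd_mul (differentiableAt_const _) (d (s4.add s5) hx), dd_add (d s4 hx) (d s5 hx),
    dd_mul (d sρ1 hx) (d sZ hx), dd_mul (d sρ hx) (d sZ1 hx), dd_const, hcρ, hcZ, hδ x hx,
    R.m_divg hx, R.nabla_s_eq hx, dd_m_of_pd_eq_zero (R.pd_P hx).1 (R.pd_P hx).2,
    nabla.eq_1 P (nabla P (logP P)), ← hZ]
  simp only [reducedCoefs, scale]
  push_cast
  ring

/-- Up to sign the component is the sum of Δμ + μ(μ + q) - (δ - a)δ̄H and its conjugate. The terms
quadratic in m + iM cancel, and what remains is the equation m_u = ∇[∇(ln P)]. -/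
theorem ricci_ll_eq (hδ : ∀ y ∈ U, dd (canonicalFrame P s L W H 0) (complexMass P s m) y = 0)
    (hx : x ∈ U) :
    frameRicci (canonicalFrame P s L W H) (reducedCoefs P s L W H).γ 2 2 x
      = -2 * divg s x * divgBar s x
        * (((pd 3 m x : ℝ) : ℂ) - (nabla P (nabla P (logP P)) x : ℂ)) := by
  have hU := R.isOpen
  have F := R.isNullFrame
  have d := fun {f : Pt → ℂ} (hf : ContDiffOn ℝ ∞ f U) => differentiableAt_of_smooth hU hf hx
  have sk := smooth_ofReal R.smooth_logNabla
  have sρ := R.smooth_divg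
  have sρb := R.smooth_divgBar
  have sZ := R.smooth_mass
  have hjb := R.dd_jb hδ hx
  have hμ : dd (canonicalFrame P s L W H 2) (reducedCoefs P s L W H).μ x
      = (1 / 2) * (2 * divg s x ^ 3 * H x + divg s x ^ 2 * divgBar s x * H x
          + divg s x * divgBar s x ^ 2 * H x) * complexMass P s m x
        + (1 / 2) * (divg s x ^ 2 + divg s x * divgBar s x) * ((pd 3 m x : ℝ) : ℂ)
        - H x * divgBar s x ^ 2 * (nabla P (logP P) x : ℂ) := by
    have h : ∀ y ∈ U, (reducedCoefs P s L W H).μ y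
        = (1 / 2) * ((divg s y * (divg s y + divgBar s y)) * complexMass P s m y)
          - divgBar s y * (nabla P (logP P) y : ℂ) := fun y hy => by rw [R.μ_eq hy]; ring
    have s1 := sρ.mul (sρ.add sρb)
    have s2 := s1.mul sZ
    have hk : ∀ i, pd i (nabla P (logP P)) x = 0
        → pd i (fun z => (nabla P (logP P) z : ℂ)) x = 0 := fun i hi => by
      rw [pd_ofReal i (differentiableAt_of_smooth hU R.smooth_logNabla hx), hi, Complex.ofReal_zero]
    rw [dd_congr hU h hx, dd_sub (d (contDiffOn_const.mul s2)) (d (sρb.mul sk)),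
      dd_mul (differentiableAt_const _) (d s2), dd_mul (d s1) (d sZ),
      dd_mul (d sρ) (d (sρ.add sρb)), dd_add (d sρ) (d sρb), dd_mul (d sρb) (d sk), dd_const,
      R.l_divg hx, R.l_divgBar hx, dd_l_of_pd_eq_zero (R.mass_r hx), R.mass_u hx,
      dd_l_of_pd_eq_zero (hk 2 (R.pd_logNabla hx).1), hk 3 (R.pd_logNabla hx).2]
    ring
  have hμb := F.dd_conj_l hx fun y hy => F.conj_μ y hy
  have hj : ∀ y ∈ U, (reducedCoefs P s L W H).j y = star ((reducedCoefs P s L W H).jb y) :=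
    fun y hy => by rw [F.conj_j y hy, star_star]
  have hjb' := F.dd_conj_m hx hj
  have hq : (reducedCoefs P s L W H).q x = pd 2 (fun y => (H y : ℂ)) x :=
      dd_canonical_k _ _ _ _ _ _ _
  have hb : dd (canonicalFrame P s L W H 1) (reducedCoefs P s L W H).j x
      - (reducedCoefs P s L W H).ab x * (reducedCoefs P s L W H).j x
      = star (divg s x * divgBar s x * (nabla P (nabla P (logP P)) x : ℂ)
        - (1 / 2) * (complexMass P s m x * (-2 * divg s x ^ 2
            * ((1 / 2) * divg s x * divgBar s x * (complexMass P s m x - star (complexMass P s m x))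
              - (nabla P (logP P) x : ℂ) * (divgBar s x - divg s x)))
          + divg s x * ((divgBar s x - divg s x) * ((pd 3 m x : ℝ) : ℂ)))) := by
    rw [hjb', F.conj_a x hx, hj x hx, ← hjb, star_sub, star_mul']
  have hT : (reducedCoefs P s L W H).T x = 0 ∧ (reducedCoefs P s L W H).Tb x = 0 := ⟨rfl, rfl⟩
  rw [ricci_ll, hT.1, hT.2, hμb, F.conj_μ x hx, hμ, hq, R.pd_H hx, R.μ_eq hx]
  have c1 : starRingEnd ℂ (divg s x) = divgBar s x := star_divg s x
  have c2 : starRingEnd ℂ (divgBar s x) = divg s x := star_divgBar s x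
  simp only [star_add, star_sub, star_mul', star_neg, star_pow, RCLike.star_def, c1, c2,
    Complex.conj_ofReal, map_div₀, map_one, map_ofNat, Complex.conj_conj] at hb ⊢
  have hH := R.H_eq_complex hx
  rw [RCLike.star_def] at hH
  rw [hH]
  rw [RCLike.star_def] at hjb
  linear_combination hjb + hb

end IsMassData

/-! ### Quasi-stationary metrics -/

/-- Here h = H, because ∂_u = l + Hk, and μ + μ̄ = -H(ρ + ρ̄) is read off from `reducedCoefs`.
Nothing is required of the u-dependence of H. -/
theorem IsReducedData.split {U : Set Pt} {P s : Pt → ℝ} {L W : Pt → ℂ} {H : Pt → ℝ}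
    (R : IsReducedData U P s L W H)
    (hv : ∀ y ∈ U, ∀ a b, ricci (canonicalMetric P s L W H) a b y = 0) (m₀ : ℝ) :
    IsAlgSpecialVacuum U (splitMetric (canonicalMetric P s L W H) kRay rCoord s m₀) kRay ∧
      IsDiverging U (splitMetric (canonicalMetric P s L W H) kRay rCoord s m₀) kRay rCoord s := by
  have F := R.isNullFrame
  have hk : ∀ y ∈ U, canonicalFrame P s L W H 3 y = cvec (kRay y) := fun _ _ => rfl
  have hg : ∀ y ∈ U, ∀ a b, splitMetric (canonicalMetric P s L W H) kRay rCoord s m₀ y a b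
      = canonicalMetric P s L W H y a b + 2 * (m₀ * ((reducedCoefs P s L W H).ρ y).re)
        * (lower (canonicalMetric P s L W H) kRay y a
          * lower (canonicalMetric P s L W H) kRay y b) :=
    fun y hy => splitMetric_eq (R.divg_mul hy)
  have F' := (F.split hk hg).1
  refine ⟨IsAlgSpecialVacuum.of_frames contDiffOn_const fun x hx => ⟨U, _, _, hx, F', hk,
    fun _ _ => rfl, fun y hy => F.split_vacuum hk hg hv (fun _ _ => rfl)
      (h := fun y => (H y : ℂ)) (fun y hy => ⟨R.l_divg hy, R.l_divgBar hy⟩) (fun y hy => ?_) hy⟩,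
    fun x hx => F'.divergence_eq hx hk (R.divg_mul hx)⟩
  simp only [reducedCoefs]
  ring

theorem IsReducedData.algSpecial {U : Set Pt} {P s : Pt → ℝ} {L W : Pt → ℂ} {H : Pt → ℝ}
    (R : IsReducedData U P s L W H)
    (hv : ∀ y ∈ U, ∀ a b, ricci (canonicalMetric P s L W H) a b y = 0) :
    IsAlgSpecialVacuum U (canonicalMetric P s L W H) kRay ∧
      IsDiverging U (canonicalMetric P s L W H) kRay rCoord s :=
  ⟨IsAlgSpecialVacuum.of_frames contDiffOn_const fun _ hx =>
    ⟨U, _, _, hx, R.isNullFrame, fun _ _ => rfl, fun _ _ => rfl, hv⟩,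
    fun _ hx => R.isNullFrame.divergence_eq hx (fun _ _ => rfl) (R.divg_mul hx)⟩

theorem IsMassData.vacuum {U : Set Pt} {P s : Pt → ℝ} {L W : Pt → ℂ} {H m : Pt → ℝ}
    (R : IsMassData U P s L W H m)
    (hδ : ∀ y ∈ U, dd (canonicalFrame P s L W H 0) (complexMass P s m) y = 0)
    (hu : ∀ y ∈ U, pd 3 m y = nabla P (nabla P (logP P)) y) {x : Pt} (hx : x ∈ U)
    (a b : Fin 4) : ricci (canonicalMetric P s L W H) a b x = 0 := by
  refine R.isNullFrame.vacuum hx (R.ricci_kk_eq hx) (R.ricci_km_eq hx) (R.ricci_kl_zero hx)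
    (R.ricci_mmb_zero hx) ?_ ?_ a b
  · rw [R.ricci_ml_eq hx, hδ x hx, mul_zero]
  · rw [R.ricci_ll_eq hδ hx, hu x hx, sub_self, mul_zero]

theorem smooth_coord (i : Fin 4) {U : Set Pt} : ContDiffOn ℝ ∞ (fun y : Pt => y i) U :=
  (contDiff_apply ℝ ℝ i).contDiffOn

theorem pd_coord (i j : Fin 4) (x : Pt) : pd i (fun y : Pt => y j) x = if i = j then 1 else 0 := by
  have h : HasFDerivAt (fun y : Pt => y j) _ x := hasFDerivAt_apply (𝕜 := ℝ) j x
  rw [pd, h.fderiv]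
  simp [Pi.single_apply, eq_comm]

theorem smooth_massOf {U : Set Pt} {A : Pt → ℝ} (sA : ContDiffOn ℝ ∞ A U) (c : ℝ) :
    ContDiffOn ℝ ∞ (massOf A c) U := (contDiffOn_const.mul (smooth_coord 3)).add sA

theorem pd_massOf {A : Pt → ℝ} {x : Pt} (dA : DifferentiableAt ℝ A x) (c : ℝ) (i : Fin 4) :
    pd i (massOf A c) x = c * (if i = 3 then 1 else 0) + pd i A x := by
  have d3 : DifferentiableAt ℝ (fun y : Pt => y 3) x :=
    differentiableAt_of_smooth isOpen_univ (smooth_coord 3) trivial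
  refine (pd_add i ((differentiableAt_const c).fun_mul d3) dA).trans ?_
  rw [pd_mul i (differentiableAt_const c) d3, pd_const, pd_coord]
  ring

namespace IsQuasiStationary

variable {U : Set Pt} {P : Pt → ℝ} {L : Pt → ℂ} {A : Pt → ℝ} {c : ℝ}
  (Q : IsQuasiStationary U P L A c)
include Q

theorem massData (hU : IsOpen U) :
    IsMassData U P (sigmaOf P L) L (WOf P L) (HOf P L A c) (massOf A c) := by
  have ss := smooth_sigmaOf hU Q.smooth_P Q.smooth_L
  have sk := smooth_nabla hU Q.smooth_P (smooth_logP Q.smooth_P Q.P_pos)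
  have sM : ContDiffOn ℝ ∞ (MOf P L) U :=
    ((contDiffOn_const.mul ss).mul sk).add (smooth_nabla hU Q.smooth_P ss)
  have sm := smooth_massOf Q.smooth_A c
  have hs := fun i (hP : ∀ y ∈ U, pd i P y = 0) (hL : ∀ y ∈ U, pd i L y = 0) y (hy : y ∈ U) =>
    pd_sigmaOf_zero hU Q.smooth_P Q.smooth_L hP hL hy
  have sdz := smooth_dz hU (smooth_ofReal ss)
  refine
    { isOpen := hU
      smooth_P := Q.smooth_P
      smooth_s := ss
      smooth_L := Q.smooth_L
      smooth_W := contDiffOn_const.mul sdz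
      smooth_H := sk.sub (((sm.mul smooth_rCoord).add (sM.mul ss)).div
        ((smooth_rCoord.pow 2).add (ss.pow 2)) Q.regular)
      P_pos := Q.P_pos
      regular := Q.regular
      P_r := Q.P_r
      L_r := Q.L_r
      W_r := fun x hx => ?_
      s_r := hs 2 Q.P_r Q.L_r
      s_eq := fun _ _ => rfl
      P_u := Q.P_u
      L_u := Q.L_u
      W_eq := fun _ _ => rfl
      smooth_m := sm
      m_r := fun x hx => ?_
      H_eq := fun _ _ => rfl }
  · refine (pd_mul 2 (differentiableAt_const _) (differentiableAt_of_smooth hU sdz hx)).trans ?_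
    rw [pd_const, pd_dz_zero hU (smooth_ofReal ss) (fun y hy => ?_) hx, Q.L_u x hx]
    · simp
    · rw [pd_ofReal 2 (differentiableAt_of_smooth hU ss hy), hs 2 Q.P_r Q.L_r y hy,
        Complex.ofReal_zero]
  · rw [pd_massOf (differentiableAt_of_smooth hU Q.smooth_A hx), Q.A_r x hx]
    simp

/-- Since m = cu + A, δ(m + iM) is a multiple of (A + iM)_ζ - cL. -/
theorem dd_mass (hU : IsOpen U) {x : Pt} (hx : x ∈ U) :
    dd (canonicalFrame P (sigmaOf P L) L (WOf P L) (HOf P L A c) 0)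
      (complexMass P (sigmaOf P L) (massOf A c)) x = 0 := by
  have R := Q.massData hU
  have dA := differentiableAt_of_smooth hU Q.smooth_A hx
  have sM := smooth_ofReal R.smooth_M
  have h1 : ∀ i, i ≠ 3 → pd i (complexMass P (sigmaOf P L) (massOf A c)) x
      = pd i (fun y => (A y : ℂ) + Complex.I * (MOf P L y : ℂ)) x := by
    intro i hi
    have dM := (differentiableAt_const Complex.I).fun_mul (differentiableAt_of_smooth hU sM hx)
    have h := pd_ofReal i (differentiableAt_of_smooth hU R.smooth_m hx)
    rw [pd_massOf dA, if_neg hi, mul_zero, zero_add, ← pd_ofReal i dA] at h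
    refine (pd_add i (differentiableAt_of_smooth hU (smooth_ofReal R.smooth_m) hx) dM).trans ?_
    rw [h]
    exact (pd_add i (differentiableAt_of_smooth hU (smooth_ofReal Q.smooth_A) hx) dM).symm
  have h2 := Q.eq_L x hx
  rw [dz, ← h1 0 (by decide), ← h1 1 (by decide)] at h2
  rw [dd_canonical_m, R.mass_r hx, R.mass_u hx, pd_massOf dA, Q.A_u x hx, dz, ← h2]
  simp
  ring_nf
  simp

theorem vacuum (hU : IsOpen U) {x : Pt} (hx : x ∈ U) (a b : Fin 4) :
    ricci (quasiMetric P L A c) a b x = 0 := by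
  refine (Q.massData hU).vacuum (fun y hy => Q.dd_mass hU hy) (fun y hy => ?_) hx a b
  rw [pd_massOf (differentiableAt_of_smooth hU Q.smooth_A hy), Q.A_u y hy, Q.eq_P y hy]
  simp

theorem add_const (m₀ : ℝ) : IsQuasiStationary U P L (fun x => A x + m₀) c :=
  { Q with
    smooth_A := Q.smooth_A.add contDiffOn_const
    A_r := fun x hx => by
      rw [← Q.A_r x hx, pd, pd, fderiv_add_const]
    A_u := fun x hx => by
      rw [← Q.A_u x hx, pd, pd, fderiv_add_const]
    eq_L := fun x hx => by
      have h : (fun y => ((A y + m₀ : ℝ) : ℂ) + Complex.I * (MOf P L y : ℂ))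
          = fun y => (A y : ℂ) + Complex.I * (MOf P L y : ℂ) + m₀ := by
        funext y; push_cast; ring
      rw [Q.eq_L x hx, h]
      simp only [dz, pd, fderiv_add_const] }

end IsQuasiStationary

theorem lower_kRay (P s : Pt → ℝ) (L W : Pt → ℂ) (H : Pt → ℝ) (x : Pt) (a : Fin 4) :
    lower (canonicalMetric P s L W H) kRay x a = -omega3 L x a := by
  simp [lower, kRay, Pi.single_apply, canonicalMetric_r]

/-- H enters the metric as -2H (ω³)² and contains -mr/(r² + Σ²), while the 1-form k is -ω³; raising
m by m₀ therefore adds precisely the split term. -/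
theorem splitMetric_quasiMetric (P : Pt → ℝ) (L : Pt → ℂ) (A : Pt → ℝ) (c m₀ : ℝ) (x : Pt) :
    splitMetric (quasiMetric P L A c) kRay rCoord (sigmaOf P L) m₀ x
      = quasiMetric P L (fun x => A x + m₀) c x := by
  ext a b
  rw [splitMetric, Matrix.of_apply, quasiMetric, lower_kRay, lower_kRay]
  simp only [quasiMetric, canonicalMetric, Matrix.of_apply, omega4, HOf, massOf]
  ring

/-! ### Canonical metrics which split are quasi-stationary -/

section

variable {U : Set Pt} {P s : Pt → ℝ} {L W : Pt → ℂ} {H : Pt → ℝ} {m₀ : ℝ}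

/-- A canonical vacuum metric which splits has `L_u = 0`. -/
theorem IsCanonicalData.L_u_of_split (D : IsCanonicalData U P s L W H) (hm : m₀ ≠ 0)
    (hv : ∀ y ∈ U, ∀ a b, ricci (canonicalMetric P s L W H) a b y = 0)
    (hv' : ∀ y ∈ U, ∀ a b,
      ricci (splitMetric (canonicalMetric P s L W H) kRay rCoord s m₀) a b y = 0)
    {x : Pt} (hx : x ∈ U) : pd 3 L x = 0 := by
  have hU := D.isOpen
  have F := D.isNullFrame
  set e := canonicalFrame P s L W H
  set c := canonicalCoefs P s L W H with hc
  have hk : ∀ y ∈ U, e 3 y = cvec (kRay y) := fun _ _ => rfl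
  have hg : ∀ y ∈ U, ∀ a b, splitMetric (canonicalMetric P s L W H) kRay rCoord s m₀ y a b
      = canonicalMetric P s L W H y a b + 2 * (m₀ * (c.ρ y).re)
        * (lower (canonicalMetric P s L W H) kRay y a
          * lower (canonicalMetric P s L W H) kRay y b) :=
    fun y hy => splitMetric_eq (D.divg_mul hy)
  obtain ⟨F', hV⟩ := F.split hk hg
  have R := fun y hy => F.ricci_zero hy (hv y hy)
  have R' := fun y hy => F'.ricci_zero hy (hv' y hy)
  have sachs := fun y hy => F.sachs hy (R y hy 3 3)
  -- T = P L_u/(r - iΣ), where P and L_u do not depend on r.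
  have hTk : dd (e 3) c.T x = -(c.ρb x + c.F x) * c.T x := by
    refine (dd_canonical_k _ _ _ _ _ _ _).trans ?_
    refine (pd_mul 2 (differentiableAt_of_smooth hU D.smooth_scale hx)
      (differentiableAt_of_smooth hU (smooth_pd hU D.smooth_L 3) hx)).trans ?_
    rw [D.pd_scale_r hx, pd_pd_zero hU D.smooth_L D.L_r hx 3]
    simp only [hc, canonicalCoefs]
    ring
  have hδ : dd (e 0) c.ρ x = -c.T x * c.ρ x := by
    have := R x hx 3 0
    rw [ricci_km, hTk] at this
    linear_combination -this
  have ha : dd (e 3) c.a x = dd (e 0) c.F x - (c.ρb x + c.F x) * c.a x + c.F x * c.T x := by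
    have := R x hx 0 3
    rw [ricci_mk] at this
    linear_combination this
  have h := F.ks_ricci_ml hV sachs hx hTk hδ ha
  rw [R' x hx, R x hx] at h
  have hρ : c.ρ x ≠ 0 := D.divg_ne hx
  have hm' : (m₀ : ℂ) ≠ 0 := by exact_mod_cast hm
  -- Both metrics are vacuum, so the defect -6τTρ² vanishes, with τ = m₀/2.
  have h0 : (m₀ : ℂ) * c.ρ x ^ 2 * c.T x = 0 := by linear_combination (1 / 3) * h
  have hT : c.T x = 0 := (mul_eq_zero.1 h0).resolve_left (mul_ne_zero hm' (pow_ne_zero 2 hρ))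
  exact (mul_eq_zero.1 hT).resolve_left (D.scale_ne hx)

/-- `Σ_u = 2 Σ P_u / P` -/
theorem IsCanonicalData.s_u_eq (D : IsCanonicalData U P s L W H) (hL : ∀ y ∈ U, pd 3 L y = 0)
    {x : Pt} (hx : x ∈ U) : P x * pd 3 s x = 2 * s x * pd 3 P x := by
  have hU := D.isOpen
  have s1 : ContDiffOn ℝ ∞ (fun _ : Pt => (1 : ℝ)) U := contDiffOn_const
  have dP := differentiableAt_of_smooth hU D.smooth_P hx
  have dS := differentiableAt_of_smooth hU (smooth_sigmaOf hU s1 D.smooth_L) hx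
  -- Σ/P² is built from L alone and is therefore independent of u.
  have h : ∀ y ∈ U, s y = P y * (P y * sigmaOf (fun _ => 1) L y) := by
    intro y hy
    rw [D.s_eq y hy, sigmaOf, sigmaOf]; ring
  rw [pd_congr hU h hx, pd_mul 3 dP (dP.fun_mul dS), pd_mul 3 dP dS,
    pd_sigmaOf_zero hU s1 D.smooth_L (fun _ _ => pd_const 3 _) hL hx, h x hx]
  ring

/-- A canonical vacuum metric which splits is independent of `u`, up to `H`. -/
theorem IsCanonicalData.isReducedData (D : IsCanonicalData U P s L W H) (hm : m₀ ≠ 0)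
    (hv : ∀ y ∈ U, ∀ a b, ricci (canonicalMetric P s L W H) a b y = 0)
    (hv' : ∀ y ∈ U, ∀ a b,
      ricci (splitMetric (canonicalMetric P s L W H) kRay rCoord s m₀) a b y = 0) :
    IsReducedData U P s L W H := by
  have hU := D.isOpen
  have F := D.isNullFrame
  have hL : ∀ y ∈ U, pd 3 L y = 0 := fun y hy => D.L_u_of_split hm hv hv' hy
  set e := canonicalFrame P s L W H with he
  set c := canonicalCoefs P s L W H with hc
  have hk : ∀ y ∈ U, e 3 y = cvec (kRay y) := fun _ _ => rfl
  have hg : ∀ y ∈ U, ∀ a b, splitMetric (canonicalMetric P s L W H) kRay rCoord s m₀ y a b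
      = canonicalMetric P s L W H y a b + 2 * (m₀ * (c.ρ y).re)
        * (lower (canonicalMetric P s L W H) kRay y a
          * lower (canonicalMetric P s L W H) kRay y b) :=
    fun y hy => splitMetric_eq (D.divg_mul hy)
  obtain ⟨F', hV⟩ := F.split hk hg
  have R := fun y hy => F.ricci_zero hy (hv y hy)
  have R' := fun y hy => F'.ricci_zero hy (hv' y hy)
  have sachs := fun y hy => F.sachs hy (R y hy 3 3)
  have hT : ∀ y ∈ U, c.T y = 0 := fun y hy => by
    change scale P s y * pd 3 L y = 0
    rw [hL y hy, mul_zero]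
  have hδ : ∀ y ∈ U, dd (e 0) c.ρ y = 0 := fun y hy => by
    have := R y hy 3 0
    rw [ricci_km, hT y hy, dd_congr hU hT hy, dd_const] at this
    linear_combination -this
  have P_u : ∀ x ∈ U, pd 3 P x = 0 := by
    intro x hx
    -- Both metrics are vacuum, so the ll defect vanishes. P_u enters it through μ + μ̄ and through
    -- Σ_u in Δρ.
    have h := F.ks_ricci_ll hV sachs hx hT hδ
    rw [R' x hx, R x hx] at h
    have hm' : (m₀ : ℂ) ≠ 0 := by exact_mod_cast hm
    have dP := differentiableAt_of_smooth hU D.smooth_P hx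
    have dPc := differentiableAt_of_smooth hU (smooth_ofReal D.smooth_P) hx
    have dρb := differentiableAt_of_smooth hU D.smooth_divgBar hx
    have hρ : dd (e 2) (divg s) x
        = H x * divg s x ^ 2 - Complex.I * divg s x ^ 2 * ((pd 3 s x : ℝ) : ℂ) := by
      rw [he, dd_canonical_l, D.pd_divg hx, D.pd_divg hx, D.s_r x hx]
      simp; ring
    have hρb : dd (e 2) (divgBar s) x
        = H x * divgBar s x ^ 2 + Complex.I * divgBar s x ^ 2 * ((pd 3 s x : ℝ) : ℂ) := by
      rw [he, dd_canonical_l, D.pd_divgBar hx, D.pd_divgBar hx, D.s_r x hx]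
      simp; ring
    have hn : P x * (dd (e 2) (scale P s) x / scale P s x) = ((pd 3 P x : ℝ) : ℂ)
        + P x * (H x * divgBar s x + Complex.I * divgBar s x * ((pd 3 s x : ℝ) : ℂ)) := by
      have h1 : dd (e 2) (scale P s) x = ((pd 3 P x : ℝ) : ℂ) * divgBar s x
          + P x * (H x * divgBar s x ^ 2
            + Complex.I * divgBar s x ^ 2 * ((pd 3 s x : ℝ) : ℂ)) := by
        refine (dd_mul dPc dρb).trans ?_
        rw [hρb, he, dd_canonical_l, pd_ofReal 2 dP, pd_ofReal 3 dP, D.P_r x hx]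
        simp
      rw [mul_div_assoc', div_eq_iff (D.scale_ne hx), h1, scale]
      ring
    have hns := congrArg star hn
    have hμ : c.μ x + c.μb x = -(dd (e 2) (scale P s) x / scale P s x
        + star (dd (e 2) (scale P s) x / scale P s x)) := by
      simp only [hc, canonicalCoefs]; ring
    generalize dd (e 2) (scale P s) x / scale P s x = n at hn hns hμ
    have c2 : starRingEnd ℂ (divgBar s x) = divg s x := star_divgBar s x
    simp only [star_add, star_mul', RCLike.star_def, Complex.conj_ofReal, Complex.conj_I,
      c2] at hns hμ
    have hs : (P x : ℂ) * ((pd 3 s x : ℝ) : ℂ) = 2 * s x * ((pd 3 P x : ℝ) : ℂ) := by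
      exact_mod_cast D.s_u_eq hL hx
    -- H drops out of the defect. With Σ_u = 2ΣP_u/P and 2iΣρρ̄ = ρ̄ - ρ its bracket becomes
    -- -2(P_u/P)[(ρ² + ρ̄²) - (ρ - ρ̄)²] = -4(P_u/P)ρρ̄.
    have h1 : (m₀ : ℂ) * (divg s x * divgBar s x) * ((pd 3 P x : ℝ) : ℂ) = 0 := by
      rw [hμ] at h
      change 0 = 0 - 3 * (m₀ / 2 : ℂ) * ((divg s x + divgBar s x) * (dd (e 2) (divg s) x
        + dd (e 2) (divgBar s) x) + _ * (divg s x ^ 2 + divgBar s x ^ 2)) at h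
      rw [hρ, hρb] at h
      have tw := D.twist_divg hx
      linear_combination (-(P x : ℂ) / 6) * h
        - (m₀ / 4 : ℂ) * (divg s x ^ 2 + divgBar s x ^ 2) * (hn + hns)
        + (m₀ / 2 : ℂ) * Complex.I * divg s x * divgBar s x * (divgBar s x - divg s x) * hs
        + (m₀ / 2 : ℂ) * (divgBar s x - divg s x) * ((pd 3 P x : ℝ) : ℂ) * tw
    have h2 := (mul_eq_zero.1 h1).resolve_left
      (mul_ne_zero hm' (mul_ne_zero (D.divg_ne hx) (D.divgBar_ne hx)))
    exact_mod_cast h2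
  refine { D with P_u := P_u, L_u := hL, W_eq := fun x hx => ?_ }
  have h := hδ x hx
  change dd (e 0) (divg s) x = 0 at h
  have hs : pd 3 s x = 0 := by
    have := D.s_u_eq hL hx
    rw [P_u x hx, mul_zero] at this
    exact (mul_eq_zero.1 this).resolve_left (D.P_pos x hx).ne'
  have ds : ∀ i, pd i (fun y => (s y : ℂ)) x = ((pd i s x : ℝ) : ℂ) := fun i =>
    pd_ofReal i (differentiableAt_of_smooth hU D.smooth_s hx)
  -- The left side is δρ, now that Σ depends on neither r nor u.
  have h1 : scale P s x * divg s x ^ 2 * (W x - Complex.I * dz (fun y => (s y : ℂ)) x) = 0 := by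
    rw [he, dd_canonical_m, dz, D.pd_divg hx, D.pd_divg hx, D.pd_divg hx, D.pd_divg hx, D.s_r x hx,
      hs] at h
    rw [dz, ds, ds]
    simp at h ⊢
    grind
  exact sub_eq_zero.1 ((mul_eq_zero.1 h1).resolve_left
    (mul_ne_zero (D.scale_ne hx) (pow_ne_zero 2 (D.divg_ne hx))))

end

/-! ### Integration of the vacuum equations in r -/

theorem vacuum_mmb_clear {a b k n h h' : ℂ} (ha : a ≠ 0) (hb : b ≠ 0)
    (e : 2 * a⁻¹ * b⁻¹ * k + Complex.I * a⁻¹ * b⁻¹ * (a⁻¹ - b⁻¹) * n - h * (a⁻¹ ^ 2 + b⁻¹ ^ 2)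
      - h' * (a⁻¹ + b⁻¹) = 0) :
    2 * a * b * k + Complex.I * (b - a) * n - h * (a ^ 2 + b ^ 2) - h' * a * b * (a + b) = 0 := by
  field_simp at e
  linear_combination e

theorem vacuum_kl_clear {a b n h h' h'' : ℂ} (ha : a ≠ 0) (hb : b ≠ 0)
    (e : -h * (a⁻¹ - b⁻¹) ^ 2 + Complex.I * a⁻¹ * b⁻¹ * (a⁻¹ - b⁻¹) * n
      + (a⁻¹ + b⁻¹) * h' + h'' = 0) :
    -h * (b - a) ^ 2 + Complex.I * (b - a) * n + a * b * (a + b) * h' + a ^ 2 * b ^ 2 * h''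
      = 0 := by
  field_simp at e
  linear_combination e

namespace IsReducedData

variable {U : Set Pt} {P s : Pt → ℝ} {L W : Pt → ℂ} {H : Pt → ℝ}
  (R : IsReducedData U P s L W H) {x : Pt}
include R

/-- The mm̄ component with ρ = 1/(r + iΣ) inserted and the denominators cleared: a real first-order
linear equation for H in r. -/
theorem vacuum_mmb (hx : x ∈ U)
    (hv : frameRicci (canonicalFrame P s L W H) (reducedCoefs P s L W H).γ 0 1 x = 0) :
    nabla P (logP P) x * (rCoord x ^ 2 + s x ^ 2) + s x * nabla P s x
      - H x * (rCoord x ^ 2 - s x ^ 2) - pd 2 H x * rCoord x * (rCoord x ^ 2 + s x ^ 2) = 0 := by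
  obtain ⟨ha, hb⟩ := divg_inv_ne (R.regular x hx)
  rw [R.ricci_mmb_eq hx, pd_ofReal 2 (differentiableAt_of_smooth R.isOpen R.smooth_H hx)] at hv
  have h := vacuum_mmb_clear ha hb hv
  have : (((nabla P (logP P) x * (rCoord x ^ 2 + s x ^ 2) + s x * nabla P s x
      - H x * (rCoord x ^ 2 - s x ^ 2) - pd 2 H x * rCoord x * (rCoord x ^ 2 + s x ^ 2) : ℝ)) : ℂ)
      = 0 := by
    push_cast
    linear_combination (1 / 2) * h + ((nabla P (logP P) x : ℂ) * (s x : ℂ) ^ 2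
      + (s x : ℂ) * (nabla P s x : ℂ) + H x * (s x : ℂ) ^ 2
      - ((pd 2 H x : ℝ) : ℂ) * rCoord x * (s x : ℂ) ^ 2) * Complex.I_sq
  exact_mod_cast this

theorem vacuum_kl (hx : x ∈ U)
    (hv : frameRicci (canonicalFrame P s L W H) (reducedCoefs P s L W H).γ 3 2 x = 0) :
    4 * s x ^ 2 * H x + 2 * s x * nabla P s x
      + 2 * rCoord x * (rCoord x ^ 2 + s x ^ 2) * pd 2 H x
      + (rCoord x ^ 2 + s x ^ 2) ^ 2 * pd 2 (pd 2 H) x = 0 := by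
  have hU := R.isOpen
  obtain ⟨ha, hb⟩ := divg_inv_ne (R.regular x hx)
  have h1 : ∀ y ∈ U, pd 2 (fun z => (H z : ℂ)) y = ((pd 2 H y : ℝ) : ℂ) := fun y hy =>
    pd_ofReal 2 (differentiableAt_of_smooth hU R.smooth_H hy)
  rw [R.ricci_kl_eq hx, pd_congr hU h1 hx, h1 x hx,
    pd_ofReal 2 (differentiableAt_of_smooth hU (smooth_pd hU R.smooth_H 2) hx)] at hv
  have h := vacuum_kl_clear ha hb hv
  have h4 : ((rCoord x : ℂ) + Complex.I * (s x : ℂ)) * ((rCoord x : ℂ) - Complex.I * (s x : ℂ))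
      = (rCoord x ^ 2 + s x ^ 2 : ℂ) := by
    linear_combination -(s x : ℂ) ^ 2 * Complex.I_sq
  rw [h4, ← mul_pow, h4] at h
  have : (((4 * s x ^ 2 * H x + 2 * s x * nabla P s x
      + 2 * rCoord x * (rCoord x ^ 2 + s x ^ 2) * pd 2 H x
      + (rCoord x ^ 2 + s x ^ 2) ^ 2 * pd 2 (pd 2 H) x : ℝ)) : ℂ) = 0 := by
    push_cast
    linear_combination h + (4 * (s x : ℂ) ^ 2 * H x + 2 * (s x : ℂ) * (nabla P s x : ℂ))
      * Complex.I_sq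
  exact_mod_cast this

/-- In vacuum, `(∇(ln P) - H) (r² + Σ²) = m r + M Σ` with `m` independent of `r`. -/
theorem exists_massData
    (hv : ∀ y ∈ U, ∀ a b, ricci (canonicalMetric P s L W H) a b y = 0) :
    ∃ m, IsMassData U P s L W H m := by
  have hU := R.isOpen
  have d := fun {f : Pt → ℝ} (hf : ContDiffOn ℝ ∞ f U) {y : Pt} (hy : y ∈ U) =>
    differentiableAt_of_smooth hU hf hy
  have sl := smooth_logP R.smooth_P R.P_pos
  have sk := smooth_nabla hU R.smooth_P sl
  have kr : ∀ y ∈ U, pd 2 (nabla P (logP P)) y = 0 := fun y hy =>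
    pd_nabla_zero hU R.smooth_P sl R.P_r
      (fun z hz => pd_logP_zero hU R.smooth_P R.P_pos hz (R.P_r z hz)) hy
  have sX : ContDiffOn ℝ ∞ (fun y => rCoord y * rCoord y + s y * s y) U :=
    (smooth_rCoord.mul smooth_rCoord).add (R.smooth_s.mul R.smooth_s)
  have s1 := sk.sub R.smooth_H
  have sB := s1.mul sX
  have hX : ∀ y ∈ U, pd 2 (fun y => rCoord y * rCoord y + s y * s y) y = 2 * rCoord y := by
    intro y hy
    have dr := d smooth_rCoord hy
    have ds := d R.smooth_s hy
    rw [pd_add 2 (dr.fun_mul dr) (ds.fun_mul ds), pd_mul 2 dr dr, pd_mul 2 ds ds, R.s_r y hy,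
      pd_rCoord]
    simp
    ring
  -- The candidate for mr + MΣ. The mm̄ equation says B = r B_r + MΣ, which suggests m = B_r.
  set B : Pt → ℝ := fun y => (nabla P (logP P) y - H y) * (rCoord y * rCoord y + s y * s y) with hB
  have sH2 := smooth_pd hU R.smooth_H 2
  have hB1 : ∀ y ∈ U, pd 2 B y = 2 * (rCoord y * (nabla P (logP P) y - H y))
      - pd 2 H y * (rCoord y * rCoord y + s y * s y) := by
    intro y hy
    rw [hB, pd_mul 2 (d s1 hy) (d sX hy), pd_sub 2 (d sk hy) (d R.smooth_H hy), hX y hy, kr y hy]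
    ring
  have e1 : ∀ y ∈ U, _ := fun y hy => R.vacuum_mmb hy (R.isNullFrame.ricci_zero hy (hv y hy) 0 1)
  have e2 : ∀ y ∈ U, _ := fun y hy => R.vacuum_kl hy (R.isNullFrame.ricci_zero hy (hv y hy) 3 2)
  refine ⟨pd 2 B, { R with
    smooth_m := smooth_pd hU sB 2
    m_r := fun x hx => ?_
    H_eq := fun x hx => ?_ }⟩
  · have s2 := smooth_rCoord.mul s1
    rw [pd_congr hU hB1 hx, pd_sub 2 (d (contDiffOn_const.mul s2) hx) (d (sH2.mul sX) hx),
      pd_mul 2 (differentiableAt_const _) (d s2 hx), pd_mul 2 (d smooth_rCoord hx) (d s1 hx),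
      pd_mul 2 (d sH2 hx) (d sX hx), pd_sub 2 (d sk hx) (d R.smooth_H hx), hX x hx, kr x hx,
      pd_const, pd_rCoord]
    have h1 := e1 x hx
    have h2 := e2 x hx
    have h3 := R.regular x hx
    -- Differentiating B = r B_r + MΣ would give only r B_rr = 0. Combining the mm̄ with the kl
    -- equation gives (r² + Σ²) B_rr = 0, which also works at r = 0.
    refine (mul_eq_zero.1 (?_ : (rCoord x ^ 2 + s x ^ 2) * _ = 0)).resolve_left h3
    rw [if_pos rfl]
    linear_combination 2 * h1 - h2
  · have h1 := e1 x hx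
    have h3 := R.regular x hx
    rw [hB1 x hx, eq_sub_iff_add_eq, ← eq_sub_iff_add_eq', div_eq_iff h3]
    linear_combination h1

end IsReducedData

/-! ### The constant c and the function A -/

theorem nabla_congr {U : Set Pt} (hU : IsOpen U) {P f g : Pt → ℝ} (h : ∀ y ∈ U, f y = g y) {x : Pt}
    (hx : x ∈ U) : nabla P f x = nabla P g x := by
  have h2 : ∀ i, pd i (pd i f) x = pd i (pd i g) x := fun i =>
    pd_congr hU (fun y hy => pd_congr hU h hy i) hx i
  rw [nabla, nabla, h2, h2]

theorem eq_zero_of_pd {f : Pt → ℝ} {x : Pt} (h : ∀ i, pd i f x = 0) : fderiv ℝ f x = 0 := by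
  refine ContinuousLinearMap.coe_injective (LinearMap.pi_ext' fun i => LinearMap.ext_ring ?_)
  exact h i

/-- A vacuum metric of this form is quasi-stationary. -/
theorem IsMassData.isQuasiStationary {U : Set Pt} {P s : Pt → ℝ} {L W : Pt → ℂ} {H m : Pt → ℝ}
    (R : IsMassData U P s L W H m) (hc : IsPreconnected U)
    (hv : ∀ y ∈ U, ∀ a b, ricci (canonicalMetric P s L W H) a b y = 0) :
    ∃ (c : ℝ) (A : Pt → ℝ), IsQuasiStationary U P L A c ∧
      ∀ x ∈ U, s x = sigmaOf P L x ∧ W x = WOf P L x ∧ H x = HOf P L A c x := by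
  have hU := R.isOpen
  have F := R.isNullFrame
  have ric := fun y hy => F.ricci_zero hy (hv y hy)
  have hδ : ∀ y ∈ U, dd (canonicalFrame P s L W H 0) (complexMass P s m) y = 0 := by
    intro y hy
    have h := ric y hy 0 2
    rw [R.ricci_ml_eq hy] at h
    exact (mul_eq_zero.1 h).resolve_left (pow_ne_zero 2 (R.divg_ne hy))
  have hu : ∀ y ∈ U, pd 3 m y = nabla P (nabla P (logP P)) y := by
    intro y hy
    have h := ric y hy 2 2
    rw [R.ricci_ll_eq hδ hy] at h
    have h1 := (mul_eq_zero.1 h).resolve_left (mul_ne_zero (mul_ne_zero (by norm_num)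
      (R.divg_ne hy)) (R.divgBar_ne hy))
    exact_mod_cast sub_eq_zero.1 h1
  have hZ : ∀ y ∈ U, dz (complexMass P s m) y
      = L y * (nabla P (nabla P (logP P)) y : ℂ) := by
    intro y hy
    have h := hδ y hy
    rw [dd_canonical_m, R.mass_r hy, R.mass_u hy, hu y hy] at h
    have h1 := (mul_eq_zero.1 h).resolve_left (R.scale_ne hy)
    linear_combination h1
  have sC := smooth_nabla hU R.smooth_P R.smooth_logNabla
  have hC : ∀ i : Fin 4, ∀ y ∈ U, pd i (nabla P (nabla P (logP P))) y = 0 := by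
    have h2 : ∀ y ∈ U, pd 2 (nabla P (nabla P (logP P))) y = 0 := fun y hy =>
      pd_nabla_zero hU R.smooth_P R.smooth_logNabla R.P_r (fun _ hz => (R.pd_logNabla hz).1) hy
    have h3 : ∀ y ∈ U, pd 3 (nabla P (nabla P (logP P))) y = 0 := fun y hy =>
      pd_nabla_zero hU R.smooth_P R.smooth_logNabla R.P_u (fun _ hz => (R.pd_logNabla hz).2) hy
    -- Let C = ∇[∇(ln P)], so m_u = C and (m + iM)_ζ = LC. The u-derivative of the latter has C_ζ on
    -- the left and 0 on the right, since L and C do not depend on u; as C is real, both of its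
    -- derivatives in ζ vanish.
    have h01 : ∀ y ∈ U, pd 0 (nabla P (nabla P (logP P))) y = 0
        ∧ pd 1 (nabla P (nabla P (logP P))) y = 0 := by
      intro y hy
      have e1 := pd_congr hU hZ hy 3
      have e3 : ∀ z ∈ U, pd 3 (complexMass P s m) z = (nabla P (nabla P (logP P)) z : ℂ) :=
        fun z hz => by rw [R.mass_u hz, hu z hz]
      have d := differentiableAt_of_smooth hU sC hy
      rw [pd_mul 3 (differentiableAt_of_smooth hU R.smooth_L hy)
        (differentiableAt_of_smooth hU (smooth_ofReal sC) hy), R.L_u y hy, pd_ofReal 3 d, h3 y hy,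
        pd_dz hU R.smooth_mass hy, dz, pd_congr hU e3 hy, pd_congr hU e3 hy, pd_ofReal 0 d,
        pd_ofReal 1 d] at e1
      have h0 := congrArg Complex.re e1
      have h1 := congrArg Complex.im e1
      simp at h0 h1
      exact ⟨h0, h1⟩
    intro i y hy
    match i with
    | 0 => exact (h01 y hy).1
    | 1 => exact (h01 y hy).2
    | 2 => exact h2 y hy
    | 3 => exact h3 y hy
  -- Connectedness of U is needed here, to obtain a single constant c. Then m_u = c, and A = m - cu
  -- depends on neither r nor u.
  obtain ⟨c, hcc⟩ := hU.exists_is_const_of_fderiv_eq_zero hc (sC.differentiableOn (by simp))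
    fun y hy => eq_zero_of_pd fun i => hC i y hy
  have s3 := (contDiffOn_const (c := c)).mul (smooth_coord 3 (U := U))
  have sA := R.smooth_m.sub s3
  have hA : ∀ i, ∀ y ∈ U, pd i (fun y : Pt => m y - c * y 3) y
      = pd i m y - c * (if i = 3 then 1 else 0) := by
    intro i y hy
    rw [pd_sub i (differentiableAt_of_smooth hU R.smooth_m hy)
        (differentiableAt_of_smooth hU s3 hy),
      pd_mul i (differentiableAt_const _) (differentiableAt_of_smooth hU (smooth_coord 3) hy),
      pd_const, pd_coord]
    ring
  have hM : ∀ y ∈ U, MOf P L y = 2 * s y * nabla P (logP P) y + nabla P s y := fun y hy => by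
    rw [MOf, R.s_eq y hy, nabla_congr hU R.s_eq hy]
  have hmass : ∀ y, massOf (fun y : Pt => m y - c * y 3) c y = m y := fun y => by
    rw [massOf]; ring
  refine ⟨c, fun y => m y - c * y 3, ⟨R.smooth_P, R.smooth_L, sA, R.P_pos, fun x hx => ?_, R.P_r,
    R.P_u, R.L_r, R.L_u, fun x hx => ?_, fun x hx => ?_, hcc, fun x hx => ?_⟩,
    fun x hx => ⟨R.s_eq x hx, ?_, ?_⟩⟩
  · rw [← R.s_eq x hx]; exact R.regular x hx
  · rw [hA 2 x hx, R.m_r x hx]; simp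
  · rw [hA 3 x hx, hu x hx, hcc x hx]; simp
  · have h := hZ x hx
    rw [hcc x hx] at h
    have e : ∀ i, i ≠ 3 → pd i (fun y : Pt => ((m y - c * y 3 : ℝ) : ℂ)
        + Complex.I * (MOf P L y : ℂ)) x
        = pd i (complexMass P s m) x := by
      intro i hi
      have e1 : ∀ y ∈ U, (((m y - c * y 3 : ℝ)) : ℂ) + Complex.I * (MOf P L y : ℂ)
          = complexMass P s m y - ((c * y 3 : ℝ) : ℂ) := by
        intro y hy
        rw [hM y hy, complexMass]
        push_cast
        ring
      have dc := differentiableAt_of_smooth hU s3 hx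
      rw [pd_congr hU e1 hx, pd_sub i (differentiableAt_of_smooth hU R.smooth_mass hx)
        (differentiableAt_of_smooth hU (smooth_ofReal s3) hx), pd_ofReal i dc,
        pd_mul i (differentiableAt_const _) (differentiableAt_of_smooth hU (smooth_coord 3) hx),
        pd_const, pd_coord, if_neg hi]
      simp
    rw [dz, e 0 (by decide), e 1 (by decide), mul_comm]
    exact h.symm
  · rw [R.W_eq x hx, WOf]
    have e : ∀ i, pd i (fun y => (s y : ℂ)) x = pd i (fun y => (sigmaOf P L y : ℂ)) x := fun i =>
      pd_congr hU (fun y hy => by rw [R.s_eq y hy]) hx i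
    rw [dz, dz, e, e]
  · rw [R.H_eq x hx, HOf, hM x hx, hmass, R.s_eq x hx]

end

theorem theorem2 :
    -- any stationary diverging algebraically special vacuum metric
    (∀ (U : Set Pt) (g : Pt → Ten2) (k ξ : Pt → Fin 4 → ℝ) (r s : Pt → ℝ), IsOpen U →
      IsAlgSpecialVacuum U g k → IsDiverging U g k r s → IsStationaryFor U g k ξ →
      ∀ m₀ : ℝ,
        IsAlgSpecialVacuum U (splitMetric g k r s m₀) k ∧
        IsDiverging U (splitMetric g k r s m₀) k r s ∧
        IsStationaryFor U (splitMetric g k r s m₀) k ξ) ∧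
    -- any solution of the quasi-stationary field equations
    (∀ (U : Set Pt) (P : Pt → ℝ) (L : Pt → ℂ) (A : Pt → ℝ) (c : ℝ), IsOpen U →
      IsQuasiStationary U P L A c →
      IsCanonical U P (sigmaOf P L) L (WOf P L) (HOf P L A c) ∧
      IsAlgSpecialVacuum U (quasiMetric P L A c) kRay ∧
      IsDiverging U (quasiMetric P L A c) kRay rCoord (sigmaOf P L) ∧
      ∀ m₀ : ℝ,
        IsQuasiStationary U P L (fun x => A x + m₀) c ∧
        (∀ x ∈ U, splitMetric (quasiMetric P L A c) kRay rCoord (sigmaOf P L) m₀ x =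
          quasiMetric P L (fun x => A x + m₀) c x) ∧
        IsAlgSpecialVacuum U
          (splitMetric (quasiMetric P L A c) kRay rCoord (sigmaOf P L) m₀) kRay ∧
        IsDiverging U (splitMetric (quasiMetric P L A c) kRay rCoord (sigmaOf P L) m₀) kRay
          rCoord (sigmaOf P L)) ∧
    -- these are the most general ones which split in this way
    (∀ (U : Set Pt) (P s : Pt → ℝ) (L W : Pt → ℂ) (H : Pt → ℝ) (m₀ : ℝ), IsOpen U →
      IsPreconnected U → IsCanonical U P s L W H →
      IsAlgSpecialVacuum U (canonicalMetric P s L W H) kRay → m₀ ≠ 0 →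
      IsAlgSpecialVacuum U (splitMetric (canonicalMetric P s L W H) kRay rCoord s m₀) kRay →
      ∃ (c : ℝ) (A : Pt → ℝ), IsQuasiStationary U P L A c ∧
        ∀ x ∈ U, s x = sigmaOf P L x ∧ W x = WOf P L x ∧ H x = HOf P L A c x) := by
  refine ⟨fun U g k ξ r s hU hA hD hS m₀ => hS.split hU hA hD m₀, ?_, ?_⟩
  · intro U P L A c hU Q
    have R := Q.massData hU
    have hv := fun y hy => Q.vacuum hU (x := y) hy
    obtain ⟨h1, h2⟩ := R.algSpecial hv
    exact ⟨R.isCanonical Q.L_u, h1, h2, fun m₀ => ⟨Q.add_const m₀,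
      fun x _ => splitMetric_quasiMetric P L A c m₀ x, R.split hv m₀⟩⟩
  · intro U P s L W H m₀ hU hc hcan hA hm hA'
    obtain ⟨m, R⟩ := ((hcan.data hU (hA.metric hU)).isReducedData hm hA.vacuum
      hA'.vacuum).exists_massData hA.vacuum
    exact R.isQuasiStationary hc hA.vacuum
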